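/- Let $a,b$ be integers with $1\le a\le b$. Let $f:[0,b]\to\mathbb{R}_{\ge 0}$ be a concave, continuous, piecewise linear function with $f(0)=a\ge f(1)$ and $f(b)=0$, such that the linear segments of its graph have lattice points (points of $\mathbb{Z}^2$) as end points. Let $\Delta\subset\mathbb{R}^2$ be the convex hull of $(0,0)$ and the graph of $f$. Write $\Delta^{(1)}$ for the convex hull of the lattice points in the interior of $\Delta$. A $\mathbb{Z}$-affine transformation is a map $x\mapsto Ax+c$ with $A\in\mathrm{GL}_2(\mathbb{Z})$, $c\in\mathbb{Z}^2$; the lattice width $\mathrm{lw}(P)$ of a nonempty lattice polygon $P$ is the smallest integer $s\ge 0$ such that some $\mathbb{Z}$-affine transformation maps $P$ into the strip $\{0\le y\le s\}$, and $\mathrm{lw}(\emptyset)=-1$. Then $\Delta$ is not the image under a $\mathbb{Z}$-affine transformation of $2\Upsilon=2\,\mathrm{Conv}\{(-1,-1),(1,0),(0,1)\}$, and there exist a regular subdivision $\Delta_1,\dots,\Delta_r$ of $\Delta$ and a convex piecewise linear function $v:\Delta\to\mathbb{R}$ realizing it (that is, $\Delta_1,\dots,\Delta_r$ are two-dimensional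 lattice polygons covering $\Delta$, and are precisely the maximal closed convex subsets of $\Delta$ on which $v$ is affine), with $v(\Delta\cap\mathbb{Z}^2)\subset\mathbb{Z}$, such that the following hold. (1) Let $\Gamma(\Delta_1,\dots,\Delta_r)$ be the metric graph with vertices $v_1,\dots,v_r$ and with, for $\ell\ne m$, exactly $L(\ell,m)$ edges between $v_\ell$ and $v_m$, all of length one, where $L(\ell,m)$ is the number of lattice points of $\Delta_\ell\cap\Delta_m$ minus one (and $0$ if there is no such point). Its gonality, i.e. the minimal degree of a divisor of rank one, equals $\mathrm{lw}(\Delta^{(1)})+2$. (2) Let $(n_\ell,1)$ with $n_\ell\in\mathbb{Z}^2$ be the normal vector to the graph of $v$ over $\Delta_\ell$, and let $d(\ell,m)$ be the greatest common divisor of the $2\times 2$ minors of the matrix with rows $(n_\ell,1)$ and $(n_m,1)$. Then $d(\ell,m)=1$ whenever $\ell\neq m$ and $L(\ell,m)\ge 1$. (3) The metric graph $\Gamma(v)$, obtained from $\Gamma(\Delta_1,\dots,\Delta_r)$ by replacing every edge between $v_\ell$ and $v_m$ by a chain of $d(\ell,m)$ edges of length one, also has gonality $\mathrm{lw}(\Delta^{(1)})+2$.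 -/

import Mathlib

open Set Filter Topology

noncomputable section

/-! ### Lattice polygons in the plane -/

/-- The plane `ℝ²`. -/
abbrev Plane : Type := ℝ × ℝ

/-- The lattice `ℤ²`, embedded in the plane. -/
def latticePoint (z : ℤ × ℤ) : Plane := ((z.1 : ℝ), (z.2 : ℝ))

/-- The set of lattice points of the plane. -/
def latticePoints : Set Plane := Set.range latticePoint

/-- A lattice polygon (of any dimension, possibly empty): the convex hull of finitely many
lattice points. It is two-dimensional when its interior is nonempty. -/
def IsLatticePolygon (S : Set Plane) : Prop :=
  ∃ F : Finset (ℤ × ℤ), S = convexHull ℝ (latticePoint '' (F : Set (ℤ × ℤ)))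

/-- The `ℤ`-affine transformation `x ↦ A x + c` with `A ∈ GL₂(ℤ)` and `c ∈ ℤ²`. -/
def zAffine (A : Matrix.GeneralLinearGroup (Fin 2) ℤ) (c : ℤ × ℤ) (p : Plane) : Plane :=
  (((A.val 0 0 : ℤ) : ℝ) * p.1 + ((A.val 0 1 : ℤ) : ℝ) * p.2 + (c.1 : ℝ),
   ((A.val 1 0 : ℤ) : ℝ) * p.1 + ((A.val 1 1 : ℤ) : ℝ) * p.2 + (c.2 : ℝ))

/-- Equivalence of polygons under `ℤ`-affine transformations. -/
def LatticeEquiv (S T : Set Plane) : Prop :=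
  ∃ (A : Matrix.GeneralLinearGroup (Fin 2) ℤ) (c : ℤ × ℤ), zAffine A c '' S = T

open Classical in
/-- The lattice width: `-1` for the empty polygon, and otherwise the smallest integer `s ≥ 0` such
that some `ℤ`-affine transformation maps the polygon into the strip `0 ≤ y ≤ s`. -/
def latticeWidth (S : Set Plane) : ℤ :=
  if S = ∅ then -1
  else ((sInf {s : ℕ | ∃ (A : Matrix.GeneralLinearGroup (Fin 2) ℤ) (c : ℤ × ℤ),
    ∀ p ∈ S, 0 ≤ (zAffine A c p).2 ∧ (zAffine A c p).2 ≤ (s : ℝ)} : ℕ) : ℤ)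

/-- The interior lattice polygon: the convex hull of the interior lattice points. -/
def interiorPolygon (S : Set Plane) : Set Plane :=
  convexHull ℝ (interior S ∩ latticePoints)

/-- The triangle with vertices `(-1,-1)`, `(1,0)`, `(0,1)`. -/
def upsilon : Set Plane := convexHull ℝ {((-1 : ℝ), (-1 : ℝ)), ((1 : ℝ), (0 : ℝ)), ((0 : ℝ), (1 : ℝ))}

/-- The Minkowski double of `upsilon`. -/
def twoUpsilon : Set Plane := (fun p : Plane => (2 : ℝ) • p) '' upsilon

/-! ### Metric graphs and their divisors -/

/-- A finite multigraph with positive edge lengths, presented by (arbitrarily oriented) edges.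
It stands for the metric graph in which the edge `e` is a segment `[0, length e]`
running from `src e` to `tgt e`. -/
structure MetricGraph where
  V : Type
  E : Type
  [fintypeV : Fintype V]
  [fintypeE : Fintype E]
  src : E → V
  tgt : E → V
  length : E → ℝ
  length_pos : ∀ e, 0 < length e

attribute [instance] MetricGraph.fintypeV MetricGraph.fintypeE

namespace MetricGraph

variable (Γ : MetricGraph)

/-- The points of the metric graph: the vertices, and the interior points of the edges. -/
abbrev Point : Type := Γ.V ⊕ (Σ e : Γ.E, Set.Ioo (0 : ℝ) (Γ.length e))

/-- The parametrization of the closed edge `e` by the segment `[0, length e]` (extended to be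
constant on both sides of the segment). -/
def edge (e : Γ.E) (t : ℝ) : Γ.Point :=
  if h : 0 < t ∧ t < Γ.length e then Sum.inr ⟨e, ⟨t, h⟩⟩
  else if t ≤ 0 then Sum.inl (Γ.src e) else Sum.inl (Γ.tgt e)

/-- The continuous functions on the metric graph whose restriction to each edge is piecewise linear
with integer slopes and finitely many pieces. As the graph is obtained by gluing
finitely many segments, continuity is continuity on each closed edge. -/
def IsRational (φ : Γ.Point → ℝ) : Prop :=
  ∀ e : Γ.E, ContinuousOn (fun t => φ (Γ.edge e t)) (Set.Icc 0 (Γ.length e)) ∧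
    ∃ P : Finset ℝ, ∀ s t : ℝ, 0 ≤ s → s < t → t ≤ Γ.length e → (∀ x ∈ P, x ∉ Set.Ioo s t) →
      ∃ m : ℤ, ∀ x ∈ Set.Icc s t, φ (Γ.edge e x) = φ (Γ.edge e s) + (m : ℝ) * (x - s)

open Classical in
/-- `ord φ p` is the sum of the incoming slopes of `φ` at `p`. -/
def ord (φ : Γ.Point → ℝ) : Γ.Point → ℝ
  | Sum.inl x => ∑ e : Γ.E,
      ((if Γ.src e = x then - derivWithin (fun t => φ (Γ.edge e t)) (Set.Ioi 0) 0 else 0) +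
       (if Γ.tgt e = x then
          derivWithin (fun t => φ (Γ.edge e t)) (Set.Iio (Γ.length e)) (Γ.length e) else 0))
  | Sum.inr ⟨e, t⟩ =>
      derivWithin (fun s => φ (Γ.edge e s)) (Set.Iio t.1) t.1 -
        derivWithin (fun s => φ (Γ.edge e s)) (Set.Ioi t.1) t.1

/-- Divisors: the free abelian group on the points of the metric graph. -/
abbrev Divisor : Type := Γ.Point →₀ ℤ

variable {Γ}

/-- The degree of a divisor. -/
def Divisor.deg (D : Γ.Divisor) : ℤ := D.sum fun _ n => n

/-- Effective divisors. -/
def Divisor.IsEffective (D : Γ.Divisor) : Prop := ∀ p, 0 ≤ D p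

/-- `D ∼ D'` when `D' - D = div φ` for some `φ`. -/
def Divisor.IsEquivalent (D D' : Γ.Divisor) : Prop :=
  ∃ φ : Γ.Point → ℝ, Γ.IsRational φ ∧ ∀ p, (((D' - D) p : ℤ) : ℝ) = Γ.ord φ p

/-- The complete linear system `|D|`. -/
def Divisor.linearSystem (D : Γ.Divisor) : Set Γ.Divisor :=
  {D' | Divisor.IsEffective D' ∧ Divisor.IsEquivalent D D'}

/-- `r(D) ≥ k`, for `k ≥ 0`. -/
def Divisor.RankGE (D : Γ.Divisor) (k : ℕ) : Prop :=
  ∀ E : Γ.Divisor, Divisor.IsEffective E → Divisor.deg E = (k : ℤ) →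
    (Divisor.linearSystem (D - E)).Nonempty

/-- `r(D) = k`, for `k ≥ 0`. -/
def Divisor.HasRank (D : Γ.Divisor) (k : ℕ) : Prop :=
  Divisor.RankGE D k ∧ ¬ Divisor.RankGE D (k + 1)

variable (Γ)

/-- `n` is the gonality: the minimal degree of a divisor of rank one. -/
def IsGonality (n : ℤ) : Prop :=
  IsLeast {d : ℤ | ∃ D : Γ.Divisor, Divisor.HasRank D 1 ∧ Divisor.deg D = d} n

end MetricGraph

/-! ### Regular subdivisions and their metric graphs -/

/-- `T` is a closed convex subset of `S` on which `v` is linear (that is, affine). -/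
def IsLinearityDomain (S : Set Plane) (v : Plane → ℝ) (T : Set Plane) : Prop :=
  T ⊆ S ∧ IsClosed T ∧ Convex ℝ T ∧
    ∃ α β γ : ℝ, ∀ p ∈ T, v p = α * p.1 + β * p.2 + γ

/-- A regular subdivision of `S`, together with a function realizing it: the cells are
two-dimensional lattice polygons that cover `S`, and they are, without repetition, the maximal
domains of linearity of the convex function `v` on `S`. -/
structure RegularSubdivision (S : Set Plane) where
  r : ℕ
  cell : Fin r → Set Plane
  v : Plane → ℝ
  isLatticePolygon : ∀ i, IsLatticePolygon (cell i)
  interior_nonempty : ∀ i, (interior (cell i)).Nonempty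
  cover : ⋃ i, cell i = S
  convexOn : ConvexOn ℝ S v
  injective : Function.Injective cell
  maximal_iff : ∀ T : Set Plane, (∃ i, cell i = T) ↔ Maximal (IsLinearityDomain S v) T

namespace RegularSubdivision

variable {S : Set Plane} (R : RegularSubdivision S)

/-- The realizing function takes integer values at the lattice points of `S`. -/
def IsIntegral : Prop := ∀ z : ℤ × ℤ, latticePoint z ∈ S → ∃ n : ℤ, R.v (latticePoint z) = (n : ℝ)

/-- `(a.1, a.2, 1)` is a normal vector to the graph of `v` over the cell `i`. -/
def IsNormal (i : Fin R.r) (a : ℤ × ℤ) : Prop :=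
  ∃ c : ℝ, ∀ p ∈ R.cell i, (a.1 : ℝ) * p.1 + (a.2 : ℝ) * p.2 + R.v p = c

/-- The integral length of the intersection of two cells: its number of lattice points minus one
(and `0` if the intersection contains no lattice point). -/
def intersectionLength (i j : Fin R.r) : ℕ :=
  (R.cell i ∩ R.cell j ∩ latticePoints).ncard - 1

/-- The multigraph with one vertex for each cell, and with as many edges between two cells as the
integral length of their intersection; the edges between the cells `i` and `j` have length
`len i j`. -/
def dualGraph (len : Fin R.r → Fin R.r → ℝ) (hlen : ∀ i j, i < j → 0 < len i j) :
    MetricGraph where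
  V := Fin R.r
  E := Σ p : {p : Fin R.r × Fin R.r // p.1 < p.2}, Fin (R.intersectionLength p.1.1 p.1.2)
  src e := e.1.1.1
  tgt e := e.1.1.2
  length e := len e.1.1.1 e.1.1.2
  length_pos e := hlen _ _ e.1.2

/-- The metric graph of the subdivision, all of whose edges have length one. -/
def metricGraph : MetricGraph := R.dualGraph (fun _ _ => 1) (fun _ _ _ => one_pos)

end RegularSubdivision

/-- The greatest common divisor of the `2 × 2` minors of the matrix with rows
`(a.1, a.2, 1)` and `(b.1, b.2, 1)`. -/
def minorsGcd (a b : ℤ × ℤ) : ℕ :=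
  Nat.gcd (a.1 * b.2 - a.2 * b.1).natAbs (Nat.gcd (a.1 - b.1).natAbs (a.2 - b.2).natAbs)

theorem minorsGcd_pos {a b : ℤ × ℤ} (h : a ≠ b) : 0 < minorsGcd a b := by
  rcases Nat.eq_zero_or_pos (minorsGcd a b) with h0 | h0
  · exfalso
    unfold minorsGcd at h0
    have h1 := (Nat.gcd_eq_zero_iff.1 h0).2
    have h2 := Nat.gcd_eq_zero_iff.1 h1
    exact h (Prod.ext (by omega) (by omega))
  · exact h0

namespace RegularSubdivision

variable {S : Set Plane} (R : RegularSubdivision S)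

theorem isLinearityDomain_cell (i : Fin R.r) : IsLinearityDomain S R.v (R.cell i) :=
  ((R.maximal_iff _).1 ⟨i, rfl⟩).prop

/-- The affine function of a cell is a lower bound for the convex function `v`. -/
theorem le_of_isNormal {i : Fin R.r} {a : ℤ × ℤ} {c : ℝ}
    (h : ∀ p ∈ R.cell i, (a.1 : ℝ) * p.1 + (a.2 : ℝ) * p.2 + R.v p = c) {p : Plane} (hp : p ∈ S) :
    c ≤ (a.1 : ℝ) * p.1 + (a.2 : ℝ) * p.2 + R.v p := by
  obtain ⟨q, hq⟩ := R.interior_nonempty i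
  have hcont : Tendsto (fun t : ℝ => (1 - t) • q + t • p) (𝓝[>] 0) (𝓝 q) := by
    have h1 : Continuous (fun t : ℝ => (1 - t) • q + t • p) := by fun_prop
    have h2 := h1.tendsto 0
    simp only [sub_zero, one_smul, zero_smul, add_zero] at h2
    exact h2.mono_left nhdsWithin_le_nhds
  have hev := hcont.eventually (mem_interior_iff_mem_nhds.1 hq)
  have hlt : ∀ᶠ t : ℝ in 𝓝[>] 0, t < 1 := nhdsWithin_le_nhds (Iio_mem_nhds one_pos)
  obtain ⟨t, ht1, ht2, ht3⟩ := (hev.and (hlt.and self_mem_nhdsWithin)).exists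
  have ht3 : 0 < t := ht3
  have hqc : q ∈ R.cell i := interior_subset hq
  have hqS : q ∈ S := (R.isLinearityDomain_cell i).1 hqc
  have e1 := h q hqc
  have e2 := h _ ht1
  have e3 := R.convexOn.2 hqS hp (by linarith : (0 : ℝ) ≤ 1 - t) ht3.le (by ring)
  simp only [Prod.fst_add, Prod.smul_fst, Prod.snd_add, Prod.smul_snd, smul_eq_mul] at e2 e3
  have key : 0 ≤ t * ((a.1 : ℝ) * p.1 + (a.2 : ℝ) * p.2 + R.v p - c) := by
    linear_combination e3 - e2 + (1 - t) * e1
  have := nonneg_of_mul_nonneg_right key ht3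
  linarith

theorem normal_ne {i j : Fin R.r} (hij : i ≠ j) {a b : ℤ × ℤ} (ha : R.IsNormal i a)
    (hb : R.IsNormal j b) : a ≠ b := by
  rintro rfl
  obtain ⟨c, hc⟩ := ha
  obtain ⟨d, hd⟩ := hb
  obtain ⟨Fi, hFi⟩ := R.isLatticePolygon i
  obtain ⟨Fj, hFj⟩ := R.isLatticePolygon j
  have hcd : c = d := by
    obtain ⟨p, hp⟩ := R.interior_nonempty i
    obtain ⟨q, hq⟩ := R.interior_nonempty j
    have hp := interior_subset hp
    have hq := interior_subset hq
    have h1 := R.le_of_isNormal hc ((R.isLinearityDomain_cell j).1 hq)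
    have h2 := R.le_of_isNormal hd ((R.isLinearityDomain_cell i).1 hp)
    rw [hd q hq] at h1
    rw [hc p hp] at h2
    exact le_antisymm h1 h2
  subst hcd
  set T : Set Plane := convexHull ℝ (latticePoint '' (Fi ∪ Fj : Set (ℤ × ℤ))) with hT
  have hiT : R.cell i ⊆ T := by
    rw [hFi]; exact convexHull_mono (Set.image_mono Set.subset_union_left)
  have hjT : R.cell j ⊆ T := by
    rw [hFj]; exact convexHull_mono (Set.image_mono Set.subset_union_right)
  have hconv : Convex ℝ {p | p ∈ S ∧ (a.1 : ℝ) * p.1 + (a.2 : ℝ) * p.2 + R.v p ≤ c} := by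
    intro p hp q hq s t hs ht hst
    refine ⟨R.convexOn.1 hp.1 hq.1 hs ht hst, ?_⟩
    have e := R.convexOn.2 hp.1 hq.1 hs ht hst
    have h1 := mul_le_mul_of_nonneg_left hp.2 hs
    have h2 := mul_le_mul_of_nonneg_left hq.2 ht
    have h3 : s * c + t * c = c := by rw [← add_mul, hst, one_mul]
    simp only [Prod.fst_add, Prod.smul_fst, Prod.snd_add, Prod.smul_snd, smul_eq_mul] at e ⊢
    linarith
  have hTsub : T ⊆ {p | p ∈ S ∧ (a.1 : ℝ) * p.1 + (a.2 : ℝ) * p.2 + R.v p ≤ c} := by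
    refine convexHull_min ?_ hconv
    rintro _ ⟨z, hz | hz, rfl⟩
    · have hz' : latticePoint z ∈ R.cell i := by
        rw [hFi]; exact subset_convexHull ℝ _ ⟨z, hz, rfl⟩
      exact ⟨(R.isLinearityDomain_cell i).1 hz', (hc _ hz').le⟩
    · have hz' : latticePoint z ∈ R.cell j := by
        rw [hFj]; exact subset_convexHull ℝ _ ⟨z, hz, rfl⟩
      exact ⟨(R.isLinearityDomain_cell j).1 hz', (hd _ hz').le⟩
  have hdom : IsLinearityDomain S R.v T := by
    refine ⟨fun p hp => (hTsub hp).1, ?_, convex_convexHull ℝ _, -(a.1 : ℝ), -(a.2 : ℝ), c, ?_⟩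
    · exact (((Fi.finite_toSet.union Fj.finite_toSet).image _).isCompact_convexHull (𝕜 := ℝ)).isClosed
    · intro p hp
      have h1 := (hTsub hp).2
      have h2 := R.le_of_isNormal hc (hTsub hp).1
      linarith
  have h1 : T ⊆ R.cell i := ((R.maximal_iff _).1 ⟨i, rfl⟩).2 hdom hiT
  have h2 : T ⊆ R.cell j := ((R.maximal_iff _).1 ⟨j, rfl⟩).2 hdom hjT
  exact hij (R.injective (Set.Subset.antisymm (hiT.trans h2) (hjT.trans h1)))

/-- The metric graph of the realizing function `v`: every edge of the graph of the subdivision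
between the cells `i` and `j` is replaced by a chain of `minorsGcd (a i) (a j)` segments of length
one, that is, by a segment of that length. Here `(a i, 1)` is the normal vector
to the graph of `v` over the cell `i`. -/
def metricGraphOfNormals (a : Fin R.r → ℤ × ℤ) (ha : ∀ i, R.IsNormal i (a i)) : MetricGraph :=
  R.dualGraph (fun i j => (minorsGcd (a i) (a j) : ℝ))
    (fun i j hij => Nat.cast_pos.2 (minorsGcd_pos (R.normal_ne hij.ne (ha i) (ha j))))

end RegularSubdivision

/-! ### The family of polygons -/

/-- `f` is continuous and piecewise linear on `[0, b]`, and the end points of the finitely many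
segments of its graph are lattice points. -/
def IsLatticePiecewiseLinear (f : ℝ → ℝ) (b : ℤ) : Prop :=
  ∃ (n : ℕ) (x y : ℕ → ℤ), x 0 = 0 ∧ x n = b ∧ (∀ i < n, x i < x (i + 1)) ∧
    (∀ i ≤ n, f (x i : ℝ) = (y i : ℝ)) ∧
    ∀ i < n, ∃ m c : ℝ, ∀ t ∈ Set.Icc (x i : ℝ) (x (i + 1) : ℝ), f t = m * t + c

/-- The convex hull of the origin and the graph of `f` over `[0, b]`. -/
def hullOfGraph (f : ℝ → ℝ) (b : ℤ) : Set Plane :=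
  convexHull ℝ (insert ((0 : ℝ), (0 : ℝ)) ((fun t : ℝ => (t, f t)) '' Set.Icc (0 : ℝ) (b : ℝ)))

end

/-! The polygon Δ lies in the positive quadrant and, as `f` is concave and `a ≤ b`, contains the
part of the quadrant where x + y ≤ a. It is cut along the lines x + y = k for k = 1, …, N. Here N =
a, unless Δ is the triangle x + y ≤ a itself; then N = a - 1, since nothing of Δ lies beyond x + y =
a (`exists_extendsTriangle`). The cutting function is the sum of the max(0, x + y - k). Its gradient
on the k-th strip is (k, k), so normals of adjacent strips differ by (1, 1) up to sign and every gcd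
is 1. The strips k and k + 1 share k + 2 lattice points, so the dual graph is a path 0, …, N with k
+ 1 parallel edges between k and k + 1.

Such a path has gonality max(N, 1) for arbitrary edge lengths (`isGonality_of_path`), which settles
both metric graphs at once. For the upper bound, put one chip on each of the vertices 1, …, N (on
the only vertex if N = 0). Two chips at the ends of an edge move symmetrically inwards, and the chip
at 1 slides along the bridge to 0.

For the lower bound (`Divisor.RankGE.le_deg_of_path`), suppose that D has positive rank and degree
less than N. By induction from the thick end N of the path, all rational functions between members
of |D| take one common value on the last vertices. If the next vertex k = N - h - 1 had another
value, truncating at an intermediate level would put a chip inside each of the N - h edges leaving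
k, while the h vertices N - h + 1, …, N keep a chip each; this makes N chips. So these functions are
constant on all vertices, and then some member of |D| has a chip at each of the N + 1 vertices, a
contradiction.

On the side of the lattice width, the interior lattice points satisfy 1 ≤ y ≤ N - 1, and for N ≥ 2
they include the corners of the triangle with vertices (1, 1), (N - 1, 1), (1, N - 1), of width N -
2. For N < 2 there are none, and the value -1 for the empty polygon agrees with max(N, 1) - 2.

Finally, Δ has a corner spanned by the two axes, whereas the edges of 2Υ have lattice length 2 and
span determinant ±12 rather than a divisor of 4 at each corner. -/

/-! ### Piecewise linear functions on a segment -/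

/-- Continuous piecewise linear functions with integer slopes on `[0, L]`. -/
def IsPL (h : ℝ → ℝ) (L : ℝ) : Prop :=
  ContinuousOn h (Set.Icc 0 L) ∧
    ∃ P : Finset ℝ, ∀ s t : ℝ, 0 ≤ s → s < t → t ≤ L → (∀ x ∈ P, x ∉ Set.Ioo s t) →
      ∃ m : ℤ, ∀ x ∈ Set.Icc s t, h x = h s + (m : ℝ) * (x - s)

/-- `h` is linear with slope `m` immediately to the right of `x`. -/
def RightSlope (h : ℝ → ℝ) (x m : ℝ) : Prop := ∀ᶠ z in 𝓝[>] x, h z = h x + m * (z - x)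

/-- `h` is linear with slope `m` immediately to the left of `x`. -/
def LeftSlope (h : ℝ → ℝ) (x m : ℝ) : Prop := ∀ᶠ z in 𝓝[<] x, h z = h x + m * (z - x)

theorem hasDerivWithinAt_line (y m x : ℝ) (s : Set ℝ) :
    HasDerivWithinAt (fun z => y + m * (z - x)) m s x := by
  have h : HasDerivAt (fun z : ℝ => y + m * (z - x)) (m * 1) x :=
    (((hasDerivAt_id x).sub_const x).const_mul m).const_add y
  rw [mul_one] at h
  exact h.hasDerivWithinAt

theorem RightSlope.derivWithin_eq {h : ℝ → ℝ} {x m : ℝ} (H : RightSlope h x m) :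
    derivWithin h (Ioi x) x = m :=
  ((hasDerivWithinAt_line (h x) m x (Ioi x)).congr_of_eventuallyEq H (by simp)).derivWithin
    (uniqueDiffWithinAt_Ioi x)

theorem LeftSlope.derivWithin_eq {h : ℝ → ℝ} {x m : ℝ} (H : LeftSlope h x m) :
    derivWithin h (Iio x) x = m :=
  ((hasDerivWithinAt_line (h x) m x (Iio x)).congr_of_eventuallyEq H (by simp)).derivWithin
    (uniqueDiffWithinAt_Iio x)

theorem RightSlope.add {h g : ℝ → ℝ} {x m n : ℝ} (H : RightSlope h x m) (G : RightSlope g x n) :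
    RightSlope (fun z => h z + g z) x (m + n) := by
  filter_upwards [H, G] with z h1 h2
  rw [h1, h2]; ring

theorem LeftSlope.add {h g : ℝ → ℝ} {x m n : ℝ} (H : LeftSlope h x m) (G : LeftSlope g x n) :
    LeftSlope (fun z => h z + g z) x (m + n) := by
  filter_upwards [H, G] with z h1 h2
  rw [h1, h2]; ring

theorem RightSlope.neg {h : ℝ → ℝ} {x m : ℝ} (H : RightSlope h x m) :
    RightSlope (fun z => - h z) x (-m) := by
  filter_upwards [H] with z h1
  rw [h1]; ring

theorem LeftSlope.neg {h : ℝ → ℝ} {x m : ℝ} (H : LeftSlope h x m) :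
    LeftSlope (fun z => - h z) x (-m) := by
  filter_upwards [H] with z h1
  rw [h1]; ring

theorem rightSlope_const (c x : ℝ) : RightSlope (fun _ => c) x 0 :=
  Eventually.of_forall fun _ => by ring

theorem leftSlope_const (c x : ℝ) : LeftSlope (fun _ => c) x 0 :=
  Eventually.of_forall fun _ => by ring

theorem tendsto_line (y m x : ℝ) (s : Set ℝ) :
    Tendsto (fun z => y + m * (z - x)) (𝓝[s] x) (𝓝 y) := by
  have h : Continuous (fun z => y + m * (z - x)) := by fun_prop
  simpa using (h.tendsto x).mono_left nhdsWithin_le_nhds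

theorem RightSlope.min_of_lt {h : ℝ → ℝ} {x m c : ℝ} (H : RightSlope h x m) (hc : h x < c) :
    RightSlope (fun z => min (h z) c) x m := by
  filter_upwards [H, (tendsto_line (h x) m x (Ioi x)).eventually (gt_mem_nhds hc)] with z h1 h2
  rw [min_eq_left (by linarith), min_eq_left hc.le, h1]

theorem LeftSlope.min_of_lt {h : ℝ → ℝ} {x m c : ℝ} (H : LeftSlope h x m) (hc : h x < c) :
    LeftSlope (fun z => min (h z) c) x m := by
  filter_upwards [H, (tendsto_line (h x) m x (Iio x)).eventually (gt_mem_nhds hc)] with z h1 h2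
  rw [min_eq_left (by linarith), min_eq_left hc.le, h1]

theorem RightSlope.min_of_gt {h : ℝ → ℝ} {x m c : ℝ} (H : RightSlope h x m) (hc : c < h x) :
    RightSlope (fun z => min (h z) c) x 0 := by
  filter_upwards [H, (tendsto_line (h x) m x (Ioi x)).eventually (lt_mem_nhds hc)] with z h1 h2
  rw [min_eq_right (by linarith), min_eq_right hc.le]; ring

theorem LeftSlope.min_of_gt {h : ℝ → ℝ} {x m c : ℝ} (H : LeftSlope h x m) (hc : c < h x) :
    LeftSlope (fun z => min (h z) c) x 0 := by
  filter_upwards [H, (tendsto_line (h x) m x (Iio x)).eventually (lt_mem_nhds hc)] with z h1 h2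
  rw [min_eq_right (by linarith), min_eq_right hc.le]; ring

/-- At the level itself, truncation keeps only the directions in which `h` goes down: negative
slopes to the right, positive slopes to the left. This accounts for `min` here and `max` in the
left-hand version, and it makes the left slope minus the right slope nonnegative after truncation.
-/
theorem RightSlope.min_of_eq {h : ℝ → ℝ} {x m c : ℝ} (H : RightSlope h x m) (hc : h x = c) :
    RightSlope (fun z => min (h z) c) x (min m 0) := by
  filter_upwards [H, self_mem_nhdsWithin] with z h1 h2
  have h2 : x < z := h2
  rw [h1, hc, min_self]
  rcases le_total m 0 with h3 | h3
  · rw [min_eq_left h3, min_eq_left]; nlinarith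
  · rw [min_eq_right h3, min_eq_right (by nlinarith)]; ring

theorem LeftSlope.min_of_eq {h : ℝ → ℝ} {x m c : ℝ} (H : LeftSlope h x m) (hc : h x = c) :
    LeftSlope (fun z => min (h z) c) x (max m 0) := by
  filter_upwards [H, self_mem_nhdsWithin] with z h1 h2
  have h2 : z < x := h2
  rw [h1, hc, min_self]
  rcases le_total m 0 with h3 | h3
  · rw [max_eq_right h3, min_eq_right (by nlinarith)]; ring
  · rw [max_eq_left h3, min_eq_left]; nlinarith

theorem rightSlope_of_Icc {h : ℝ → ℝ} {x y m : ℝ} (hxy : x < y)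
    (H : ∀ z ∈ Icc x y, h z = h x + m * (z - x)) : RightSlope h x m := by
  filter_upwards [Ioo_mem_nhdsGT hxy] with z hz
  exact H z ⟨hz.1.le, hz.2.le⟩

theorem leftSlope_of_Icc {h : ℝ → ℝ} {x y m : ℝ} (hxy : x < y)
    (H : ∀ z ∈ Icc x y, h z = h x + m * (z - x)) : LeftSlope h y m := by
  filter_upwards [Ioo_mem_nhdsLT hxy] with z hz
  rw [H z ⟨hz.1.le, hz.2.le⟩, H y ⟨hxy.le, le_rfl⟩]; ring

theorem exists_right_gap (P : Finset ℝ) {x L : ℝ} (hx : x < L) :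
    ∃ y, x < y ∧ y ≤ L ∧ ∀ p ∈ P, p ∉ Ioo x y := by
  classical
  have hne : (insert L (P.filter (x < ·))).Nonempty := ⟨L, Finset.mem_insert_self _ _⟩
  refine ⟨(insert L (P.filter (x < ·))).min' hne, ?_, Finset.min'_le _ _ (Finset.mem_insert_self _ _), ?_⟩
  · rw [Finset.lt_min'_iff]
    intro y hy
    rcases Finset.mem_insert.1 hy with rfl | hy
    · exact hx
    · exact (Finset.mem_filter.1 hy).2
  · intro p hp hpx
    exact absurd (Finset.min'_le _ p (Finset.mem_insert_of_mem (Finset.mem_filter.2 ⟨hp, hpx.1⟩)))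
      (not_le.2 hpx.2)

theorem exists_left_gap (P : Finset ℝ) {x L : ℝ} (hx : L < x) :
    ∃ y, y < x ∧ L ≤ y ∧ ∀ p ∈ P, p ∉ Ioo y x := by
  classical
  have hne : (insert L (P.filter (· < x))).Nonempty := ⟨L, Finset.mem_insert_self _ _⟩
  refine ⟨(insert L (P.filter (· < x))).max' hne, ?_, Finset.le_max' _ _ (Finset.mem_insert_self _ _), ?_⟩
  · rw [Finset.max'_lt_iff]
    intro y hy
    rcases Finset.mem_insert.1 hy with rfl | hy
    · exact hx
    · exact (Finset.mem_filter.1 hy).2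
  · intro p hp hpx
    exact absurd (Finset.le_max' _ p (Finset.mem_insert_of_mem (Finset.mem_filter.2 ⟨hp, hpx.2⟩)))
      (not_le.2 hpx.1)

theorem IsPL.exists_rightSlope {h : ℝ → ℝ} {L : ℝ} (H : IsPL h L) {x : ℝ} (h0 : 0 ≤ x)
    (hx : x < L) : ∃ m : ℤ, RightSlope h x m := by
  obtain ⟨-, P, hP⟩ := H
  obtain ⟨y, hxy, hyL, hy⟩ := exists_right_gap P hx
  obtain ⟨m, hm⟩ := hP x y h0 hxy hyL hy
  exact ⟨m, rightSlope_of_Icc hxy hm⟩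

theorem IsPL.exists_leftSlope {h : ℝ → ℝ} {L : ℝ} (H : IsPL h L) {x : ℝ} (h0 : 0 < x)
    (hx : x ≤ L) : ∃ m : ℤ, LeftSlope h x m := by
  obtain ⟨-, P, hP⟩ := H
  obtain ⟨y, hyx, hy0, hy⟩ := exists_left_gap P h0
  obtain ⟨m, hm⟩ := hP y x hy0 hyx hx hy
  exact ⟨m, leftSlope_of_Icc hyx hm⟩

/-! ### Operations preserving piecewise linearity -/

theorem isPL_linear (c : ℝ) (m : ℤ) (L : ℝ) : IsPL (fun t => c + m * t) L :=
  ⟨by fun_prop, ∅, fun s t _ _ _ _ => ⟨m, fun x _ => by ring⟩⟩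

theorem isPL_const (c L : ℝ) : IsPL (fun _ => c) L := by
  simpa using isPL_linear c 0 L

theorem IsPL.add {h g : ℝ → ℝ} {L : ℝ} (H : IsPL h L) (G : IsPL g L) :
    IsPL (fun t => h t + g t) L := by
  classical
  obtain ⟨hc, P, hP⟩ := H
  obtain ⟨gc, Q, hQ⟩ := G
  refine ⟨hc.add gc, P ∪ Q, fun s t h0 hst htL hPQ => ?_⟩
  obtain ⟨m, hm⟩ := hP s t h0 hst htL fun x hx => hPQ x (Finset.mem_union_left _ hx)
  obtain ⟨n, hn⟩ := hQ s t h0 hst htL fun x hx => hPQ x (Finset.mem_union_right _ hx)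
  refine ⟨m + n, fun x hx => ?_⟩
  beta_reduce
  rw [hm x hx, hn x hx]; push_cast; ring

theorem IsPL.neg {h : ℝ → ℝ} {L : ℝ} (H : IsPL h L) : IsPL (fun t => - h t) L := by
  obtain ⟨hc, P, hP⟩ := H
  refine ⟨hc.neg, P, fun s t h0 hst htL hPQ => ?_⟩
  obtain ⟨m, hm⟩ := hP s t h0 hst htL hPQ
  refine ⟨-m, fun x hx => ?_⟩
  beta_reduce
  rw [hm x hx]; push_cast; ring

theorem IsPL.min_const {h : ℝ → ℝ} {L : ℝ} (H : IsPL h L) (c : ℝ) :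
    IsPL (fun t => min (h t) c) L := by
  classical
  obtain ⟨hc, P, hP⟩ := H
  refine ⟨(continuous_id.min continuous_const).comp_continuousOn hc, ?_⟩
  set Q : Finset ℝ := insert 0 (insert L P) with hQ
  -- New break points occur where a linear piece crosses the level `c`. They are listed without
  -- knowing the pieces: for every pair in `Q`, the point where the chord over that pair has height
  -- `c`. Pairs whose quotient has denominator zero only add a harmless extra point.
  refine ⟨Q ∪ (Q ×ˢ Q).image (fun pq => pq.1 + (c - h pq.1) * (pq.2 - pq.1) / (h pq.2 - h pq.1)),
    fun s t h0 hst htL hav => ?_⟩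
  have hPQ : P ⊆ Q := (Finset.subset_insert _ _).trans (Finset.subset_insert _ _)
  have havP : ∀ x ∈ Q, x ∉ Ioo s t := fun x hx => hav x (Finset.mem_union_left _ hx)
  obtain ⟨m, hm⟩ := hP s t h0 hst htL fun x hx => havP x (hPQ hx)
  -- A crossing with nonzero slope inside the gap would lie on the chord between the neighbouring
  -- points `p` and `q` of `Q`, hence be one of the listed break points.
  have hcross : ∀ z ∈ Ioo s t, h z = c → m = 0 := by
    intro z hz hzc
    by_contra hm0
    have hp : (Q.filter (· ≤ s)).Nonempty := ⟨0, by simp [hQ, h0]⟩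
    have hq : (Q.filter (t ≤ ·)).Nonempty := ⟨L, by simp [hQ, htL]⟩
    set p := (Q.filter (· ≤ s)).max' hp with hpdef
    set q := (Q.filter (t ≤ ·)).min' hq with hqdef
    have hpm := Finset.mem_filter.1 (Finset.max'_mem _ hp)
    have hqm := Finset.mem_filter.1 (Finset.min'_mem _ hq)
    rw [← hpdef] at hpm
    rw [← hqdef] at hqm
    have hp0 : 0 ≤ p := Finset.le_max' _ _ (by simp [hQ, h0])
    have hqL : q ≤ L := Finset.min'_le _ _ (by simp [hQ, htL])
    have hpq : p < q := by linarith [hpm.2, hqm.2]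
    obtain ⟨m', hm'⟩ := hP p q hp0 hpq hqL (by
      intro x hx hxpq
      rcases le_or_gt x s with h1 | h1
      · exact absurd (Finset.le_max' _ x (Finset.mem_filter.2 ⟨hPQ hx, h1⟩)) (not_le.2 hxpq.1)
      · rcases le_or_gt t x with h2 | h2
        · exact absurd (Finset.min'_le _ x (Finset.mem_filter.2 ⟨hPQ hx, h2⟩)) (not_le.2 hxpq.2)
        · exact havP x (hPQ hx) ⟨h1, h2⟩)
    have e1 := hm' s ⟨hpm.2, by linarith [hqm.2]⟩
    have e2 := hm' t ⟨by linarith [hpm.2], hqm.2⟩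
    have e3 := hm t ⟨hst.le, le_rfl⟩
    have hmm : (m' : ℝ) = m := by
      have : ((m' : ℝ) - m) * (t - s) = 0 := by linear_combination e3 - e2 + e1
      rcases mul_eq_zero.1 this with h1 | h1
      · linarith
      · linarith
    have e4 := hm' q ⟨hpq.le, le_rfl⟩
    have e5 := hm' z ⟨by linarith [hpm.2, hz.1], by linarith [hqm.2, hz.2]⟩
    refine hav z (Finset.mem_union_right _ (Finset.mem_image.2
      ⟨(p, q), Finset.mem_product.2 ⟨hpm.1, hqm.1⟩, ?_⟩)) hz
    have hm0' : (m' : ℝ) ≠ 0 := by rw [hmm]; exact_mod_cast hm0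
    have hqp : q - p ≠ 0 := by linarith
    have e6 : h q - h p = m' * (q - p) := by linarith
    have e7 : c - h p = m' * (z - p) := by linarith
    simp only
    rw [e6, e7]
    field_simp
    ring
  by_cases hup : ∀ x ∈ Icc s t, h x ≤ c
  · refine ⟨m, fun x hx => ?_⟩
    beta_reduce
    rw [min_eq_left (hup x hx), min_eq_left (hup s ⟨le_rfl, hst.le⟩), hm x hx]
  by_cases hdown : ∀ x ∈ Icc s t, c ≤ h x
  · refine ⟨0, fun x hx => ?_⟩
    beta_reduce
    rw [min_eq_right (hdown x hx), min_eq_right (hdown s ⟨le_rfl, hst.le⟩)]; simp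
  -- Values on both sides of `c` force a crossing by the intermediate value theorem. Then the slope
  -- is zero and `h` is constant on the gap, which is absurd.
  exfalso
  push Not at hup hdown
  obtain ⟨x, hx, hxc⟩ := hup
  obtain ⟨y, hy, hyc⟩ := hdown
  have hsub : uIcc x y ⊆ Icc s t := uIcc_subset_Icc hx hy
  obtain ⟨z, hz, hzc⟩ := intermediate_value_uIcc
    (hc.mono (hsub.trans (Icc_subset_Icc h0 htL))) (mem_uIcc.2 (Or.inr ⟨hyc.le, hxc.le⟩))
  have hz' : z ∈ Ioo s t := by
    rcases mem_uIcc.1 hz with h1 | h1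
    · exact ⟨hx.1.trans_lt (lt_of_le_of_ne h1.1 (by rintro rfl; linarith)),
        (lt_of_le_of_ne h1.2 (by rintro rfl; linarith)).trans_le hy.2⟩
    · exact ⟨hy.1.trans_lt (lt_of_le_of_ne h1.1 (by rintro rfl; linarith)),
        (lt_of_le_of_ne h1.2 (by rintro rfl; linarith)).trans_le hx.2⟩
  have e1 := hm x hx
  have e2 := hm y hy
  rw [hcross z hz' hzc] at e1 e2
  simp only [Int.cast_zero, zero_mul, add_zero] at e1 e2
  linarith

/-- The left slope minus the right slope. -/
noncomputable def slopeDrop (h : ℝ → ℝ) (x : ℝ) : ℝ :=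
  derivWithin h (Iio x) x - derivWithin h (Ioi x) x

theorem slopeDrop_eq {h : ℝ → ℝ} {x m n : ℝ} (H : LeftSlope h x m) (G : RightSlope h x n) :
    slopeDrop h x = m - n := by
  rw [slopeDrop, H.derivWithin_eq, G.derivWithin_eq]

theorem slopeDrop_eq_zero {h : ℝ → ℝ} {s t x m : ℝ} (hx : x ∈ Ioo s t)
    (H : ∀ z ∈ Icc s t, h z = h s + m * (z - s)) : slopeDrop h x = 0 := by
  have hr : RightSlope h x m := rightSlope_of_Icc hx.2 fun z hz => by
    rw [H z ⟨by linarith [hx.1, hz.1], hz.2⟩, H x ⟨hx.1.le, hx.2.le⟩]; ring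
  have hl : LeftSlope h x m := leftSlope_of_Icc hx.1 fun z hz =>
    H z ⟨hz.1, by linarith [hx.2, hz.2]⟩
  rw [slopeDrop_eq hl hr, sub_self]

/-- A telescoping sum: the drops at the interior break points add up to the first slope minus the
last one. The induction is on a bound for the number of break points, splitting the interval at one
of them. -/
theorem sum_slopeDrop {h : ℝ → ℝ} {L : ℝ} {P : Finset ℝ}
    (hP : ∀ s t : ℝ, 0 ≤ s → s < t → t ≤ L → (∀ x ∈ P, x ∉ Set.Ioo s t) →
      ∃ m : ℤ, ∀ x ∈ Set.Icc s t, h x = h s + (m : ℝ) * (x - s)) (k : ℕ) :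
    ∀ s t : ℝ, 0 ≤ s → s < t → t ≤ L → (P.filter (· ∈ Ioo s t)).card ≤ k →
      ∑ x ∈ P.filter (· ∈ Ioo s t), slopeDrop h x =
        derivWithin h (Ioi s) s - derivWithin h (Iio t) t := by
  classical
  induction k with
  | zero =>
    intro s t h0 hst htL hk
    have he := Finset.card_eq_zero.1 (Nat.le_zero.1 hk)
    obtain ⟨m, hm⟩ := hP s t h0 hst htL fun x hx hxs => by
      have : x ∈ P.filter (· ∈ Ioo s t) := Finset.mem_filter.2 ⟨hx, hxs⟩
      rw [he] at this
      exact absurd this (Finset.notMem_empty x)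
    rw [he, Finset.sum_empty, (rightSlope_of_Icc hst hm).derivWithin_eq,
      (leftSlope_of_Icc hst hm).derivWithin_eq, sub_self]
  | succ k ih =>
    intro s t h0 hst htL hk
    rcases (P.filter (· ∈ Ioo s t)).eq_empty_or_nonempty with he | ⟨x, hx⟩
    · exact ih s t h0 hst htL (by rw [he]; simp)
    · have hxm := Finset.mem_filter.1 hx
      have hx1 : s < x := hxm.2.1
      have hx2 : x < t := hxm.2.2
      have hsplit : P.filter (· ∈ Ioo s t) =
          insert x (P.filter (· ∈ Ioo s x) ∪ P.filter (· ∈ Ioo x t)) := by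
        ext y
        simp only [Finset.mem_filter, Finset.mem_insert, Finset.mem_union, mem_Ioo]
        constructor
        · rintro ⟨h1, h2, h3⟩
          rcases lt_trichotomy y x with h4 | h4 | h4
          · exact Or.inr (Or.inl ⟨h1, h2, h4⟩)
          · exact Or.inl h4
          · exact Or.inr (Or.inr ⟨h1, h4, h3⟩)
        · rintro (rfl | ⟨h1, h2, h3⟩ | ⟨h1, h2, h3⟩)
          · exact ⟨hxm.1, hx1, hx2⟩
          · exact ⟨h1, h2, h3.trans hx2⟩
          · exact ⟨h1, hx1.trans h2, h3⟩
      have hdisj : Disjoint (P.filter (· ∈ Ioo s x)) (P.filter (· ∈ Ioo x t)) := by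
        rw [Finset.disjoint_left]
        intro y hy hy'
        exact lt_asymm (Finset.mem_filter.1 hy).2.2 (Finset.mem_filter.1 hy').2.1
      have hnot : x ∉ P.filter (· ∈ Ioo s x) ∪ P.filter (· ∈ Ioo x t) := by
        simp
      have hcard := hk
      rw [hsplit, Finset.card_insert_of_notMem hnot, Finset.card_union_of_disjoint hdisj] at hcard
      rw [hsplit, Finset.sum_insert hnot, Finset.sum_union hdisj,
        ih s x h0 hx1 (hx2.le.trans htL) (by omega),
        ih x t (h0.trans hx1.le) hx2 htL (by omega), slopeDrop]
      ring

namespace MetricGraph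

variable {Γ : MetricGraph}

/-! ### Slopes and orders of rational functions -/

theorem edge_zero (e : Γ.E) : Γ.edge e 0 = Sum.inl (Γ.src e) := by
  simp [edge]

theorem edge_length (e : Γ.E) : Γ.edge e (Γ.length e) = Sum.inl (Γ.tgt e) := by
  simp [edge, Γ.length_pos e]

theorem edge_of_mem (e : Γ.E) (t : Set.Ioo (0 : ℝ) (Γ.length e)) :
    Γ.edge e t.1 = Sum.inr ⟨e, t⟩ := by
  have : 0 < t.1 ∧ t.1 < Γ.length e := t.2
  simp [edge, this]

theorem edge_induction {p : Γ.Point → Prop} (e : Γ.E) (hs : p (Sum.inl (Γ.src e)))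
    (ht : p (Sum.inl (Γ.tgt e))) (hi : ∀ t, p (Sum.inr ⟨e, t⟩)) (t : ℝ) : p (Γ.edge e t) := by
  unfold edge
  split_ifs with h1 h2
  · exact hi _
  · exact hs
  · exact ht

/-- The slope of `φ` at the beginning of the edge `e`. -/
noncomputable def srcSlope (φ : Γ.Point → ℝ) (e : Γ.E) : ℝ :=
  derivWithin (fun t => φ (Γ.edge e t)) (Set.Ioi 0) 0

/-- The slope of `φ` at the end of the edge `e`. -/
noncomputable def tgtSlope (φ : Γ.Point → ℝ) (e : Γ.E) : ℝ :=
  derivWithin (fun t => φ (Γ.edge e t)) (Set.Iio (Γ.length e)) (Γ.length e)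

open Classical in
theorem ord_inl (φ : Γ.Point → ℝ) (x : Γ.V) : Γ.ord φ (Sum.inl x) =
    ∑ e : Γ.E, ((if Γ.src e = x then - srcSlope φ e else 0) +
      (if Γ.tgt e = x then tgtSlope φ e else 0)) := rfl

theorem ord_inr (φ : Γ.Point → ℝ) (e : Γ.E) (t : Set.Ioo (0 : ℝ) (Γ.length e)) :
    Γ.ord φ (Sum.inr ⟨e, t⟩) = slopeDrop (fun s => φ (Γ.edge e s)) t.1 := rfl

theorem IsRational.isPL {φ : Γ.Point → ℝ} (h : Γ.IsRational φ) (e : Γ.E) :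
    IsPL (fun t => φ (Γ.edge e t)) (Γ.length e) := h e

theorem IsRational.exists_srcSlope {φ : Γ.Point → ℝ} (h : Γ.IsRational φ) (e : Γ.E) :
    ∃ m : ℤ, RightSlope (fun t => φ (Γ.edge e t)) 0 m :=
  (h.isPL e).exists_rightSlope le_rfl (Γ.length_pos e)

theorem IsRational.exists_tgtSlope {φ : Γ.Point → ℝ} (h : Γ.IsRational φ) (e : Γ.E) :
    ∃ m : ℤ, LeftSlope (fun t => φ (Γ.edge e t)) (Γ.length e) m :=
  (h.isPL e).exists_leftSlope (Γ.length_pos e) le_rfl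

theorem IsRational.exists_slopes {φ : Γ.Point → ℝ} (h : Γ.IsRational φ) (e : Γ.E)
    (t : Set.Ioo (0 : ℝ) (Γ.length e)) :
    ∃ m n : ℤ, LeftSlope (fun t => φ (Γ.edge e t)) t.1 m ∧
      RightSlope (fun t => φ (Γ.edge e t)) t.1 n := by
  obtain ⟨m, hm⟩ := (h.isPL e).exists_leftSlope t.2.1 t.2.2.le
  obtain ⟨n, hn⟩ := (h.isPL e).exists_rightSlope t.2.1.le t.2.2
  exact ⟨m, n, hm, hn⟩

theorem srcSlope_eq {φ : Γ.Point → ℝ} {e : Γ.E} {m : ℝ}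
    (h : RightSlope (fun t => φ (Γ.edge e t)) 0 m) : srcSlope φ e = m := h.derivWithin_eq

theorem tgtSlope_eq {φ : Γ.Point → ℝ} {e : Γ.E} {m : ℝ}
    (h : LeftSlope (fun t => φ (Γ.edge e t)) (Γ.length e) m) : tgtSlope φ e = m :=
  h.derivWithin_eq

theorem IsRational.add {φ ψ : Γ.Point → ℝ} (h : Γ.IsRational φ) (g : Γ.IsRational ψ) :
    Γ.IsRational (fun p => φ p + ψ p) := fun e => (h.isPL e).add (g.isPL e)

theorem IsRational.neg {φ : Γ.Point → ℝ} (h : Γ.IsRational φ) :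
    Γ.IsRational (fun p => - φ p) := fun e => (h.isPL e).neg

theorem IsRational.min_const {φ : Γ.Point → ℝ} (h : Γ.IsRational φ) (c : ℝ) :
    Γ.IsRational (fun p => min (φ p) c) := fun e => (h.isPL e).min_const c

theorem ord_add {φ ψ : Γ.Point → ℝ} (h : Γ.IsRational φ) (g : Γ.IsRational ψ) (p : Γ.Point) :
    Γ.ord (fun p => φ p + ψ p) p = Γ.ord φ p + Γ.ord ψ p := by
  rcases p with x | ⟨e, t⟩
  · rw [ord_inl, ord_inl, ord_inl, ← Finset.sum_add_distrib]
    refine Finset.sum_congr rfl fun e _ => ?_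
    obtain ⟨m, hm⟩ := h.exists_srcSlope e
    obtain ⟨n, hn⟩ := g.exists_srcSlope e
    obtain ⟨m', hm'⟩ := h.exists_tgtSlope e
    obtain ⟨n', hn'⟩ := g.exists_tgtSlope e
    rw [srcSlope_eq (hm.add hn), srcSlope_eq hm, srcSlope_eq hn, tgtSlope_eq (hm'.add hn'),
      tgtSlope_eq hm', tgtSlope_eq hn']
    split_ifs <;> ring
  · obtain ⟨m, m', hm, hm'⟩ := h.exists_slopes e t
    obtain ⟨n, n', hn, hn'⟩ := g.exists_slopes e t
    rw [ord_inr, ord_inr, ord_inr, slopeDrop_eq hm hm', slopeDrop_eq hn hn',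
      slopeDrop_eq (hm.add hn) (hm'.add hn')]
    ring

theorem ord_neg {φ : Γ.Point → ℝ} (h : Γ.IsRational φ) (p : Γ.Point) :
    Γ.ord (fun p => - φ p) p = - Γ.ord φ p := by
  rcases p with x | ⟨e, t⟩
  · rw [ord_inl, ord_inl, ← Finset.sum_neg_distrib]
    refine Finset.sum_congr rfl fun e _ => ?_
    obtain ⟨m, hm⟩ := h.exists_srcSlope e
    obtain ⟨m', hm'⟩ := h.exists_tgtSlope e
    rw [srcSlope_eq hm.neg, srcSlope_eq hm, tgtSlope_eq hm'.neg, tgtSlope_eq hm']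
    split_ifs <;> ring
  · obtain ⟨m, m', hm, hm'⟩ := h.exists_slopes e t
    rw [ord_inr, ord_inr, slopeDrop_eq hm hm', slopeDrop_eq hm.neg hm'.neg]
    ring

theorem isRational_const (c : ℝ) : Γ.IsRational (fun _ => c) := fun _ => isPL_const c _

theorem ord_const (c : ℝ) (p : Γ.Point) : Γ.ord (fun _ => c) p = 0 := by
  rcases p with x | ⟨e, t⟩
  · rw [ord_inl]
    refine Finset.sum_eq_zero fun e _ => ?_
    rw [srcSlope_eq (rightSlope_const c 0), tgtSlope_eq (leftSlope_const c _)]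
    simp
  · rw [ord_inr, slopeDrop_eq (leftSlope_const c _) (rightSlope_const c _), sub_zero]

theorem IsRational.exists_ord_eq_intCast {φ : Γ.Point → ℝ} (h : Γ.IsRational φ) (p : Γ.Point) :
    ∃ m : ℤ, (m : ℝ) = Γ.ord φ p := by
  classical
  rcases p with x | ⟨e, t⟩
  · choose m hm using h.exists_srcSlope
    choose n hn using h.exists_tgtSlope
    refine ⟨∑ e : Γ.E, ((if Γ.src e = x then - m e else 0) + (if Γ.tgt e = x then n e else 0)), ?_⟩
    rw [ord_inl]
    push_cast
    refine Finset.sum_congr rfl fun e _ => ?_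
    rw [srcSlope_eq (hm e), tgtSlope_eq (hn e)]
  · obtain ⟨m, n, hm, hn⟩ := h.exists_slopes e t
    exact ⟨m - n, by rw [ord_inr, slopeDrop_eq hm hn]; push_cast; ring⟩

/-- The order of a rational function vanishes outside a finite set of points, over which it
sums up to zero. -/
theorem IsRational.exists_finset {φ : Γ.Point → ℝ} (h : Γ.IsRational φ) :
    ∃ A : Finset Γ.Point, (∀ p ∉ A, Γ.ord φ p = 0) ∧ ∑ p ∈ A, Γ.ord φ p = 0 := by
  classical
  choose P hP using fun e => (h.isPL e).2
  -- All the vertices, together with the break points inside the edges.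
  refine ⟨Finset.disjSum Finset.univ
    (Finset.univ.sigma fun e => (P e).subtype (· ∈ Set.Ioo (0 : ℝ) (Γ.length e))), ?_, ?_⟩
  · rintro (x | ⟨e, t⟩) hp
    · simp at hp
    · have ht : t.1 ∉ P e := by simpa using hp
      obtain ⟨y, hy, hyL, hyP⟩ := exists_right_gap (P e) t.2.2
      obtain ⟨z, hz, hz0, hzP⟩ := exists_left_gap (P e) t.2.1
      obtain ⟨m, hm⟩ := hP e z y hz0 (hz.trans hy) hyL fun x hx hxI => by
        rcases lt_trichotomy x t.1 with h1 | h1 | h1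
        · exact hzP x hx ⟨hxI.1, h1⟩
        · exact ht (h1 ▸ hx)
        · exact hyP x hx ⟨h1, hxI.2⟩
      rw [ord_inr]
      exact slopeDrop_eq_zero (⟨hz, hy⟩ : t.1 ∈ Ioo z y) hm
  · rw [Finset.sum_disjSum, Finset.sum_sigma]
    have h1 : ∀ e : Γ.E, ∑ t ∈ (P e).subtype (· ∈ Set.Ioo (0 : ℝ) (Γ.length e)),
        Γ.ord φ (Sum.inr ⟨e, t⟩) = srcSlope φ e - tgtSlope φ e := by
      intro e
      have := sum_slopeDrop (hP e) _ 0 (Γ.length e) le_rfl (Γ.length_pos e) le_rfl le_rfl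
      rw [← Finset.sum_subtype_eq_sum_filter] at this
      exact this
    -- Each edge contributes once at its source and once at its target, which cancels the telescoped
    -- sum over its interior.
    have h2 : ∑ x : Γ.V, Γ.ord φ (Sum.inl x) = ∑ e : Γ.E, (- srcSlope φ e + tgtSlope φ e) := by
      simp only [ord_inl]
      rw [Finset.sum_comm]
      refine Finset.sum_congr rfl fun e _ => ?_
      rw [Finset.sum_add_distrib]
      simp
    rw [h2, Finset.sum_congr rfl fun e _ => h1 e, ← Finset.sum_add_distrib]
    exact Finset.sum_eq_zero fun e _ => by ring

theorem IsRational.exists_divisor {φ : Γ.Point → ℝ} (h : Γ.IsRational φ) :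
    ∃ D : Γ.Divisor, (∀ p, ((D p : ℤ) : ℝ) = Γ.ord φ p) := by
  obtain ⟨A, hA, -⟩ := h.exists_finset
  choose m hm using h.exists_ord_eq_intCast
  refine ⟨Finsupp.onFinset A m fun p hp => ?_, fun p => hm p⟩
  by_contra hpA
  have := hm p
  rw [hA p hpA] at this
  exact hp (by exact_mod_cast this)

/-! ### Degree and linear equivalence of divisors -/

theorem Divisor.deg_eq_sum (D : Γ.Divisor) {A : Finset Γ.Point} (hA : D.support ⊆ A) :
    Divisor.deg D = ∑ p ∈ A, D p :=
  Finset.sum_subset hA fun p _ hp => by simpa using hp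

theorem Divisor.deg_add (D D' : Γ.Divisor) :
    Divisor.deg (D + D') = Divisor.deg D + Divisor.deg D' :=
  Finsupp.sum_add_index' (fun _ => rfl) fun _ _ _ => rfl

theorem Divisor.deg_sub (D D' : Γ.Divisor) :
    Divisor.deg (D - D') = Divisor.deg D - Divisor.deg D' := by
  rw [eq_sub_iff_add_eq, ← Divisor.deg_add, sub_add_cancel]

theorem Divisor.deg_single (p : Γ.Point) (n : ℤ) :
    Divisor.deg (Finsupp.single p n : Γ.Divisor) = n :=
  Finsupp.sum_single_index rfl

theorem Divisor.deg_eq_zero {φ : Γ.Point → ℝ} (h : Γ.IsRational φ) {D : Γ.Divisor}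
    (hD : ∀ p, ((D p : ℤ) : ℝ) = Γ.ord φ p) : Divisor.deg D = 0 := by
  obtain ⟨A, hA, hA0⟩ := h.exists_finset
  rw [D.deg_eq_sum (A := A) fun p hp => ?_]
  · have : ((∑ p ∈ A, D p : ℤ) : ℝ) = 0 := by
      push_cast
      rw [← hA0]
      exact Finset.sum_congr rfl fun p _ => hD p
    exact_mod_cast this
  · by_contra hpA
    have := hD p
    rw [hA p hpA] at this
    exact (Finsupp.mem_support_iff.1 hp) (by exact_mod_cast this)

theorem Divisor.IsEquivalent.deg_eq {D D' : Γ.Divisor} (h : Divisor.IsEquivalent D D') :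
    Divisor.deg D' = Divisor.deg D := by
  obtain ⟨φ, hφ, hD⟩ := h
  have := Divisor.deg_eq_zero hφ hD
  rw [Divisor.deg_sub] at this
  linarith

theorem Divisor.IsEquivalent.refl (D : Γ.Divisor) : Divisor.IsEquivalent D D :=
  ⟨fun _ => 0, isRational_const 0, fun p => by rw [ord_const]; simp⟩

theorem Divisor.IsEquivalent.symm {D D' : Γ.Divisor} (h : Divisor.IsEquivalent D D') :
    Divisor.IsEquivalent D' D := by
  obtain ⟨φ, hφ, hD⟩ := h
  refine ⟨_, hφ.neg, fun p => ?_⟩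
  rw [ord_neg hφ, ← hD p]
  simp

theorem Divisor.IsEquivalent.trans {D D' D'' : Γ.Divisor} (h : Divisor.IsEquivalent D D')
    (h' : Divisor.IsEquivalent D' D'') : Divisor.IsEquivalent D D'' := by
  obtain ⟨φ, hφ, hD⟩ := h
  obtain ⟨ψ, hψ, hD'⟩ := h'
  refine ⟨_, hφ.add hψ, fun p => ?_⟩
  rw [ord_add hφ hψ, ← hD p, ← hD' p]
  push_cast [Finsupp.sub_apply]
  ring

/-! ### Truncation of rational functions -/

theorem ord_min_of_lt {φ : Γ.Point → ℝ} (h : Γ.IsRational φ) {c : ℝ} {p : Γ.Point}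
    (hp : φ p < c) : Γ.ord (fun p => min (φ p) c) p = Γ.ord φ p := by
  rcases p with x | ⟨e, t⟩
  · rw [ord_inl, ord_inl]
    refine Finset.sum_congr rfl fun e _ => ?_
    obtain ⟨m, hm⟩ := h.exists_srcSlope e
    obtain ⟨n, hn⟩ := h.exists_tgtSlope e
    congr 1
    · split_ifs with h1
      · rw [srcSlope_eq hm, srcSlope_eq (hm.min_of_lt (by rwa [edge_zero, h1]))]
      · rfl
    · split_ifs with h1
      · rw [tgtSlope_eq hn, tgtSlope_eq (hn.min_of_lt (by rwa [edge_length, h1]))]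
      · rfl
  · obtain ⟨m, n, hm, hn⟩ := h.exists_slopes e t
    have hp' : φ (Γ.edge e t.1) < c := by rwa [edge_of_mem]
    rw [ord_inr, ord_inr, slopeDrop_eq hm hn, slopeDrop_eq (hm.min_of_lt hp') (hn.min_of_lt hp')]

theorem ord_min_of_gt {φ : Γ.Point → ℝ} (h : Γ.IsRational φ) {c : ℝ} {p : Γ.Point}
    (hp : c < φ p) : Γ.ord (fun p => min (φ p) c) p = 0 := by
  classical
  rcases p with x | ⟨e, t⟩
  · rw [ord_inl]
    refine Finset.sum_eq_zero fun e _ => ?_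
    obtain ⟨m, hm⟩ := h.exists_srcSlope e
    obtain ⟨n, hn⟩ := h.exists_tgtSlope e
    have h1 : (if Γ.src e = x then - srcSlope (fun p => min (φ p) c) e else 0) = 0 := by
      split_ifs with h1
      · rw [srcSlope_eq (hm.min_of_gt (by rwa [edge_zero, h1])), neg_zero]
      · rfl
    have h2 : (if Γ.tgt e = x then tgtSlope (fun p => min (φ p) c) e else 0) = 0 := by
      split_ifs with h1
      · rw [tgtSlope_eq (hn.min_of_gt (by rwa [edge_length, h1]))]
      · rfl
    rw [h1, h2, add_zero]
  · obtain ⟨m, n, hm, hn⟩ := h.exists_slopes e t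
    have hp' : c < φ (Γ.edge e t.1) := by rwa [edge_of_mem]
    rw [ord_inr, slopeDrop_eq (hm.min_of_gt hp') (hn.min_of_gt hp'), sub_zero]

theorem srcSlope_min {φ : Γ.Point → ℝ} (h : Γ.IsRational φ) {c : ℝ} {e : Γ.E}
    (hp : φ (Sum.inl (Γ.src e)) = c) :
    srcSlope (fun p => min (φ p) c) e = min (srcSlope φ e) 0 := by
  obtain ⟨m, hm⟩ := h.exists_srcSlope e
  rw [srcSlope_eq hm, srcSlope_eq (hm.min_of_eq (by rwa [edge_zero]))]

theorem tgtSlope_min {φ : Γ.Point → ℝ} (h : Γ.IsRational φ) {c : ℝ} {e : Γ.E}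
    (hp : φ (Sum.inl (Γ.tgt e)) = c) :
    tgtSlope (fun p => min (φ p) c) e = max (tgtSlope φ e) 0 := by
  obtain ⟨m, hm⟩ := h.exists_tgtSlope e
  rw [tgtSlope_eq hm, tgtSlope_eq (hm.min_of_eq (by rwa [edge_length]))]

open Classical in
-- At a vertex on the level `c`, the truncation remains nonconstant only along the edges on which
-- `φ` descends away from the vertex, and each of them contributes its rate of descent. All terms
-- are therefore nonnegative.
theorem ord_min_of_eq_inl {φ : Γ.Point → ℝ} (h : Γ.IsRational φ) {c : ℝ} {x : Γ.V}
    (hp : φ (Sum.inl x) = c) : Γ.ord (fun p => min (φ p) c) (Sum.inl x) =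
      ∑ e : Γ.E, ((if Γ.src e = x then max (- srcSlope φ e) 0 else 0) +
        (if Γ.tgt e = x then max (tgtSlope φ e) 0 else 0)) := by
  rw [ord_inl]
  refine Finset.sum_congr rfl fun e _ => ?_
  congr 1
  · split_ifs with h1
    · rw [srcSlope_min h (by rwa [h1]), ← max_neg_neg, neg_zero]
    · rfl
  · split_ifs with h1
    · rw [tgtSlope_min h (by rwa [h1])]
    · rfl

theorem ord_min_of_eq_nonneg {φ : Γ.Point → ℝ} (h : Γ.IsRational φ) {c : ℝ} {p : Γ.Point}
    (hp : φ p = c) : 0 ≤ Γ.ord (fun p => min (φ p) c) p := by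
  classical
  rcases p with x | ⟨e, t⟩
  · rw [ord_min_of_eq_inl h hp]
    refine Finset.sum_nonneg fun e _ => add_nonneg ?_ ?_ <;> split_ifs <;> simp
  · obtain ⟨m, n, hm, hn⟩ := h.exists_slopes e t
    have hp' : φ (Γ.edge e t.1) = c := by rwa [edge_of_mem]
    rw [ord_inr, slopeDrop_eq (hm.min_of_eq hp') (hn.min_of_eq hp')]
    have h1 : (0 : ℝ) ≤ max (m : ℝ) 0 := le_max_right _ _
    have h2 : min (n : ℝ) 0 ≤ 0 := min_le_right _ _
    linarith

/-- The truncated divisor equals `D'` where `φ < c`, equals `D` where `φ > c`, and is at least `D`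
where `φ = c`; so it is effective. This is the chip-firing move on which the lower bound rests. -/
theorem exists_truncation {D D' : Γ.Divisor} {φ : Γ.Point → ℝ} (h : Γ.IsRational φ)
    (hD : Divisor.IsEffective D) (hD' : Divisor.IsEffective D')
    (hφ : ∀ p, (((D' - D) p : ℤ) : ℝ) = Γ.ord φ p) (c : ℝ) :
    ∃ D'' : Γ.Divisor, Divisor.IsEffective D'' ∧
      ∀ p, (((D'' - D) p : ℤ) : ℝ) = Γ.ord (fun p => min (φ p) c) p := by
  obtain ⟨F, hF⟩ := (h.min_const c).exists_divisor
  refine ⟨D + F, fun p => ?_, fun p => by rw [add_sub_cancel_left, hF]⟩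
  have h1 := hφ p
  have h2 := hF p
  have h3 : (0 : ℝ) ≤ ((D p : ℤ) : ℝ) := by exact_mod_cast hD p
  have h4 : (0 : ℝ) ≤ ((D' p : ℤ) : ℝ) := by exact_mod_cast hD' p
  have h5 : (0 : ℝ) ≤ (((D + F) p : ℤ) : ℝ) := by
    rw [Finsupp.add_apply]
    push_cast
    rw [Finsupp.sub_apply] at h1
    push_cast at h1
    rcases lt_trichotomy (φ p) c with h6 | h6 | h6
    · rw [ord_min_of_lt h h6] at h2
      linarith
    · have := ord_min_of_eq_nonneg h h6
      linarith
    · rw [ord_min_of_gt h h6] at h2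
      linarith
  exact_mod_cast h5

/-- On an edge whose end points are on both sides of the level `c`, the truncation at level `c`
has a positive order at some interior point. -/
theorem exists_ord_min_pos {φ : Γ.Point → ℝ} (h : Γ.IsRational φ) {c : ℝ} {e : Γ.E}
    (hc : (φ (Sum.inl (Γ.src e)) < c ∧ c < φ (Sum.inl (Γ.tgt e))) ∨
      (φ (Sum.inl (Γ.tgt e)) < c ∧ c < φ (Sum.inl (Γ.src e)))) :
    ∃ t : Set.Ioo (0 : ℝ) (Γ.length e), φ (Sum.inr ⟨e, t⟩) = c ∧
      0 < Γ.ord (fun p => min (φ p) c) (Sum.inr ⟨e, t⟩) := by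
  set g : ℝ → ℝ := fun t => φ (Γ.edge e t) with hg
  have hL := Γ.length_pos e
  have g0 : g 0 = φ (Sum.inl (Γ.src e)) := by rw [hg]; simp only [edge_zero]
  have gL : g (Γ.length e) = φ (Sum.inl (Γ.tgt e)) := by rw [hg]; simp only [edge_length]
  have hcont : ContinuousOn g (Icc 0 (Γ.length e)) := (h.isPL e).1
  rw [← g0, ← gL] at hc
  have hK : IsCompact (Icc 0 (Γ.length e) ∩ g ⁻¹' Ici c) :=
    isCompact_Icc.of_isClosed_subset (hcont.preimage_isClosed_of_isClosed isClosed_Icc isClosed_Ici)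
      inter_subset_left
  suffices H : ∃ t : Set.Ioo (0 : ℝ) (Γ.length e), g t = c ∧
      ((∀ z ∈ Ioo 0 t.1, g z < c) ∨ (∀ z ∈ Ioo t.1 (Γ.length e), g z < c)) by
    -- As `g` is strictly below `c` on one side of `t`, its slope on that side is nonzero and
    -- descends away from `t`, so it survives truncation.
    obtain ⟨t, htc, ht⟩ := H
    refine ⟨t, by rw [← edge_of_mem]; exact htc, ?_⟩
    obtain ⟨m, n, hm, hn⟩ := h.exists_slopes e t
    rw [ord_inr, slopeDrop_eq (hm.min_of_eq htc) (hn.min_of_eq htc)]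
    have h1 : (0 : ℝ) ≤ max (m : ℝ) 0 := le_max_right _ _
    have h2 : min (n : ℝ) 0 ≤ 0 := min_le_right _ _
    rcases ht with ht | ht
    · obtain ⟨z, hz1, hz2⟩ := (hm.and (Ioo_mem_nhdsLT t.2.1)).exists
      have h3 := ht z hz2
      have hz1 : g z = g t + m * (z - t) := hz1
      rw [hz1, htc] at h3
      have h4 : 0 < (m : ℝ) := by nlinarith [hz2.2]
      have h5 : (0 : ℝ) < max (m : ℝ) 0 := lt_max_of_lt_left h4
      linarith
    · obtain ⟨z, hz1, hz2⟩ := (hn.and (Ioo_mem_nhdsGT t.2.2)).exists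
      have h3 := ht z hz2
      have hz1 : g z = g t + n * (z - t) := hz1
      rw [hz1, htc] at h3
      have h4 : (n : ℝ) < 0 := by nlinarith [hz2.1]
      have h5 : min (n : ℝ) 0 < 0 := min_lt_of_left_lt h4
      linarith
  rcases hc with ⟨hc0, hcL⟩ | ⟨hcL, hc0⟩
  -- The first point of the superlevel set; in the mirrored case, the last one.
  · obtain ⟨t, ⟨⟨ht0, htL⟩, htc⟩, htmin⟩ := hK.exists_isLeast ⟨_, ⟨hL.le, le_rfl⟩, hcL.le⟩
    have htc : c ≤ g t := htc
    have hlt : ∀ z ∈ Ico 0 t, g z < c := by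
      intro z hz
      by_contra hzc
      exact absurd (htmin ⟨⟨hz.1, hz.2.le.trans htL⟩, not_lt.1 hzc⟩) (not_le.2 hz.2)
    obtain ⟨z, hz, hzc⟩ := intermediate_value_Icc ht0
      (hcont.mono (Icc_subset_Icc le_rfl htL)) ⟨hc0.le, htc⟩
    have hzt : z = t := by
      by_contra hne
      exact absurd hzc (hlt z ⟨hz.1, lt_of_le_of_ne hz.2 hne⟩).ne
    subst hzt
    refine ⟨⟨z, lt_of_le_of_ne ht0 ?_, lt_of_le_of_ne htL ?_⟩, hzc,
      Or.inl fun y hy => hlt y ⟨hy.1.le, hy.2⟩⟩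
    · rintro rfl; linarith
    · rintro rfl; linarith
  · obtain ⟨t, ⟨⟨ht0, htL⟩, htc⟩, htmax⟩ := hK.exists_isGreatest ⟨_, ⟨le_rfl, hL.le⟩, hc0.le⟩
    have htc : c ≤ g t := htc
    have hlt : ∀ z ∈ Ioc t (Γ.length e), g z < c := by
      intro z hz
      by_contra hzc
      exact absurd (htmax ⟨⟨ht0.trans hz.1.le, hz.2⟩, not_lt.1 hzc⟩) (not_le.2 hz.1)
    obtain ⟨z, hz, hzc⟩ := intermediate_value_Icc' htL
      (hcont.mono (Icc_subset_Icc ht0 le_rfl)) ⟨hcL.le, htc⟩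
    have hzt : z = t := by
      by_contra hne
      exact absurd hzc (hlt z ⟨lt_of_le_of_ne hz.1 (Ne.symm hne), hz.2⟩).ne
    subst hzt
    refine ⟨⟨z, lt_of_le_of_ne ht0 ?_, lt_of_le_of_ne htL ?_⟩, hzc,
      Or.inr fun y hy => hlt y ⟨hy.1, hy.2.le⟩⟩
    · rintro rfl; linarith
    · rintro rfl; linarith

end MetricGraph

namespace MetricGraph

variable {Γ : MetricGraph}

/-! ### A lower bound for the degree of a divisor of positive rank -/

theorem Divisor.sum_le_deg {D : Γ.Divisor} (hD : Divisor.IsEffective D) (A : Finset Γ.Point) :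
    ∑ p ∈ A, D p ≤ Divisor.deg D := by
  classical
  rw [D.deg_eq_sum (Finset.subset_union_right : D.support ⊆ A ∪ D.support)]
  exact Finset.sum_le_sum_of_subset_of_nonneg Finset.subset_union_left fun p _ _ => hD p

theorem Divisor.deg_eq_of_mem {D D' : Γ.Divisor} (h : D' ∈ Divisor.linearSystem D) :
    Divisor.deg D' = Divisor.deg D := h.2.deg_eq

theorem Divisor.RankGE.exists_mem {D : Γ.Divisor} (hr : Divisor.RankGE D 1) (p : Γ.Point) :
    ∃ D' ∈ Divisor.linearSystem D, 1 ≤ D' p := by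
  classical
  obtain ⟨F, hF, φ, hφ, hFφ⟩ := hr (Finsupp.single p 1) (fun q => by
    rw [Finsupp.single_apply]; split_ifs <;> norm_num) (by rw [Divisor.deg_single]; rfl)
  refine ⟨F + Finsupp.single p 1, ⟨fun q => ?_, φ, hφ, fun q => ?_⟩, ?_⟩
  · have := hF q
    rw [Finsupp.add_apply, Finsupp.single_apply]
    split_ifs <;> linarith
  · rw [← hFφ q]
    congr 2
    abel
  · have := hF p
    rw [Finsupp.add_apply, Finsupp.single_eq_same]
    linarith

theorem Divisor.RankGE.one_le_deg {D : Γ.Divisor} (hr : Divisor.RankGE D 1) (p : Γ.Point) :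
    1 ≤ Divisor.deg D := by
  obtain ⟨D', hD', hp⟩ := hr.exists_mem p
  rw [← Divisor.deg_eq_of_mem hD']
  have := Divisor.sum_le_deg hD'.1 {p}
  rw [Finset.sum_singleton] at this
  linarith

/-- All rational functions between members of `|D|` are constant on the set `W` of vertices. -/
def Divisor.ConstOn (D : Γ.Divisor) (W : Finset Γ.V) : Prop :=
  ∀ D₁ ∈ Divisor.linearSystem D, ∀ D₂ ∈ Divisor.linearSystem D, ∀ φ : Γ.Point → ℝ,
    Γ.IsRational φ → (∀ p, (((D₂ - D₁) p : ℤ) : ℝ) = Γ.ord φ p) →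
      ∀ u ∈ W, ∀ v ∈ W, φ (Sum.inl u) = φ (Sum.inl v)

/-- A member of `|D|` with a maximal number of chips on `W`. -/
theorem Divisor.RankGE.exists_normalized {D : Γ.Divisor} (hr : Divisor.RankGE D 1)
    {W : Finset Γ.V} (hne : W.Nonempty) (hW : Divisor.ConstOn D W) :
    ∃ D₁ ∈ Divisor.linearSystem D, (∀ w ∈ W, 1 ≤ D₁ (Sum.inl w)) ∧
      ∀ D₂ ∈ Divisor.linearSystem D, ∀ φ : Γ.Point → ℝ, Γ.IsRational φ →
        (∀ p, (((D₂ - D₁) p : ℤ) : ℝ) = Γ.ord φ p) →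
          ∀ e, (Γ.src e ∈ W → 0 ≤ srcSlope φ e) ∧ (Γ.tgt e ∈ W → tgtSlope φ e ≤ 0) := by
  classical
  obtain ⟨w₀, hw₀⟩ := hne
  obtain ⟨m, ⟨D₁, hD₁, hm⟩, hmax⟩ := Int.exists_greatest_of_bdd
    (P := fun z => ∃ D' ∈ Divisor.linearSystem D, ∑ w ∈ W, D' (Sum.inl w) = z)
    ⟨Divisor.deg D, by
      rintro z ⟨D', hD', rfl⟩
      rw [← Divisor.deg_eq_of_mem hD']
      have := Divisor.sum_le_deg hD'.1 (W.map ⟨Sum.inl, Sum.inl_injective⟩)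
      rwa [Finset.sum_map] at this⟩
    (by
      obtain ⟨D', hD', -⟩ := hr.exists_mem (Sum.inl w₀)
      exact ⟨_, D', hD', rfl⟩)
  have key : ∀ D₂ ∈ Divisor.linearSystem D, ∀ φ : Γ.Point → ℝ, Γ.IsRational φ →
        (∀ p, (((D₂ - D₁) p : ℤ) : ℝ) = Γ.ord φ p) →
          ∀ e, (Γ.src e ∈ W → 0 ≤ srcSlope φ e) ∧ (Γ.tgt e ∈ W → tgtSlope φ e ≤ 0) := by
    intro D₂ hD₂ φ hφ hord
    set c := φ (Sum.inl w₀) with hc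
    have hWc : ∀ w ∈ W, φ (Sum.inl w) = c := fun w hw => hW D₁ hD₁ D₂ hD₂ φ hφ hord w hw w₀ hw₀
    obtain ⟨D₃, hD₃, hD₃'⟩ := exists_truncation hφ hD₁.1 hD₂.1 hord c
    -- Truncating at the common value `c` on `W` can only add chips on `W`. By maximality it adds
    -- none, so `φ` does not descend along any edge leaving a vertex of `W`.
    have hle := hmax _ ⟨D₃, ⟨hD₃, hD₁.2.trans ⟨_, hφ.min_const c, hD₃'⟩⟩, rfl⟩
    have hnn : ∀ w ∈ W, 0 ≤ Γ.ord (fun p => min (φ p) c) (Sum.inl w) :=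
      fun w hw => ord_min_of_eq_nonneg hφ (hWc w hw)
    have hsum : ∑ w ∈ W, Γ.ord (fun p => min (φ p) c) (Sum.inl w) = 0 := by
      refine le_antisymm ?_ (Finset.sum_nonneg hnn)
      have : ∑ w ∈ W, Γ.ord (fun p => min (φ p) c) (Sum.inl w) =
          ((∑ w ∈ W, D₃ (Sum.inl w) - m : ℤ) : ℝ) := by
        rw [← hm, ← Finset.sum_sub_distrib]
        push_cast
        refine Finset.sum_congr rfl fun w _ => ?_
        rw [← hD₃', Finsupp.sub_apply]
        push_cast
        rfl
      rw [this]
      exact_mod_cast sub_nonpos.2 hle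
    have hzero : ∀ w ∈ W, Γ.ord (fun p => min (φ p) c) (Sum.inl w) = 0 :=
      (Finset.sum_eq_zero_iff_of_nonneg hnn).1 hsum
    have hterm : ∀ w ∈ W, ∀ e, (if Γ.src e = w then max (- srcSlope φ e) 0 else 0) +
        (if Γ.tgt e = w then max (tgtSlope φ e) 0 else 0) = 0 := by
      intro w hw e
      have h1 := hzero w hw
      rw [ord_min_of_eq_inl hφ (hWc w hw)] at h1
      have h2 : ∀ e ∈ (Finset.univ : Finset Γ.E),
          0 ≤ (if Γ.src e = w then max (- srcSlope φ e) 0 else 0) +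
            (if Γ.tgt e = w then max (tgtSlope φ e) 0 else 0) := fun e _ => by
        refine add_nonneg ?_ ?_ <;> split_ifs <;> simp
      exact (Finset.sum_eq_zero_iff_of_nonneg h2).1 h1 e (Finset.mem_univ e)
    intro e
    constructor
    · intro he
      have h1 := hterm _ he e
      rw [if_pos rfl] at h1
      have h2 : (0 : ℝ) ≤ if Γ.tgt e = Γ.src e then max (tgtSlope φ e) 0 else 0 := by
        split_ifs <;> simp
      have h3 := le_max_left (- srcSlope φ e) 0
      linarith
    · intro he
      have h1 := hterm _ he e
      rw [if_pos (rfl : Γ.tgt e = Γ.tgt e)] at h1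
      have h2 : (0 : ℝ) ≤ if Γ.src e = Γ.tgt e then max (- srcSlope φ e) 0 else 0 := by
        split_ifs <;> simp
      have h3 := le_max_left (tgtSlope φ e) 0
      linarith
  refine ⟨D₁, hD₁, fun w hw => ?_, key⟩
  obtain ⟨D₂, hD₂, hD₂w⟩ := hr.exists_mem (Sum.inl w)
  obtain ⟨φ, hφ, hord⟩ := hD₁.2.symm.trans hD₂.2
  -- No slope comes into `w` from `D₁` to `D₂`, so `D₁` has at least as many chips at `w` as `D₂`,
  -- which was chosen to have one there.
  have h1 : Γ.ord φ (Sum.inl w) ≤ 0 := by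
    rw [ord_inl]
    refine Finset.sum_nonpos fun e _ => add_nonpos ?_ ?_
    · split_ifs with h
      · have := (key D₂ hD₂ φ hφ hord e).1 (h ▸ hw)
        linarith
      · exact le_rfl
    · split_ifs with h
      · exact (key D₂ hD₂ φ hφ hord e).2 (h ▸ hw)
      · exact le_rfl
  rw [← hord] at h1
  have h2 : (D₂ - D₁) (Sum.inl w) ≤ 0 := by exact_mod_cast h1
  rw [Finsupp.sub_apply] at h2
  linarith

/-- If a function took another value at `w`, truncation at an intermediate level would place a chip
inside every edge of `F` while leaving a chip on every vertex of `I`, whose edges all stay inside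
`W`. There are too few chips for that. -/
theorem Divisor.ConstOn.insert {D : Γ.Divisor} (hr : Divisor.RankGE D 1)
    {W I : Finset Γ.V} (hne : W.Nonempty) (hW : Divisor.ConstOn D W) (hIW : I ⊆ W)
    (hI : ∀ e, Γ.src e ∈ I ∨ Γ.tgt e ∈ I → Γ.src e ∈ W ∧ Γ.tgt e ∈ W) {w : Γ.V} (hw : w ∉ W)
    (F : Finset Γ.E)
    (hF : ∀ e ∈ F, (Γ.src e = w ∧ Γ.tgt e ∈ W) ∨ (Γ.tgt e = w ∧ Γ.src e ∈ W))
    (hdeg : Divisor.deg D < F.card + I.card) {W' : Finset Γ.V}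
    (hW' : ∀ v ∈ W', v = w ∨ v ∈ W) : Divisor.ConstOn D W' := by
  classical
  obtain ⟨D₁, hD₁, hpos, hslope⟩ := hr.exists_normalized hne hW
  obtain ⟨w₀, hw₀⟩ := hne
  have key : ∀ D₂ ∈ Divisor.linearSystem D, ∀ φ : Γ.Point → ℝ, Γ.IsRational φ →
        (∀ p, (((D₂ - D₁) p : ℤ) : ℝ) = Γ.ord φ p) → φ (Sum.inl w) = φ (Sum.inl w₀) := by
    intro D₂ hD₂ φ hφ hord
    set c₀ := φ (Sum.inl w₀) with hc₀
    have hWc : ∀ w ∈ W, φ (Sum.inl w) = c₀ := fun w hw => hW D₁ hD₁ D₂ hD₂ φ hφ hord w hw w₀ hw₀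
    have hsl := hslope D₂ hD₂ φ hφ hord
    by_contra hne
    -- The function may have bumps inside the edges within `W`, so that truncation could take chips
    -- away from `I`. These edges are therefore flattened to the common value `c₀`.
    set ψ : Γ.Point → ℝ := fun p => match p with
      | Sum.inl x => φ (Sum.inl x)
      | Sum.inr ⟨e, t⟩ => if Γ.src e ∈ W ∧ Γ.tgt e ∈ W then c₀ else φ (Sum.inr ⟨e, t⟩) with hψ
    have hin : ∀ e, Γ.src e ∈ W ∧ Γ.tgt e ∈ W → (fun t => ψ (Γ.edge e t)) = fun _ => c₀ := by
      intro e he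
      funext t
      refine edge_induction (p := fun q => ψ q = c₀) e (hWc _ he.1) (hWc _ he.2) (fun t => ?_) t
      simp [hψ, he]
    have hout : ∀ e, ¬ (Γ.src e ∈ W ∧ Γ.tgt e ∈ W) →
        (fun t => ψ (Γ.edge e t)) = fun t => φ (Γ.edge e t) := by
      intro e he
      funext t
      refine edge_induction (p := fun q => ψ q = φ q) e rfl rfl (fun t => ?_) t
      simp only [hψ, if_neg he]
    have hψr : Γ.IsRational ψ := by
      intro e
      change IsPL (fun t => ψ (Γ.edge e t)) (Γ.length e)
      by_cases he : Γ.src e ∈ W ∧ Γ.tgt e ∈ W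
      · rw [hin e he]
        exact isPL_const _ _
      · rw [hout e he]
        exact hφ.isPL e
    obtain ⟨G, hG⟩ := hψr.exists_divisor
    -- Flattening keeps the divisor effective: by normalization the slopes removed at vertices of
    -- `W` contributed nonpositively to the order, and the flattened edges return to the chips of
    -- `D₁` in their interiors.
    have heff : Divisor.IsEffective (D₁ + G) := by
      intro p
      have h0 := hD₁.1 p
      have h0' := hD₂.1 p
      rw [Finsupp.add_apply]
      rcases p with x | ⟨e, t⟩
      · suffices h : (D₂ - D₁) (Sum.inl x) ≤ G (Sum.inl x) by
          rw [Finsupp.sub_apply] at h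
          linarith
        have h : (((D₂ - D₁) (Sum.inl x) : ℤ) : ℝ) ≤ G (Sum.inl x) := by
          rw [hord, hG, ord_inl, ord_inl]
          refine Finset.sum_le_sum fun e _ => add_le_add ?_ ?_
          · split_ifs with hx
            · by_cases he : Γ.src e ∈ W ∧ Γ.tgt e ∈ W
              · rw [srcSlope, srcSlope, hin e he, (rightSlope_const c₀ 0).derivWithin_eq]
                have := (hsl e).1 he.1
                rw [srcSlope] at this
                linarith
              · rw [srcSlope, srcSlope, hout e he]
            · exact le_rfl
          · split_ifs with hx
            · by_cases he : Γ.src e ∈ W ∧ Γ.tgt e ∈ W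
              · rw [tgtSlope, tgtSlope, hin e he, (leftSlope_const c₀ _).derivWithin_eq]
                have := (hsl e).2 he.2
                rwa [tgtSlope] at this
              · rw [tgtSlope, tgtSlope, hout e he]
            · exact le_rfl
        exact_mod_cast h
      · by_cases he : Γ.src e ∈ W ∧ Γ.tgt e ∈ W
        · have h := hG (Sum.inr ⟨e, t⟩)
          rw [ord_inr, hin e he, slopeDrop_eq (leftSlope_const c₀ _) (rightSlope_const c₀ _),
            sub_zero] at h
          have : G (Sum.inr ⟨e, t⟩) = 0 := by exact_mod_cast h
          rw [this, add_zero]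
          exact h0
        · have h := hG (Sum.inr ⟨e, t⟩)
          rw [ord_inr, hout e he, ← ord_inr, ← hord] at h
          have : G (Sum.inr ⟨e, t⟩) = (D₂ - D₁) (Sum.inr ⟨e, t⟩) := by exact_mod_cast h
          rw [this, Finsupp.sub_apply]
          linarith
    set c := (c₀ + φ (Sum.inl w)) / 2 with hc
    obtain ⟨D₃, hD₃, hD₃'⟩ := exists_truncation hψr hD₁.1 heff
      (fun p => by rw [add_sub_cancel_left, hG]) c
    have hD₃deg : Divisor.deg D₃ = Divisor.deg D :=
      Divisor.deg_eq_of_mem ⟨hD₃, hD₁.2.trans ⟨_, hψr.min_const c, hD₃'⟩⟩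
    have hex : ∀ e, ∃ t : Set.Ioo (0 : ℝ) (Γ.length e), e ∈ F → 1 ≤ D₃ (Sum.inr ⟨e, t⟩) := by
      intro e
      by_cases he : e ∈ F
      · have hcc : (ψ (Sum.inl (Γ.src e)) < c ∧ c < ψ (Sum.inl (Γ.tgt e))) ∨
            (ψ (Sum.inl (Γ.tgt e)) < c ∧ c < ψ (Sum.inl (Γ.src e))) := by
          simp only [hψ]
          rcases hF e he with ⟨h1, h2⟩ | ⟨h1, h2⟩
          · rw [h1, hWc _ h2]
            rcases lt_or_gt_of_ne hne with h3 | h3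
            · left; constructor <;> linarith
            · right; constructor <;> linarith
          · rw [h1, hWc _ h2]
            rcases lt_or_gt_of_ne hne with h3 | h3
            · right; constructor <;> linarith
            · left; constructor <;> linarith
        obtain ⟨t, -, ht⟩ := exists_ord_min_pos hψr hcc
        refine ⟨t, fun _ => ?_⟩
        rw [← hD₃'] at ht
        have h1 : 0 < (D₃ - D₁) (Sum.inr ⟨e, t⟩) := by exact_mod_cast ht
        have h2 := hD₁.1 (Sum.inr ⟨e, t⟩)
        rw [Finsupp.sub_apply] at h1
        linarith
      · have := Γ.length_pos e
        exact ⟨⟨Γ.length e / 2, by constructor <;> linarith⟩, fun h => absurd h he⟩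
    choose t ht using hex
    -- All edges at `v` are flat for `ψ`, hence for its truncation; the chip that `D₁` has at `v`
    -- stays.
    have hIpos : ∀ v ∈ I, 1 ≤ D₃ (Sum.inl v) := by
      intro v hv
      have h1 : Γ.ord (fun p => min (ψ p) c) (Sum.inl v) = 0 := by
        rw [ord_inl]
        refine Finset.sum_eq_zero fun e _ => ?_
        by_cases he : Γ.src e ∈ W ∧ Γ.tgt e ∈ W
        · have : (fun t => min (ψ (Γ.edge e t)) c) = fun _ => min c₀ c := by
            funext t
            rw [congrFun (hin e he) t]
          rw [srcSlope, tgtSlope, this, (rightSlope_const _ _).derivWithin_eq,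
            (leftSlope_const _ _).derivWithin_eq]
          simp
        · rw [if_neg, if_neg, add_zero]
          · rintro rfl
            exact he (hI e (Or.inr hv))
          · rintro rfl
            exact he (hI e (Or.inl hv))
      rw [← hD₃'] at h1
      have h2 : (D₃ - D₁) (Sum.inl v) = 0 := by exact_mod_cast h1
      have h3 := hpos v (hIW hv)
      rw [Finsupp.sub_apply] at h2
      linarith
    have h1 := Divisor.sum_le_deg hD₃ (Finset.disjSum I (F.sigma fun e => {t e}))
    rw [Finset.sum_disjSum, Finset.sum_sigma, hD₃deg] at h1
    have h2 : (I.card : ℤ) ≤ ∑ v ∈ I, D₃ (Sum.inl v) := by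
      simpa using Finset.sum_le_sum hIpos
    have h3 : (F.card : ℤ) ≤ ∑ e ∈ F, ∑ s ∈ {t e}, D₃ (Sum.inr ⟨e, s⟩) := by
      have : ∀ e ∈ F, (1 : ℤ) ≤ ∑ s ∈ {t e}, D₃ (Sum.inr ⟨e, s⟩) := fun e he => by
        rw [Finset.sum_singleton]
        exact ht e he
      simpa using Finset.sum_le_sum this
    linarith
  intro D₂ hD₂ D₃ hD₃ φ hφ hord u hu v hv
  suffices h : ∀ v ∈ W', φ (Sum.inl v) = φ (Sum.inl w₀) by rw [h u hu, h v hv]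
  intro v hv
  rcases hW' v hv with rfl | hv
  -- A function from `D₂` to `D₃` is compared through the normalized `D₁`: `χ` and `χ + φ` both
  -- start at `D₁`, so both have equal values at `v` and `w₀`, and hence so does `φ`.
  · obtain ⟨χ, hχ, hχord⟩ := hD₁.2.symm.trans hD₂.2
    have h1 := key D₂ hD₂ χ hχ hχord
    have h2 := key D₃ hD₃ _ (hχ.add hφ) fun p => by
      rw [ord_add hχ hφ, ← hord, ← hχord]
      push_cast [Finsupp.sub_apply]
      ring
    linarith
  · exact hW D₂ hD₂ D₃ hD₃ φ hφ hord v hv w₀ hw₀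

/-- In a path with vertices `0, …, N` and at least `k + 1` edges between `k` and `k + 1`, a divisor
of positive rank has degree at least `N`. -/
theorem Divisor.RankGE.le_deg_of_path {D : Γ.Divisor} (hr : Divisor.RankGE D 1) {N : ℕ}
    (pos : Γ.V ≃ Fin (N + 1)) (hE : ∀ e, (pos (Γ.tgt e) : ℕ) = pos (Γ.src e) + 1)
    (hcard : ∀ k < N, k + 1 ≤ (Finset.univ.filter fun e => (pos (Γ.src e) : ℕ) = k).card) :
    (N : ℤ) ≤ Divisor.deg D := by
  classical
  by_contra hlt
  rw [not_le] at hlt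
  -- The last `h + 1` vertices of the path.
  set W : ℕ → Finset Γ.V := fun h => Finset.univ.filter fun v => N ≤ pos v + h with hWdef
  have hmem : ∀ h v, v ∈ W h ↔ N ≤ pos v + h := fun h v => by simp [hWdef]
  have hne : ∀ h, (W h).Nonempty := fun h => ⟨pos.symm (Fin.last N), by
    rw [hmem, Equiv.apply_symm_apply, Fin.val_last]; omega⟩
  have main : ∀ h ≤ N, Divisor.ConstOn D (W h) := by
    intro h
    induction h with
    | zero =>
      intro _ D₁ _ D₂ _ φ _ _ u hu v hv
      rw [hmem] at hu hv
      have : u = v := pos.injective (Fin.ext (by omega))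
      rw [this]
    | succ h ih =>
      intro hN
      have hk : N - h - 1 < N + 1 := by omega
      -- Here `I` consists of the last `h` vertices, and `F` of the edges between `N - h - 1` and `N
      -- - h`, of which there are at least `N - h`. Together they require `N` chips.
      refine Divisor.ConstOn.insert hr (hne h) (ih (by omega))
        (I := Finset.univ.filter fun v => N + 1 ≤ pos v + h) (w := pos.symm ⟨N - h - 1, hk⟩)
        ?_ ?_ ?_ (Finset.univ.filter fun e => (pos (Γ.src e) : ℕ) = N - h - 1) ?_ ?_ ?_
      · intro v hv
        rw [hmem]
        have := (Finset.mem_filter.1 hv).2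
        omega
      · intro e he
        simp only [Finset.mem_filter, Finset.mem_univ, true_and] at he
        rw [hmem, hmem]
        have := hE e
        omega
      · rw [hmem, Equiv.apply_symm_apply]
        simp only
        omega
      · intro e he
        left
        have h1 := (Finset.mem_filter.1 he).2
        refine ⟨?_, ?_⟩
        · rw [Equiv.eq_symm_apply]
          exact Fin.ext h1
        · rw [hmem, hE, h1]
          omega
      · have h1 := hcard (N - h - 1) (by omega)
        have h2 : h ≤ (Finset.univ.filter fun v => N + 1 ≤ (pos v : ℕ) + h).card := by
          rw [← Finset.card_range h]
          refine Finset.card_le_card_of_injOn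
            (fun j => pos.symm ⟨N - j, by omega⟩) (fun j hj => ?_) ?_
          · have hj := Finset.mem_range.1 hj
            simp only [Finset.coe_filter, Finset.mem_univ, true_and, Set.mem_ofPred_eq,
              Equiv.apply_symm_apply]
            rw [Finset.card_range]
            omega
          · intro i hi j hj hij
            have hi := Finset.mem_range.1 hi
            have hj := Finset.mem_range.1 hj
            have := congrArg Fin.val (pos.symm.injective hij)
            simp only at this
            omega
        omega
      · intro v hv
        rw [hmem] at hv ⊢
        by_cases h1 : N ≤ pos v + h
        · exact Or.inr h1
        · left
          rw [Equiv.eq_symm_apply]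
          exact Fin.ext (by simp only; omega)
  -- With `W` the set of all vertices, normalization gives a chip at each of the `N + 1` vertices.
  obtain ⟨D₁, hD₁, hpos, -⟩ := hr.exists_normalized (hne N) (main N le_rfl)
  have h1 := Divisor.sum_le_deg hD₁.1 (Finset.univ.map ⟨Sum.inl, Sum.inl_injective⟩)
  rw [Finset.sum_map, Divisor.deg_eq_of_mem hD₁] at h1
  have h2 : ((Finset.univ : Finset Γ.V).card : ℤ) ≤ ∑ v : Γ.V, D₁ (Sum.inl v) := by
    simpa using Finset.sum_le_sum fun v (_ : v ∈ Finset.univ) => hpos v (by rw [hmem]; omega)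
  rw [Finset.card_univ, Fintype.card_congr pos, Fintype.card_fin] at h2
  push_cast at h2
  simp only [Function.Embedding.coeFn_mk] at h1
  linarith

end MetricGraph

namespace MetricGraph

variable {Γ : MetricGraph}

/-! ### The gonality of a path with multiple edges -/

/-- The function with values `a` at the vertices and `g e` on the edge `e`. -/
def glue (a : Γ.V → ℝ) (g : Γ.E → ℝ → ℝ) : Γ.Point → ℝ
  | Sum.inl x => a x
  | Sum.inr ⟨e, t⟩ => g e t

theorem glue_edge {a : Γ.V → ℝ} {g : Γ.E → ℝ → ℝ} {e : Γ.E} (h0 : g e 0 = a (Γ.src e))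
    (hL : g e (Γ.length e) = a (Γ.tgt e)) {t : ℝ} (ht : t ∈ Icc 0 (Γ.length e)) :
    glue a g (Γ.edge e t) = g e t := by
  rcases eq_or_lt_of_le ht.1 with rfl | h1
  · rw [edge_zero, h0]; rfl
  · rcases eq_or_lt_of_le ht.2 with rfl | h2
    · rw [edge_length, hL]; rfl
    · have := edge_of_mem e (⟨t, h1, h2⟩ : Ioo (0 : ℝ) (Γ.length e))
      simp only at this
      rw [this]; rfl

theorem _root_.IsPL.congr {h g : ℝ → ℝ} {L : ℝ} (H : IsPL g L) (hg : ∀ x ∈ Icc 0 L, h x = g x) :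
    IsPL h L := by
  obtain ⟨hc, P, hP⟩ := H
  refine ⟨hc.congr hg, P, fun s t h0 hst htL hav => ?_⟩
  obtain ⟨m, hm⟩ := hP s t h0 hst htL hav
  refine ⟨m, fun x hx => ?_⟩
  rw [hg x ⟨h0.trans hx.1, hx.2.trans htL⟩, hg s ⟨h0, hst.le.trans htL⟩, hm x hx]

section Glue

variable {a : Γ.V → ℝ} {g : Γ.E → ℝ → ℝ} (hg : ∀ e, IsPL (g e) (Γ.length e))
  (h0 : ∀ e, g e 0 = a (Γ.src e)) (hL : ∀ e, g e (Γ.length e) = a (Γ.tgt e))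
include h0 hL

theorem srcSlope_glue (e : Γ.E) : srcSlope (glue a g) e = derivWithin (g e) (Ioi 0) 0 := by
  refine Filter.EventuallyEq.derivWithin_eq ?_ (glue_edge (h0 e) (hL e) ⟨le_rfl, (Γ.length_pos e).le⟩)
  filter_upwards [Ioo_mem_nhdsGT (Γ.length_pos e)] with t ht
  exact glue_edge (h0 e) (hL e) ⟨ht.1.le, ht.2.le⟩

theorem tgtSlope_glue (e : Γ.E) :
    tgtSlope (glue a g) e = derivWithin (g e) (Iio (Γ.length e)) (Γ.length e) := by
  refine Filter.EventuallyEq.derivWithin_eq ?_ (glue_edge (h0 e) (hL e) ⟨(Γ.length_pos e).le, le_rfl⟩)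
  filter_upwards [Ioo_mem_nhdsLT (Γ.length_pos e)] with t ht
  exact glue_edge (h0 e) (hL e) ⟨ht.1.le, ht.2.le⟩

theorem ord_glue_inr (e : Γ.E) (t : Ioo (0 : ℝ) (Γ.length e)) :
    Γ.ord (glue a g) (Sum.inr ⟨e, t⟩) = slopeDrop (g e) t := by
  have h : (fun s => glue a g (Γ.edge e s)) =ᶠ[𝓝 t.1] g e := by
    filter_upwards [Ioo_mem_nhds t.2.1 t.2.2] with s hs
    exact glue_edge (h0 e) (hL e) ⟨hs.1.le, hs.2.le⟩
  rw [ord_inr, slopeDrop, slopeDrop]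
  congr 1
  · exact Filter.EventuallyEq.derivWithin_eq (h.filter_mono nhdsWithin_le_nhds) h.eq_of_nhds
  · exact Filter.EventuallyEq.derivWithin_eq (h.filter_mono nhdsWithin_le_nhds) h.eq_of_nhds

include hg in
theorem isRational_glue : Γ.IsRational (glue a g) := fun e =>
  (hg e).congr fun _ hx => glue_edge (h0 e) (hL e) hx

open Classical in
theorem ord_glue_inl {e : Γ.E} (hc : ∀ e' ≠ e, ∃ c : ℝ, g e' = fun _ => c) (x : Γ.V) :
    Γ.ord (glue a g) (Sum.inl x) =
      (if Γ.src e = x then - derivWithin (g e) (Ioi 0) 0 else 0) +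
        (if Γ.tgt e = x then derivWithin (g e) (Iio (Γ.length e)) (Γ.length e) else 0) := by
  rw [ord_inl, Finset.sum_eq_single e]
  · rw [srcSlope_glue h0 hL, tgtSlope_glue h0 hL]
  · intro e' _ he'
    obtain ⟨c, hc⟩ := hc e' he'
    rw [srcSlope_glue h0 hL, tgtSlope_glue h0 hL, hc, (rightSlope_const c 0).derivWithin_eq,
      (leftSlope_const c _).derivWithin_eq]
    simp
  · intro h
    exact absurd (Finset.mem_univ e) h

end Glue

/-! ### Moving chips along a single edge -/

theorem isPL_rise (t L : ℝ) : IsPL (fun x => min x t) L := by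
  simpa using (isPL_linear 0 1 L).min_const t

theorem isPL_fall (t L : ℝ) : IsPL (fun x => min (L - x) t) L := by
  simpa [sub_eq_add_neg] using (isPL_linear L (-1) L).min_const t

theorem rightSlope_id (x : ℝ) : RightSlope (fun z => z) x 1 :=
  Eventually.of_forall fun z => by ring

theorem leftSlope_id (x : ℝ) : LeftSlope (fun z => z) x 1 :=
  Eventually.of_forall fun z => by ring

theorem rightSlope_sub (L x : ℝ) : RightSlope (fun z => L - z) x (-1) :=
  Eventually.of_forall fun z => by ring

theorem leftSlope_sub (L x : ℝ) : LeftSlope (fun z => L - z) x (-1) :=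
  Eventually.of_forall fun z => by ring

theorem slopeDrop_rise (t x : ℝ) : slopeDrop (fun x => min x t) x = if x = t then 1 else 0 := by
  rcases lt_trichotomy x t with h | h | h
  · rw [slopeDrop_eq ((leftSlope_id x).min_of_lt h) ((rightSlope_id x).min_of_lt h), if_neg h.ne,
      sub_self]
  · rw [slopeDrop_eq ((leftSlope_id x).min_of_eq h) ((rightSlope_id x).min_of_eq h), if_pos h]
    norm_num
  · rw [slopeDrop_eq ((leftSlope_id x).min_of_gt h) ((rightSlope_id x).min_of_gt h), if_neg h.ne',
      sub_self]

theorem slopeDrop_fall (L t x : ℝ) :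
    slopeDrop (fun x => min (L - x) t) x = if x = L - t then 1 else 0 := by
  rcases lt_trichotomy (L - x) t with h | h | h
  · rw [slopeDrop_eq ((leftSlope_sub L x).min_of_lt h) ((rightSlope_sub L x).min_of_lt h),
      if_neg (by intro h'; linarith), sub_self]
  · rw [slopeDrop_eq ((leftSlope_sub L x).min_of_eq h) ((rightSlope_sub L x).min_of_eq h),
      if_pos (by linarith)]
    norm_num
  · rw [slopeDrop_eq ((leftSlope_sub L x).min_of_gt h) ((rightSlope_sub L x).min_of_gt h),
      if_neg (by intro h'; linarith), sub_self]

theorem slopeDrop_add {h g : ℝ → ℝ} {L x : ℝ} (H : IsPL h L) (G : IsPL g L) (hx : x ∈ Ioo 0 L) :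
    slopeDrop (fun z => h z + g z) x = slopeDrop h x + slopeDrop g x := by
  obtain ⟨m, hm⟩ := H.exists_leftSlope hx.1 hx.2.le
  obtain ⟨m', hm'⟩ := H.exists_rightSlope hx.1.le hx.2
  obtain ⟨n, hn⟩ := G.exists_leftSlope hx.1 hx.2.le
  obtain ⟨n', hn'⟩ := G.exists_rightSlope hx.1.le hx.2
  rw [slopeDrop_eq hm hm', slopeDrop_eq hn hn', slopeDrop_eq (hm.add hn) (hm'.add hn')]
  ring

/-- Two chips at the end points of an edge can be moved to symmetric points of the edge. -/
theorem exists_tent (e : Γ.E) (t t' : Ioo (0 : ℝ) (Γ.length e)) (htt : t'.1 = Γ.length e - t.1) :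
    ∃ φ, Γ.IsRational φ ∧ ∀ p, (((Finsupp.single (Sum.inr ⟨e, t⟩) 1 +
      Finsupp.single (Sum.inr ⟨e, t'⟩) 1 - Finsupp.single (Sum.inl (Γ.src e)) 1 -
        Finsupp.single (Sum.inl (Γ.tgt e)) 1 : Γ.Divisor) p : ℤ) : ℝ) = Γ.ord φ p := by
  classical
  -- A trapezoid that vanishes at both ends of the edge, with plateau between `t` and `L - t`.
  -- Written as a sum, it needs no distinction of whether `t` is before or after the midpoint, and
  -- at the midpoint the two drops add up to 2.
  set T : ℝ → ℝ := fun x => min x t.1 + (min ((Γ.length e) - x) t.1 + (- t.1)) with hT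
  set g : Γ.E → ℝ → ℝ := fun e' => if e' = e then T else fun _ => 0 with hgdef
  have hge : g e = T := by simp [hgdef]
  have hgne : ∀ e' ≠ e, g e' = fun _ => 0 := fun e' h => by simp [hgdef, h]
  have ht0 := t.2.1
  have htL := t.2.2
  have hTpl : IsPL T (Γ.length e) := (isPL_rise _ _).add ((isPL_fall _ _).add (isPL_const _ _))
  have hg : ∀ e', IsPL (g e') (Γ.length e') := by
    intro e'
    by_cases h : e' = e
    · obtain rfl := h.symm; rw [hge]; exact hTpl
    · rw [hgne e' h]; exact isPL_const _ _
  have h0 : ∀ e', g e' 0 = (fun _ : Γ.V => (0 : ℝ)) (Γ.src e') := by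
    intro e'
    by_cases h : e' = e
    · obtain rfl := h.symm
      rw [hge, hT]
      simp only [sub_zero]
      rw [min_eq_left ht0.le, min_eq_right htL.le]; ring
    · rw [hgne e' h]
  have hL : ∀ e', g e' (Γ.length e') = (fun _ : Γ.V => (0 : ℝ)) (Γ.tgt e') := by
    intro e'
    by_cases h : e' = e
    · obtain rfl := h.symm
      rw [hge, hT]
      simp only [sub_self]
      rw [min_eq_left ht0.le, min_eq_right htL.le]; ring
    · rw [hgne e' h]
  refine ⟨glue (fun _ => 0) g, isRational_glue hg h0 hL, ?_⟩
  rintro (x | ⟨e', s⟩)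
  · rw [ord_glue_inl h0 hL (e := e) (fun e' h => ⟨0, hgne e' h⟩), hge]
    have hr : RightSlope T 0 (1 + (0 + 0)) :=
      ((rightSlope_id 0).min_of_lt ht0).add
        (((rightSlope_sub (Γ.length e) 0).min_of_gt (by linarith)).add (rightSlope_const _ _))
    have hl : LeftSlope T (Γ.length e) (0 + (-1 + 0)) :=
      ((leftSlope_id (Γ.length e)).min_of_gt htL).add
        (((leftSlope_sub (Γ.length e) (Γ.length e)).min_of_lt (by linarith)).add (leftSlope_const _ _))
    rw [hr.derivWithin_eq, hl.derivWithin_eq]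
    simp only [Finsupp.sub_apply, Finsupp.add_apply, Finsupp.single_apply, reduceCtorEq, if_false,
      Sum.inl.injEq]
    split_ifs <;> norm_num
  · rw [ord_glue_inr h0 hL]
    by_cases h : e' = e
    · obtain rfl := h.symm
      rw [hge, hT, slopeDrop_add (L := Γ.length e) (isPL_rise _ _) ((isPL_fall _ _).add (isPL_const _ _)) s.2,
        slopeDrop_add (L := Γ.length e) (isPL_fall _ _) (isPL_const _ _) s.2, slopeDrop_rise, slopeDrop_fall,
        slopeDrop_eq (leftSlope_const _ _) (rightSlope_const _ _), ← htt]
      simp only [Finsupp.sub_apply, Finsupp.add_apply, Finsupp.single_apply, reduceCtorEq, if_false,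
        Sum.inr.injEq, Sigma.mk.injEq, heq_eq_eq, true_and, Subtype.ext_iff]
      have h1 : (t.1 = s.1) ↔ s.1 = t.1 := eq_comm
      have h2 : (t'.1 = s.1) ↔ s.1 = t'.1 := eq_comm
      simp only [h1, h2]
      push_cast
      ring
    · rw [hgne e' h, slopeDrop_eq (leftSlope_const _ _) (rightSlope_const _ _)]
      simp [Ne.symm h]

/-- A chip at the end of a bridge, beyond which lies a single vertex, can be moved along
the bridge. -/
theorem exists_bridge (e : Γ.E) (hloop : Γ.src e ≠ Γ.tgt e)
    (he : ∀ e', Γ.src e' = Γ.src e ∨ Γ.tgt e' = Γ.src e → e' = e) (t : ℝ)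
    (ht0 : 0 ≤ t) (htL : t < Γ.length e) :
    ∃ φ, Γ.IsRational φ ∧ ∀ p, (((Finsupp.single (Γ.edge e t) 1 -
        Finsupp.single (Sum.inl (Γ.tgt e)) 1 : Γ.Divisor) p : ℤ) : ℝ) = Γ.ord φ p := by
  classical
  -- Constant from the source up to the point `t`, then of slope -1 down to 0 at the target. The
  -- rest of the graph sees only the value 0, because no other edge meets the source.
  set T : ℝ → ℝ := fun x => min ((Γ.length e) - x) ((Γ.length e) - t) with hT
  set a : Γ.V → ℝ := fun v => if v = Γ.src e then (Γ.length e) - t else 0 with ha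
  set g : Γ.E → ℝ → ℝ := fun e' => if e' = e then T else fun _ => 0 with hgdef
  have hge : g e = T := by simp [hgdef]
  have hgne : ∀ e' ≠ e, g e' = fun _ => 0 := fun e' h => by simp [hgdef, h]
  have hg : ∀ e', IsPL (g e') (Γ.length e') := by
    intro e'
    by_cases h : e' = e
    · obtain rfl := h.symm; rw [hge]; exact isPL_fall _ _
    · rw [hgne e' h]; exact isPL_const _ _
  have h0 : ∀ e', g e' 0 = a (Γ.src e') := by
    intro e'
    by_cases h : e' = e
    · obtain rfl := h.symm
      rw [hge, hT, ha]
      simp only [sub_zero, if_true]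
      rw [min_eq_right (by linarith)]
    · rw [hgne e' h, ha]
      simp only
      rw [if_neg fun h' => h (he e' (Or.inl h'))]
  have hL : ∀ e', g e' (Γ.length e') = a (Γ.tgt e') := by
    intro e'
    by_cases h : e' = e
    · obtain rfl := h.symm
      rw [hge, hT, ha]
      simp only [sub_self, if_neg hloop.symm]
      rw [min_eq_left (by linarith)]
    · rw [hgne e' h, ha]
      simp only
      rw [if_neg fun h' => h (he e' (Or.inr h'))]
  refine ⟨glue a g, isRational_glue hg h0 hL, ?_⟩
  have hl : LeftSlope T (Γ.length e) (-1) := (leftSlope_sub (Γ.length e) (Γ.length e)).min_of_lt (by linarith)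
  rcases eq_or_lt_of_le ht0 with rfl | ht0
  · have hr : RightSlope T 0 (min (-1) 0) := (rightSlope_sub (Γ.length e) 0).min_of_eq rfl
    rw [edge_zero]
    rintro (x | ⟨e', s⟩)
    · rw [ord_glue_inl h0 hL (e := e) (fun e' h => ⟨0, hgne e' h⟩), hge,
        hr.derivWithin_eq, hl.derivWithin_eq]
      simp only [Finsupp.sub_apply, Finsupp.single_apply, Sum.inl.injEq]
      split_ifs <;> norm_num
    · rw [ord_glue_inr h0 hL]
      by_cases h : e' = e
      · obtain rfl := h.symm
        have : s.1 < (Γ.length e) := s.2.2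
        have hs := s.2.1
        rw [hge, hT, slopeDrop_fall, if_neg (by linarith)]
        simp
      · rw [hgne e' h, slopeDrop_eq (leftSlope_const _ _) (rightSlope_const _ _)]
        simp
  · have hr : RightSlope T 0 0 := (rightSlope_sub (Γ.length e) 0).min_of_gt (by linarith)
    obtain ⟨t', rfl⟩ : ∃ t' : Ioo (0 : ℝ) (Γ.length e), t = t'.1 := ⟨⟨t, ht0, htL⟩, rfl⟩
    rw [edge_of_mem]
    rintro (x | ⟨e', s⟩)
    · rw [ord_glue_inl h0 hL (e := e) (fun e' h => ⟨0, hgne e' h⟩), hge,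
        hr.derivWithin_eq, hl.derivWithin_eq]
      simp only [Finsupp.sub_apply, Finsupp.single_apply, Sum.inl.injEq, reduceCtorEq, if_false]
      split_ifs <;> norm_num
    · rw [ord_glue_inr h0 hL]
      by_cases h : e' = e
      · obtain rfl := h.symm
        rw [hge, hT, slopeDrop_fall]
        simp only [Finsupp.sub_apply, Finsupp.single_apply, reduceCtorEq, if_false,
          Sum.inr.injEq, Sigma.mk.injEq, heq_eq_eq, true_and, Subtype.ext_iff, sub_sub_cancel]
        have h1 : (t'.1 = s.1) ↔ s.1 = t'.1 := eq_comm
        simp only [h1]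
        push_cast
        ring
      · rw [hgne e' h, slopeDrop_eq (leftSlope_const _ _) (rightSlope_const _ _)]
        simp [Ne.symm h]

theorem Divisor.eq_single_of_deg_eq_one {E : Γ.Divisor} (hE : Divisor.IsEffective E)
    (hdeg : Divisor.deg E = 1) : ∃ p, E = Finsupp.single p 1 := by
  classical
  have hne : ∃ p, 1 ≤ E p := by
    by_contra! h
    have : E = 0 := by
      ext p
      have h1 := h p
      have h2 := hE p
      change E p = 0
      omega
    rw [this] at hdeg
    simp [Divisor.deg] at hdeg
  obtain ⟨p, hp⟩ := hne
  refine ⟨p, ?_⟩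
  have heff : Divisor.IsEffective (E - Finsupp.single p 1) := by
    intro q
    have := hE q
    rw [Finsupp.sub_apply, Finsupp.single_apply]
    split_ifs with h
    · subst h; linarith
    · linarith
  have h0 : Divisor.deg (E - Finsupp.single p 1) = 0 := by
    rw [Divisor.deg_sub, Divisor.deg_single, hdeg, sub_self]
  ext q
  have h1 := Divisor.sum_le_deg heff {q}
  have h2 := heff q
  rw [Finset.sum_singleton, h0] at h1
  rw [Finsupp.sub_apply] at h1 h2
  linarith

/-- This bounds ranks from above: a divisor of rank at least two and minimal degree would leave,
after removal of a point, a divisor of positive rank and too small a degree. -/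
theorem Divisor.RankGE.sub_single {D : Γ.Divisor} {k : ℕ} (h : Divisor.RankGE D (k + 1))
    (p : Γ.Point) : Divisor.RankGE (D - Finsupp.single p 1) k := by
  classical
  intro E hE hdeg
  rw [sub_sub]
  refine h _ (fun q => ?_) ?_
  · have := hE q
    rw [Finsupp.add_apply, Finsupp.single_apply]
    split_ifs <;> linarith
  · rw [Divisor.deg_add, Divisor.deg_single, hdeg]
    push_cast
    ring

theorem Divisor.mem_linearSystem_of_ord {D D' G : Γ.Divisor} {φ : Γ.Point → ℝ}
    (hφ : Γ.IsRational φ) (hG : ∀ p, ((G p : ℤ) : ℝ) = Γ.ord φ p) (h : D' = D + G)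
    (hD' : Divisor.IsEffective D') : D' ∈ Divisor.linearSystem D :=
  ⟨hD', φ, hφ, fun p => by rw [h, add_sub_cancel_left, hG]⟩

/-- The gonality of a path with vertices `0, …, N`, with at least `k + 1` edges between `k` and
`k + 1`, and with one edge between `0` and `1`. -/
theorem isGonality_of_path {N : ℕ}
    (pos : Γ.V ≃ Fin (N + 1)) (hE : ∀ e, (pos (Γ.tgt e) : ℕ) = pos (Γ.src e) + 1)
    (hcard : ∀ k < N, k + 1 ≤ (Finset.univ.filter fun e => (pos (Γ.src e) : ℕ) = k).card)
    (hbridge : ∀ e e', (pos (Γ.src e) : ℕ) = 0 → (pos (Γ.src e') : ℕ) = 0 → e = e') :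
    Γ.IsGonality ((max N 1 : ℕ) : ℤ) := by
  classical
  have lower : ∀ D : Γ.Divisor, Divisor.RankGE D 1 → ((max N 1 : ℕ) : ℤ) ≤ Divisor.deg D := by
    intro D hD
    have h1 := hD.le_deg_of_path pos hE hcard
    have h2 := hD.one_le_deg (Sum.inl (pos.symm 0))
    rw [Nat.cast_max]
    exact max_le h1 (by exact_mod_cast h2)
  -- The vertices 1, …, N carry one chip each. If `N = 0` the graph is a single point, which must
  -- carry the chip itself.
  set A : Finset Γ.V := Finset.univ.filter fun v => 1 ≤ (pos v : ℕ) ∨ N = 0 with hA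
  have hAmem : ∀ v, v ∈ A ↔ (1 ≤ (pos v : ℕ) ∨ N = 0) := fun v => by simp [hA]
  set D : Γ.Divisor := ∑ v ∈ A, Finsupp.single (Sum.inl v) 1 with hD
  have hDinl : ∀ v, D (Sum.inl v) = if v ∈ A then 1 else 0 := by
    intro v
    rw [hD, Finsupp.finsetSum_apply]
    simp [Finsupp.single_apply]
  have hDinr : ∀ q, D (Sum.inr q) = 0 := by
    intro q
    rw [hD, Finsupp.finsetSum_apply]
    simp
  have hAcard : A.card = max N 1 := by
    have h1 : A.card = (Finset.univ.filter fun i : Fin (N + 1) => 1 ≤ (i : ℕ) ∨ N = 0).card := by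
      refine Finset.card_equiv pos fun v => ?_
      simp [hA]
    rw [h1]
    rcases Nat.eq_zero_or_pos N with h | h
    · subst h; simp
    · have : (Finset.univ.filter fun i : Fin (N + 1) => 1 ≤ (i : ℕ) ∨ N = 0) =
          Finset.univ.erase 0 := by
        ext i
        simp only [Finset.mem_filter, Finset.mem_univ, true_and, Finset.mem_erase, and_true, ne_eq,
          Fin.ext_iff, Fin.val_zero]
        omega
      rw [this, Finset.card_erase_of_mem (Finset.mem_univ _), Finset.card_univ, Fintype.card_fin]
      omega
  have hdeg : Divisor.deg D = ((max N 1 : ℕ) : ℤ) := by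
    have h1 : D.support ⊆ A.map ⟨Sum.inl, Sum.inl_injective⟩ := by
      rintro (v | q) hp
      · have := Finsupp.mem_support_iff.1 hp
        rw [hDinl] at this
        simpa using this
      · exact absurd (hDinr q) (Finsupp.mem_support_iff.1 hp)
    rw [D.deg_eq_sum h1, Finset.sum_map]
    simp only [Function.Embedding.coeFn_mk]
    rw [Finset.sum_congr rfl fun v hv => by rw [hDinl, if_pos hv]]
    simp [hAcard]
  -- Points of the bridge between 0 and 1, including 0, are reached by the chip at 1.
  have hbr : ∀ e, (pos (Γ.src e) : ℕ) = 0 → ∀ t, 0 ≤ t → t < Γ.length e →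
      (Divisor.linearSystem (D - Finsupp.single (Γ.edge e t) 1)).Nonempty := by
    intro e he t ht0 htL
    obtain ⟨φ, hφ, hord⟩ := exists_bridge e
      (fun h => by have := hE e; rw [h] at this; omega) (fun e' he' => by
        rcases he' with he' | he'
        · exact hbridge e' e (by rw [he', he]) he
        · have := hE e'
          rw [he', he] at this
          omega) t ht0 htL
    refine ⟨D - Finsupp.single (Sum.inl (Γ.tgt e)) 1,
      Divisor.mem_linearSystem_of_ord hφ hord ((sub_add_sub_cancel _ _ _).symm) ?_⟩
    rintro (x | q)
    · rw [Finsupp.sub_apply, hDinl, Finsupp.single_apply]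
      simp only [Sum.inl.injEq]
      by_cases hx : Γ.tgt e = x
      · rw [if_pos ((hAmem x).2 (Or.inl (by rw [← hx, hE]; omega))), if_pos hx, sub_self]
      · rw [if_neg hx]
        split_ifs <;> norm_num
    · rw [Finsupp.sub_apply, hDinr]
      simp
  have hrank : Divisor.RankGE D 1 := by
    intro E hEeff hEdeg
    obtain ⟨p, rfl⟩ := Divisor.eq_single_of_deg_eq_one hEeff (by exact_mod_cast hEdeg)
    rcases p with v | ⟨e, t⟩
    · by_cases hv : v ∈ A
      · refine ⟨_, ⟨fun q => ?_, Divisor.IsEquivalent.refl _⟩⟩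
        rw [Finsupp.sub_apply, Finsupp.single_apply]
        split_ifs with h
        · subst h
          rw [hDinl, if_pos hv, sub_self]
        · rcases q with x | q
          · rw [hDinl]; split_ifs <;> norm_num
          · rw [hDinr]; norm_num
      · rw [hAmem] at hv
        push Not at hv
        have h1 := hcard 0 (by omega)
        obtain ⟨e, he⟩ := Finset.card_pos.1 (lt_of_lt_of_le Nat.one_pos h1)
        have he := (Finset.mem_filter.1 he).2
        have hsrc : Γ.src e = v := pos.injective (Fin.ext (by omega))
        have := hbr e he 0 le_rfl (Γ.length_pos e)
        rwa [edge_zero, hsrc] at this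
    · by_cases he : (pos (Γ.src e) : ℕ) = 0
      · have := hbr e he t.1 t.2.1.le t.2.2
        rwa [edge_of_mem] at this
      -- Both ends of `e` carry a chip, and these move to the given point and its mirror image.
      · obtain ⟨φ, hφ, hord⟩ := exists_tent e t
          ⟨Γ.length e - t.1, by constructor <;> linarith [t.2.1, t.2.2]⟩ rfl
        refine ⟨D + Finsupp.single (Sum.inr ⟨e, ⟨Γ.length e - t.1, by
            constructor <;> linarith [t.2.1, t.2.2]⟩⟩) 1 -
          Finsupp.single (Sum.inl (Γ.src e)) 1 - Finsupp.single (Sum.inl (Γ.tgt e)) 1,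
          Divisor.mem_linearSystem_of_ord hφ hord (by ext q; simp only [Finsupp.sub_apply, Finsupp.add_apply]; ring) ?_⟩
        have hE' := hE e
        rintro (x | q)
        · rw [Finsupp.sub_apply, Finsupp.sub_apply, Finsupp.add_apply, hDinl]
          simp only [Finsupp.single_apply, Sum.inl.injEq, reduceCtorEq, if_false]
          by_cases hx : Γ.src e = x
          · have hx' : Γ.tgt e ≠ x := fun h => by
              rw [← hx] at h; rw [h] at hE'; omega
            rw [if_pos ((hAmem x).2 (Or.inl (by rw [← hx]; omega))), if_pos hx, if_neg hx']
            norm_num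
          · by_cases hx' : Γ.tgt e = x
            · rw [if_pos ((hAmem x).2 (Or.inl (by rw [← hx']; omega))), if_pos hx', if_neg hx]
              norm_num
            · rw [if_neg hx, if_neg hx']
              split_ifs <;> norm_num
        · rw [Finsupp.sub_apply, Finsupp.sub_apply, Finsupp.add_apply, hDinr]
          simp only [Finsupp.single_apply, reduceCtorEq, if_false]
          split_ifs <;> norm_num
  refine ⟨⟨D, ⟨hrank, fun h2 => ?_⟩, hdeg⟩, ?_⟩
  · have h3 := lower _ (h2.sub_single (Sum.inl (pos.symm 0)))
    rw [Divisor.deg_sub, Divisor.deg_single, hdeg] at h3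
    linarith
  · rintro d ⟨D', hD', rfl⟩
    exact lower D' hD'.1

end MetricGraph

/-! ### The subdivision into strips parallel to the hypotenuse of a standard triangle -/

/-- The convex set `S` in the positive quadrant contains the triangle `x + y ≤ N` and a further
interior point, and the rest of `S` is a lattice polygon. -/
structure ExtendsTriangle (S : Set Plane) (N : ℕ) : Prop where
  convex : Convex ℝ S
  nonneg : ∀ p ∈ S, 0 ≤ p.1 ∧ 0 ≤ p.2
  triangle : ∀ p : Plane, 0 ≤ p.1 → 0 ≤ p.2 → p.1 + p.2 ≤ N → p ∈ S
  exists_interior : ∃ q ∈ interior S, (N : ℝ) < q.1 + q.2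
  polygon : IsLatticePolygon {p | p ∈ S ∧ (N : ℝ) ≤ p.1 + p.2}

theorem IsLatticePolygon.isClosed {T : Set Plane} (h : IsLatticePolygon T) : IsClosed T := by
  obtain ⟨F, rfl⟩ := h
  exact ((F.finite_toSet.image _).isCompact_convexHull (𝕜 := ℝ)).isClosed

/-- A convex function whose slope in the direction of the axes increases by one at each of the
lines `x + y = 1, …, N`. -/
noncomputable def stripValue (N : ℕ) (p : Plane) : ℝ :=
  ∑ j ∈ Finset.range N, max 0 (p.1 + p.2 - (j + 1))

/-- The part of `S` between the lines `x + y = k` and `x + y = k + 1`; there is no upper bound if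
`k = N`. -/
def strip (S : Set Plane) (N k : ℕ) : Set Plane :=
  {p | p ∈ S ∧ (k : ℝ) ≤ p.1 + p.2 ∧ (k < N → p.1 + p.2 ≤ k + 1)}

/-- The difference of `stripValue` and its linear part on the strip `k`. -/
noncomputable def stripGap (N k : ℕ) (s : ℝ) : ℝ :=
  ∑ j ∈ Finset.range N, if j < k then max 0 ((j + 1) - s) else max 0 (s - (j + 1))

/-- For `j < k` the summand max(0, s - (j + 1)) is the linear term s - (j + 1) plus max(0, (j + 1) -
s). The linear terms sum to k s - k (k + 1) / 2, and the rest is `stripGap`. -/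
theorem stripValue_eq {N k : ℕ} (hk : k ≤ N) (p : Plane) :
    stripValue N p = k * (p.1 + p.2) - k * (k + 1) / 2 + stripGap N k (p.1 + p.2) := by
  set s := p.1 + p.2 with hs
  have h1 : stripValue N p - stripGap N k s =
      ∑ j ∈ Finset.range N, if j < k then s - (j + 1) else 0 := by
    rw [stripValue, stripGap, ← Finset.sum_sub_distrib]
    refine Finset.sum_congr rfl fun j _ => ?_
    rw [← hs]
    split_ifs
    · rcases le_total s (j + 1) with h | h
      · rw [max_eq_left (by linarith), max_eq_right (by linarith)]; ring
      · rw [max_eq_right (by linarith), max_eq_left (by linarith)]; ring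
    · exact sub_self _
  have h2 : ∑ j ∈ Finset.range N, (if j < k then s - (j + 1) else (0 : ℝ)) =
      ∑ j ∈ Finset.range k, (s - (j + 1)) := by
    rw [← Finset.sum_filter]
    congr 1
    ext j
    simp only [Finset.mem_filter, Finset.mem_range]
    omega
  have h3 : ∀ k : ℕ, ∑ j ∈ Finset.range k, (s - (j + 1)) = k * s - k * (k + 1) / 2 := by
    intro k
    induction k with
    | zero => simp
    | succ k ih => rw [Finset.sum_range_succ, ih]; push_cast; ring
  rw [h2, h3] at h1
  linarith

/-- All summands are nonnegative. The term `j = k - 1` gives the lower bound and the term `j = k`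
the upper one; for `k = 0` the lower bound is the hypothesis on `s`. -/
theorem stripGap_eq_zero_iff {N k : ℕ} (hk : k ≤ N) {s : ℝ} (hs : 0 ≤ s) :
    stripGap N k s = 0 ↔ (k : ℝ) ≤ s ∧ (k < N → s ≤ k + 1) := by
  rw [stripGap, Finset.sum_eq_zero_iff_of_nonneg (fun j _ => by split_ifs <;> exact le_max_left _ _)]
  constructor
  · intro h
    constructor
    · rcases Nat.eq_zero_or_pos k with rfl | h0
      · simpa using hs
      · have := h (k - 1) (Finset.mem_range.2 (by omega))
        rw [if_pos (by omega), max_eq_left_iff, Nat.cast_sub h0] at this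
        push_cast at this
        linarith
    · intro hkN
      have := h k (Finset.mem_range.2 hkN)
      rw [if_neg (lt_irrefl k), max_eq_left_iff] at this
      linarith
  · rintro ⟨h1, h2⟩ j hj
    split_ifs with hjk
    · have : (j : ℝ) + 1 ≤ k := by exact_mod_cast hjk
      rw [max_eq_left_iff]; linarith
    · have hjN := Finset.mem_range.1 hj
      have h3 : (k : ℝ) ≤ j := by exact_mod_cast not_lt.1 hjk
      have := h2 (by omega)
      rw [max_eq_left_iff]; linarith

theorem exists_pos_add_smul_mem {T : Set Plane} {q : Plane} (hq : q ∈ interior T) (d : Plane) :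
    ∃ t : ℝ, 0 < t ∧ q + t • d ∈ T := by
  have h1 : Continuous fun t : ℝ => q + t • d := by fun_prop
  have h2 : Tendsto (fun t : ℝ => q + t • d) (𝓝[>] 0) (𝓝 q) := by
    simpa using (h1.tendsto 0).mono_left nhdsWithin_le_nhds
  obtain ⟨t, ht1, ht2⟩ :=
    ((h2.eventually (mem_interior_iff_mem_nhds.1 hq)).and self_mem_nhdsWithin).exists
  exact ⟨t, ht2, ht1⟩

/-- An affine function that vanishes on a set with interior points is zero. -/
theorem affine_eq_zero {T : Set Plane} (hT : (interior T).Nonempty) {α β γ : ℝ}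
    (h : ∀ p ∈ T, α * p.1 + β * p.2 + γ = 0) : α = 0 ∧ β = 0 ∧ γ = 0 := by
  obtain ⟨q, hq⟩ := hT
  have h0 := h q (interior_subset hq)
  obtain ⟨t, ht, htT⟩ := exists_pos_add_smul_mem hq (1, 0)
  obtain ⟨u, hu, huT⟩ := exists_pos_add_smul_mem hq (0, 1)
  have h1 := h _ htT
  have h2 := h _ huT
  simp only [Prod.fst_add, Prod.snd_add, Prod.smul_fst, Prod.smul_snd, smul_eq_mul, mul_one,
    mul_zero, add_zero] at h1 h2
  have hα : α = 0 := by
    have : α * t = 0 := by linarith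
    exact (mul_eq_zero.1 this).resolve_right ht.ne'
  have hβ : β = 0 := by
    have : β * u = 0 := by linarith
    exact (mul_eq_zero.1 this).resolve_right hu.ne'
  subst hα hβ
  exact ⟨rfl, rfl, by linarith⟩

/-! ### The strips are the maximal domains of linearity -/

theorem strip_last (S : Set Plane) (N : ℕ) :
    strip S N N = {p | p ∈ S ∧ (N : ℝ) ≤ p.1 + p.2} := by
  ext p
  simp [strip]

namespace ExtendsTriangle

variable {S : Set Plane} {N : ℕ} (h : ExtendsTriangle S N)
include h

/-- A strip is exactly the set where `stripValue` meets one of its supporting affine functions.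
Convexity of the graph thus never has to be examined cell by cell. -/
theorem mem_strip_iff {k : ℕ} (hk : k ≤ N) {p : Plane} (hp : p ∈ S) :
    p ∈ strip S N k ↔ stripValue N p = k * p.1 + k * p.2 + - (k * (k + 1) / 2 : ℝ) := by
  have h0 := h.nonneg p hp
  rw [stripValue_eq hk, strip, Set.mem_ofPred_eq, and_iff_right hp,
    ← stripGap_eq_zero_iff hk (add_nonneg h0.1 h0.2)]
  constructor <;> intro h <;> linarith

theorem convex_strip (k : ℕ) : Convex ℝ (strip S N k) := by
  rintro p ⟨hp1, hp2, hp3⟩ q ⟨hq1, hq2, hq3⟩ s t hs ht hst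
  refine ⟨h.convex hp1 hq1 hs ht hst, ?_, fun hk => ?_⟩
  · simp only [Prod.fst_add, Prod.snd_add, Prod.smul_fst, Prod.smul_snd, smul_eq_mul]
    have h1 : (s + t) * (k : ℝ) = k := by rw [hst, one_mul]
    nlinarith [mul_le_mul_of_nonneg_left hp2 hs, mul_le_mul_of_nonneg_left hq2 ht]
  · simp only [Prod.fst_add, Prod.snd_add, Prod.smul_fst, Prod.smul_snd, smul_eq_mul]
    have h1 : (s + t) * ((k : ℝ) + 1) = k + 1 := by rw [hst, one_mul]
    nlinarith [mul_le_mul_of_nonneg_left (hp3 hk) hs, mul_le_mul_of_nonneg_left (hq3 hk) ht]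

/-- For `k < N` the strip is a trapezoid (a triangle if `k = 0`) that does not depend on `S`: a
point (x, y) lies between (x + y, 0) and (0, x + y), and these lie on its sides along the axes. The
last strip is covered by the field `polygon`. -/
theorem isLatticePolygon_strip {k : ℕ} (hk : k ≤ N) : IsLatticePolygon (strip S N k) := by
  rcases eq_or_lt_of_le hk with rfl | hk
  · rw [strip_last]
    exact h.polygon
  have hkN : (k : ℝ) + 1 ≤ N := by exact_mod_cast hk
  have hk0 : (0 : ℝ) ≤ k := Nat.cast_nonneg k
  refine ⟨{((k : ℤ), 0), (0, (k : ℤ)), ((k : ℤ) + 1, 0), (0, (k : ℤ) + 1)}, ?_⟩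
  set V := latticePoint '' (({((k : ℤ), 0), (0, (k : ℤ)), ((k : ℤ) + 1, 0), (0, (k : ℤ) + 1)} :
    Finset (ℤ × ℤ)) : Set (ℤ × ℤ)) with hV
  have hV' : V = {((k : ℝ), 0), (0, (k : ℝ)), ((k : ℝ) + 1, 0), (0, (k : ℝ) + 1)} := by
    rw [hV]
    simp [Set.image_insert_eq, latticePoint]
  apply Set.Subset.antisymm
  · rintro ⟨x, y⟩ ⟨hp, hs1, hs2⟩
    obtain ⟨hx, hy⟩ := h.nonneg _ hp
    have hs2 := hs2 hk
    simp only at hx hy hs1 hs2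
    have hc := convex_convexHull ℝ V
    have hsub := subset_convexHull ℝ V
    have e1 : ((x + y, 0) : Plane) ∈ convexHull ℝ V := by
      have := hc (hsub (show ((k : ℝ), (0 : ℝ)) ∈ V by rw [hV']; simp))
        (hsub (show ((k : ℝ) + 1, (0 : ℝ)) ∈ V by rw [hV']; simp))
        (show 0 ≤ (k : ℝ) + 1 - (x + y) by linarith) (show 0 ≤ (x + y) - k by linarith) (by ring)
      convert this using 1
      ext <;> simp; ring
    have e2 : ((0, x + y) : Plane) ∈ convexHull ℝ V := by
      have := hc (hsub (show ((0 : ℝ), (k : ℝ)) ∈ V by rw [hV']; simp))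
        (hsub (show ((0 : ℝ), (k : ℝ) + 1) ∈ V by rw [hV']; simp))
        (show 0 ≤ (k : ℝ) + 1 - (x + y) by linarith) (show 0 ≤ (x + y) - k by linarith) (by ring)
      convert this using 1
      ext <;> simp; ring
    rcases eq_or_lt_of_le (add_nonneg hx hy) with h0 | h0
    · have hx0 : x = 0 := by linarith
      have hy0 : y = 0 := by linarith
      subst hx0 hy0
      simpa using e1
    · have := hc e1 e2 (div_nonneg hx h0.le) (div_nonneg hy h0.le) (by field_simp)
      convert this using 1
      ext <;> simp <;> field_simp
  · refine convexHull_min ?_ (h.convex_strip k)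
    rw [hV']
    rintro p hp
    simp only [Set.mem_insert_iff, Set.mem_singleton_iff] at hp
    rcases hp with rfl | rfl | rfl | rfl <;>
    · refine ⟨h.triangle _ ?_ ?_ ?_, ?_, fun _ => ?_⟩ <;> simp only <;> linarith

theorem interior_strip_nonempty {k : ℕ} (hk : k ≤ N) : (interior (strip S N k)).Nonempty := by
  rcases eq_or_lt_of_le hk with rfl | hk
  · obtain ⟨q, hq, hqk⟩ := h.exists_interior
    rw [strip_last]
    refine ⟨q, mem_interior.2 ⟨interior S ∩ {p | (k : ℝ) < p.1 + p.2}, ?_, ?_, hq, hqk⟩⟩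
    · rintro p ⟨hp, hpk⟩
      exact ⟨interior_subset hp, le_of_lt hpk⟩
    · exact isOpen_interior.inter (isOpen_lt continuous_const (by fun_prop))
  · have hkN : (k : ℝ) + 1 ≤ N := by exact_mod_cast hk
    have hk0 : (0 : ℝ) ≤ k := Nat.cast_nonneg k
    refine ⟨(((k : ℝ) + 1 / 2) / 2, ((k : ℝ) + 1 / 2) / 2), mem_interior.2
      ⟨({p | 0 < p.1} ∩ {p | 0 < p.2}) ∩ ({p | (k : ℝ) < p.1 + p.2} ∩ {p | p.1 + p.2 < k + 1}),
        ?_, ?_, ?_⟩⟩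
    · rintro p ⟨⟨h1, h2⟩, h3, h4⟩
      have h1 : 0 < p.1 := h1
      have h2 : 0 < p.2 := h2
      have h3 : (k : ℝ) < p.1 + p.2 := h3
      have h4 : p.1 + p.2 < k + 1 := h4
      exact ⟨h.triangle p h1.le h2.le (by linarith), h3.le, fun _ => h4.le⟩
    · exact ((isOpen_lt continuous_const (by fun_prop)).inter
        (isOpen_lt continuous_const (by fun_prop))).inter
        ((isOpen_lt continuous_const (by fun_prop)).inter (isOpen_lt (by fun_prop) continuous_const))
    · refine ⟨⟨?_, ?_⟩, ?_, ?_⟩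
      · change (0 : ℝ) < ((k : ℝ) + 1 / 2) / 2; linarith
      · change (0 : ℝ) < ((k : ℝ) + 1 / 2) / 2; linarith
      · change (k : ℝ) < ((k : ℝ) + 1 / 2) / 2 + ((k : ℝ) + 1 / 2) / 2; linarith
      · change ((k : ℝ) + 1 / 2) / 2 + ((k : ℝ) + 1 / 2) / 2 < (k : ℝ) + 1; linarith

theorem iUnion_strip : ⋃ i : Fin (N + 1), strip S N i = S := by
  apply Set.Subset.antisymm
  · exact Set.iUnion_subset fun i p hp => hp.1
  · intro p hp
    obtain ⟨hx, hy⟩ := h.nonneg p hp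
    have hs := add_nonneg hx hy
    -- The integer part of x + y, capped at `N` because the last strip is unbounded above.
    refine Set.mem_iUnion.2 ⟨⟨min N ⌊p.1 + p.2⌋₊, by omega⟩, hp, ?_, fun hlt => ?_⟩
    · have h1 : ((min N ⌊p.1 + p.2⌋₊ : ℕ) : ℝ) ≤ (⌊p.1 + p.2⌋₊ : ℝ) := by
        exact_mod_cast min_le_right _ _
      exact h1.trans (Nat.floor_le hs)
    · simp only at hlt ⊢
      rw [min_eq_right (by omega)]
      exact (Nat.lt_floor_add_one _).le

theorem convexOn_stripValue : ConvexOn ℝ S (stripValue N) := by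
  refine ⟨h.convex, fun p _ q _ a b ha hb hab => ?_⟩
  simp only [stripValue, smul_eq_mul]
  rw [Finset.mul_sum, Finset.mul_sum, ← Finset.sum_add_distrib]
  refine Finset.sum_le_sum fun j _ => ?_
  simp only [Prod.fst_add, Prod.snd_add, Prod.smul_fst, Prod.smul_snd, smul_eq_mul]
  have e1 := mul_le_mul_of_nonneg_left (le_max_right 0 (p.1 + p.2 - ((j : ℝ) + 1))) ha
  have e2 := mul_le_mul_of_nonneg_left (le_max_right 0 (q.1 + q.2 - ((j : ℝ) + 1))) hb
  have e3 := mul_nonneg ha (le_max_left 0 (p.1 + p.2 - ((j : ℝ) + 1)))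
  have e4 := mul_nonneg hb (le_max_left 0 (q.1 + q.2 - ((j : ℝ) + 1)))
  have e5 : (a + b) * ((j : ℝ) + 1) = j + 1 := by rw [hab, one_mul]
  refine max_le (by linarith) (by linarith)

theorem corner_mem_strip {k : ℕ} (hk : k ≤ N) : (((k : ℝ), 0) : Plane) ∈ strip S N k := by
  have hkN : (k : ℝ) ≤ N := by exact_mod_cast hk
  refine ⟨h.triangle _ (Nat.cast_nonneg k) le_rfl (by simpa using hkN), by simp, fun _ => by simp⟩

theorem injective_strip : Function.Injective fun i : Fin (N + 1) => strip S N i := by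
  have key : ∀ i j : Fin (N + 1), i < j → strip S N i ≠ strip S N j := by
    intro i j hij heq
    have h1 := h.corner_mem_strip (Nat.lt_succ_iff.1 i.2)
    rw [heq] at h1
    have h2 := h1.2.1
    simp only [add_zero] at h2
    have h3 : (j : ℕ) ≤ i := by exact_mod_cast h2
    exact absurd h3 (not_le.2 hij)
  intro i j hij
  rcases lt_trichotomy i j with h1 | h1 | h1
  · exact absurd hij (key i j h1)
  · exact h1
  · exact absurd hij.symm (key j i h1)

theorem isLinearityDomain_strip {k : ℕ} (hk : k ≤ N) :
    IsLinearityDomain S (stripValue N) (strip S N k) :=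
  ⟨fun _ hp => hp.1, (h.isLatticePolygon_strip hk).isClosed, h.convex_strip k,
    k, k, -(k * (k + 1) / 2 : ℝ), fun _ hp => (h.mem_strip_iff hk hp.1).1 hp⟩

/-- With `k` the largest index for which x + y ≥ k on the whole of `T`, a point beyond level `k + 1`
would give a segment in `T` across that level, where the summand `j = k` bends strictly. -/
theorem exists_strip_of_isLinearityDomain {T : Set Plane}
    (hT : IsLinearityDomain S (stripValue N) T) : ∃ k ≤ N, T ⊆ strip S N k := by
  classical
  obtain ⟨hTS, -, hconv, α, β, γ, hv⟩ := hT
  set P : ℕ → Prop := fun k => ∀ p ∈ T, (k : ℝ) ≤ p.1 + p.2 with hP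
  have hP0 : P 0 := fun p hp => by
    have := h.nonneg p (hTS hp)
    push_cast
    linarith
  refine ⟨Nat.findGreatest P N, Nat.findGreatest_le N, fun q hq =>
    ⟨hTS hq, Nat.findGreatest_spec (P := P) (Nat.zero_le N) hP0 q hq, fun hlt => ?_⟩⟩
  set k := Nat.findGreatest P N with hk
  by_contra hqk
  rw [not_le] at hqk
  have hnot : ¬ P (k + 1) := Nat.findGreatest_is_greatest (Nat.lt_succ_self k) hlt
  simp only [hP] at hnot
  push Not at hnot
  obtain ⟨p, hp, hpk⟩ := hnot
  push_cast at hpk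
  have hpq : 0 < (q.1 + q.2) - (p.1 + p.2) := by linarith
  -- The weight for which (1 - b) p + b q lies on the line x + y = k + 1.
  set b := ((k : ℝ) + 1 - (p.1 + p.2)) / ((q.1 + q.2) - (p.1 + p.2)) with hb
  have hb0 : 0 < b := div_pos (by linarith) hpq
  have hb1 : b < 1 := by rw [hb, div_lt_one hpq]; linarith
  have hbs : b * ((q.1 + q.2) - (p.1 + p.2)) = (k : ℝ) + 1 - (p.1 + p.2) := by
    rw [hb]; field_simp
  have hz := hconv hp hq (show 0 ≤ 1 - b by linarith) hb0.le (by ring)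
  have e1 := hv _ hz
  have e2 := hv p hp
  have e3 := hv q hq
  have hlt' : stripValue N ((1 - b) • p + b • q) < (1 - b) * stripValue N p + b * stripValue N q := by
    simp only [stripValue]
    rw [Finset.mul_sum, Finset.mul_sum, ← Finset.sum_add_distrib]
    refine Finset.sum_lt_sum (fun j _ => ?_) ⟨k, Finset.mem_range.2 hlt, ?_⟩
    · simp only [Prod.fst_add, Prod.snd_add, Prod.smul_fst, Prod.smul_snd, smul_eq_mul]
      have f1 := mul_le_mul_of_nonneg_left (le_max_right 0 (p.1 + p.2 - ((j : ℝ) + 1)))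
        (show 0 ≤ 1 - b by linarith)
      have f2 := mul_le_mul_of_nonneg_left (le_max_right 0 (q.1 + q.2 - ((j : ℝ) + 1))) hb0.le
      have f3 := mul_nonneg (show 0 ≤ 1 - b by linarith)
        (le_max_left 0 (p.1 + p.2 - ((j : ℝ) + 1)))
      have f4 := mul_nonneg hb0.le (le_max_left 0 (q.1 + q.2 - ((j : ℝ) + 1)))
      refine max_le (by linarith) (by linarith)
    · simp only [Prod.fst_add, Prod.snd_add, Prod.smul_fst, Prod.smul_snd, smul_eq_mul]
      rw [max_eq_left (by linarith)]
      have f3 := mul_nonneg (show 0 ≤ 1 - b by linarith)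
        (le_max_left 0 (p.1 + p.2 - ((k : ℝ) + 1)))
      have f5 : 0 < max 0 (q.1 + q.2 - ((k : ℝ) + 1)) := lt_max_of_lt_right (by linarith)
      have f4 := mul_pos hb0 f5
      linarith
  rw [e1, e2, e3] at hlt'
  simp only [Prod.fst_add, Prod.snd_add, Prod.smul_fst, Prod.smul_snd, smul_eq_mul] at hlt'
  linarith

theorem maximal_strip_iff (T : Set Plane) :
    (∃ i : Fin (N + 1), strip S N i = T) ↔ Maximal (IsLinearityDomain S (stripValue N)) T := by
  constructor
  · rintro ⟨i, rfl⟩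
    have hi := Nat.lt_succ_iff.1 i.2
    refine ⟨h.isLinearityDomain_strip hi, ?_⟩
    rintro T ⟨hTS, -, -, α, β, γ, hv⟩ hsub p hp
    have hsub : strip S N i ⊆ T := hsub
    -- The affine function on `T` agrees with that of the strip on a set with interior points, so
    -- they coincide, and `T` lies in the set where `stripValue` equals it, which is the strip.
    have h0 := affine_eq_zero (h.interior_strip_nonempty hi)
      (α := α - i) (β := β - i) (γ := γ + (i * (i + 1) / 2 : ℝ)) fun q hq => by
        have h1 := hv q (hsub hq)
        have h2 := (h.mem_strip_iff hi hq.1).1 hq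
        linarith
    rw [h.mem_strip_iff hi (hTS hp), hv p hp]
    obtain ⟨h1, h2, h3⟩ := h0
    rw [sub_eq_zero.1 h1, sub_eq_zero.1 h2, eq_neg_of_add_eq_zero_left h3]
  · intro hT
    obtain ⟨k, hk, hsub⟩ := h.exists_strip_of_isLinearityDomain hT.prop
    exact ⟨⟨k, Nat.lt_succ_of_le hk⟩,
      Set.Subset.antisymm (hT.2 (h.isLinearityDomain_strip hk) hsub) hsub⟩

/-- The subdivision of `S` into strips. -/
noncomputable def subdivision : RegularSubdivision S where
  r := N + 1
  cell i := strip S N i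
  v := stripValue N
  isLatticePolygon i := h.isLatticePolygon_strip (Nat.lt_succ_iff.1 i.2)
  interior_nonempty i := h.interior_strip_nonempty (Nat.lt_succ_iff.1 i.2)
  cover := h.iUnion_strip
  convexOn := h.convexOn_stripValue
  injective := h.injective_strip
  maximal_iff := h.maximal_strip_iff

/-! ### Integrality, normals and dual graph of the strips -/

theorem isIntegral : h.subdivision.IsIntegral := by
  intro z _
  refine ⟨∑ j ∈ Finset.range N, max 0 (z.1 + z.2 - (j + 1)), ?_⟩
  change stripValue N (latticePoint z) = _
  simp only [stripValue, latticePoint]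
  push_cast
  rfl

theorem isNormal (i : Fin (N + 1)) :
    h.subdivision.IsNormal i (-((i : ℕ) : ℤ), -((i : ℕ) : ℤ)) := by
  refine ⟨-((i : ℕ) * ((i : ℕ) + 1) / 2 : ℝ), fun p hp => ?_⟩
  have hp : p ∈ strip S N i := hp
  have := (h.mem_strip_iff (Nat.lt_succ_iff.1 i.2) hp.1).1 hp
  change _ + stripValue N p = _
  rw [this]
  push_cast
  ring

/-- The common lattice points are (t, i + 1 - t) for t = 0, …, i + 1, which are i + 2 in number. -/
theorem intersectionLength_succ (i j : Fin (N + 1)) (hij : (j : ℕ) = i + 1) :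
    h.subdivision.intersectionLength i j = i + 1 := by
  have hj := Nat.lt_succ_iff.1 j.2
  have hjN : ((i : ℕ) : ℝ) + 1 ≤ N := by rw [hij] at hj; exact_mod_cast hj
  have hset : h.subdivision.cell i ∩ h.subdivision.cell j ∩ latticePoints =
      (fun t : ℕ => latticePoint ((t : ℤ), (i : ℕ) + 1 - (t : ℤ))) ''
        ((Finset.range (i + 2) : Finset ℕ) : Set ℕ) := by
    change strip S N i ∩ strip S N j ∩ latticePoints = _
    ext p
    constructor
    · rintro ⟨⟨⟨hp, h1, h2⟩, -, h4, h5⟩, z, rfl⟩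
      have h2 := h2 (by omega)
      obtain ⟨hx, hy⟩ := h.nonneg _ hp
      rw [hij] at h4
      simp only [latticePoint] at hx hy h2 h4
      have hx : 0 ≤ z.1 := by exact_mod_cast hx
      have hy : 0 ≤ z.2 := by exact_mod_cast hy
      have h2 : z.1 + z.2 ≤ (i : ℕ) + 1 := by exact_mod_cast h2
      have h4 : ((i : ℕ) : ℤ) + 1 ≤ z.1 + z.2 := by exact_mod_cast h4
      refine ⟨z.1.toNat, ?_, ?_⟩
      · simp only [Finset.coe_range, Set.mem_Iio]
        omega
      · simp only
        congr 1
        ext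
        · simp only; omega
        · simp only; omega
    · rintro ⟨t, ht, rfl⟩
      simp only [Finset.coe_range, Set.mem_Iio] at ht
      have ht' : (t : ℝ) ≤ (i : ℕ) + 1 := by exact_mod_cast (by omega : t ≤ (i : ℕ) + 1)
      have hsum : (latticePoint ((t : ℤ), (i : ℕ) + 1 - (t : ℤ))).1 +
          (latticePoint ((t : ℤ), (i : ℕ) + 1 - (t : ℤ))).2 = (i : ℕ) + 1 := by
        simp only [latticePoint]
        push_cast
        ring
      have hS : latticePoint ((t : ℤ), (i : ℕ) + 1 - (t : ℤ)) ∈ S := by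
        refine h.triangle _ ?_ ?_ (by rw [hsum]; exact hjN)
        · simp [latticePoint]
        · simp only [latticePoint]
          push_cast
          linarith
      refine ⟨⟨⟨hS, ?_, fun _ => ?_⟩, hS, ?_, fun _ => ?_⟩, ⟨_, rfl⟩⟩
      · rw [hsum]; linarith
      · rw [hsum]
      · rw [hsum, hij]; push_cast; exact le_rfl
      · rw [hsum, hij]; push_cast; linarith
  change Set.ncard (h.subdivision.cell i ∩ h.subdivision.cell j ∩ latticePoints) - 1 = _
  rw [hset, Set.ncard_image_of_injective,
    Set.ncard_coe_finset, Finset.card_range]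
  · rfl
  · intro s t hst
    have := congrArg Prod.fst hst
    simp only [latticePoint] at this
    exact_mod_cast this

theorem eq_succ_of_intersectionLength_pos (i j : Fin (N + 1)) (hij : i < j)
    (hpos : 0 < h.subdivision.intersectionLength i j) : (j : ℕ) = i + 1 := by
  by_contra hne
  have hij : (i : ℕ) < j := hij
  have hj := Nat.lt_succ_iff.1 j.2
  have hset : h.subdivision.cell i ∩ h.subdivision.cell j ∩ latticePoints = ∅ := by
    change strip S N i ∩ strip S N j ∩ latticePoints = _
    refine Set.eq_empty_of_forall_notMem ?_
    rintro p ⟨⟨⟨-, -, h2⟩, -, h4, -⟩, -⟩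
    have h2 := h2 (by omega)
    have : ((i : ℕ) : ℝ) + 2 ≤ (j : ℕ) := by exact_mod_cast (by omega : (i : ℕ) + 2 ≤ j)
    linarith
  change 0 < Set.ncard (h.subdivision.cell i ∩ h.subdivision.cell j ∩ latticePoints) - 1 at hpos
  rw [hset, Set.ncard_empty] at hpos
  exact absurd hpos (lt_irrefl 0)

theorem intersectionLength_comm (i j : Fin (N + 1)) :
    h.subdivision.intersectionLength i j = h.subdivision.intersectionLength j i := by
  change Set.ncard (h.subdivision.cell i ∩ h.subdivision.cell j ∩ latticePoints) - 1 =
    Set.ncard (h.subdivision.cell j ∩ h.subdivision.cell i ∩ latticePoints) - 1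
  rw [Set.inter_comm (h.subdivision.cell i)]

/-- Only consecutive strips meet in lattice points, and their normals differ by 1 in each of the
first two coordinates, which gives a minor ±1. -/
theorem minorsGcd_eq_one (i j : Fin (N + 1)) (hij : i ≠ j)
    (hpos : 0 < h.subdivision.intersectionLength i j) :
    minorsGcd (-((i : ℕ) : ℤ), -((i : ℕ) : ℤ)) (-((j : ℕ) : ℤ), -((j : ℕ) : ℤ)) = 1 := by
  have key : (j : ℕ) = i + 1 ∨ (i : ℕ) = j + 1 := by
    rcases lt_or_gt_of_ne hij with h1 | h1
    · exact Or.inl (h.eq_succ_of_intersectionLength_pos i j h1 hpos)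
    · rw [h.intersectionLength_comm] at hpos
      exact Or.inr (h.eq_succ_of_intersectionLength_pos j i h1 hpos)
  unfold minorsGcd
  simp only
  have : (-((i : ℕ) : ℤ) - -((j : ℕ) : ℤ)).natAbs = 1 := by omega
  rw [this, Nat.gcd_one_left, Nat.gcd_one_right]

/-- Arbitrary edge lengths are allowed, so that this covers both the graph with unit lengths and the
one with lengths given by the gcd's. -/
theorem isGonality_dualGraph (len : Fin (N + 1) → Fin (N + 1) → ℝ)
    (hlen : ∀ i j, i < j → 0 < len i j) :
    (h.subdivision.dualGraph len hlen).IsGonality ((max N 1 : ℕ) : ℤ) := by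
  have hsucc : ∀ e : (h.subdivision.dualGraph len hlen).E,
      ((e.1.1.2 : Fin (N + 1)) : ℕ) = (e.1.1.1 : Fin (N + 1)) + 1 := fun e =>
    h.eq_succ_of_intersectionLength_pos _ _ e.1.2 (lt_of_le_of_lt (Nat.zero_le _) e.2.2)
  refine MetricGraph.isGonality_of_path (Equiv.refl (Fin (N + 1))) hsucc ?_ ?_
  · intro k hk
    obtain ⟨i, hi⟩ : ∃ i : Fin (N + 1), (i : ℕ) = k := ⟨⟨k, by omega⟩, rfl⟩
    obtain ⟨j, hj⟩ : ∃ j : Fin (N + 1), (j : ℕ) = k + 1 := ⟨⟨k + 1, by omega⟩, rfl⟩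
    have hlt : i < j := Fin.lt_def.2 (by omega)
    have hc : (Finset.univ : Finset (Fin (h.subdivision.intersectionLength i j))).card = k + 1 := by
      rw [Finset.card_univ, Fintype.card_fin, h.intersectionLength_succ i j (by omega), hi]
    rw [← hc]
    refine Finset.card_le_card_of_injOn (fun t => ⟨⟨(i, j), hlt⟩, t⟩) (fun t _ => ?_) ?_
    · exact Finset.mem_coe.2 (Finset.mem_filter.2 ⟨Finset.mem_univ _, hi⟩)
    · intro t _ t' _ htt
      exact eq_of_heq (Sigma.mk.inj htt).2
  · intro e e' he he'
    have h1 := hsucc e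
    have h2 := hsucc e'
    obtain ⟨⟨⟨i, j⟩, hij⟩, t⟩ := e
    obtain ⟨⟨⟨i', j'⟩, hij'⟩, t'⟩ := e'
    have hi : (i : ℕ) = 0 := he
    have hi' : (i' : ℕ) = 0 := he'
    simp only at h1 h2
    obtain rfl : i = i' := Fin.ext (hi.trans hi'.symm)
    obtain rfl : j = j' := Fin.ext (h1.trans h2.symm)
    have hL := h.intersectionLength_succ i j h1
    rw [hi] at hL
    have ht : t = t' := Fin.ext (by have h3 := t.2; have h4 := t'.2; simp only [hL] at h3 h4; omega)
    rw [ht]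

end ExtendsTriangle

/-! ### The doubled triangle -/

/-- The vertices of `twoUpsilon`. -/
def twoUpsilonVertex : Fin 3 → ℤ × ℤ := ![(-2, -2), (2, 0), (0, 2)]

theorem latticePoint_twoUpsilonVertex_mem (i : Fin 3) :
    latticePoint (twoUpsilonVertex i) ∈ twoUpsilon := by
  have hsub := subset_convexHull ℝ
    ({((-1 : ℝ), (-1 : ℝ)), ((1 : ℝ), (0 : ℝ)), ((0 : ℝ), (1 : ℝ))} : Set Plane)
  fin_cases i
  · refine ⟨((-1 : ℝ), (-1 : ℝ)), hsub (by simp), ?_⟩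
    simp [latticePoint, twoUpsilonVertex]
  · refine ⟨((1 : ℝ), (0 : ℝ)), hsub (by simp), ?_⟩
    simp [latticePoint, twoUpsilonVertex]
  · refine ⟨((0 : ℝ), (1 : ℝ)), hsub (by simp), ?_⟩
    simp [latticePoint, twoUpsilonVertex]

theorem exists_weights_of_mem_twoUpsilon {p : Plane} (hp : p ∈ twoUpsilon) :
    ∃ l : Fin 3 → ℝ, (∀ i, 0 ≤ l i) ∧ ∑ i, l i = 1 ∧
      p.1 = ∑ i, l i * ((twoUpsilonVertex i).1 : ℝ) ∧
      p.2 = ∑ i, l i * ((twoUpsilonVertex i).2 : ℝ) := by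
  obtain ⟨q, hq, rfl⟩ := hp
  rw [upsilon, convexHull_insert (by simp), convexHull_pair] at hq
  obtain ⟨x, hx, r, ⟨s, t, hs, ht, hst, rfl⟩, ⟨u, v, hu, hv, huv, rfl⟩⟩ := mem_convexJoin.1 hq
  rw [Set.mem_singleton_iff] at hx
  subst hx
  refine ⟨![u, v * s, v * t], ?_, ?_, ?_, ?_⟩
  · intro i
    fin_cases i
    · exact hu
    · exact mul_nonneg hv hs
    · exact mul_nonneg hv ht
  · rw [Fin.sum_univ_three]
    simp only [Matrix.cons_val_zero, Matrix.cons_val_one, Matrix.cons_val]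
    linear_combination huv + v * hst
  · rw [Fin.sum_univ_three]
    simp [twoUpsilonVertex]
    ring
  · rw [Fin.sum_univ_three]
    simp [twoUpsilonVertex]
    ring

/-- A convex set in the positive quadrant with a corner at the origin is not equivalent to
`twoUpsilon`, as the corners of the latter have index three. -/
theorem not_latticeEquiv_twoUpsilon {S : Set Plane} (hS : ∀ p ∈ S, 0 ≤ p.1 ∧ 0 ≤ p.2)
    {a b : ℝ} (ha : 0 < a) (hb : 0 < b) (h0 : ((0, 0) : Plane) ∈ S) (h1 : ((0, a) : Plane) ∈ S)
    (h2 : ((b, 0) : Plane) ∈ S) : ¬ LatticeEquiv S twoUpsilon := by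
  rintro ⟨A, c, hA⟩
  set α := A.val 0 0 with hα
  set β := A.val 0 1 with hβ
  set γ := A.val 1 0 with hγ
  set δ := A.val 1 1 with hδ
  have hdet : (α * δ - β * γ) * (α * δ - β * γ) = 1 := by
    have h3 : IsUnit (A.val.det) := (Matrix.isUnit_iff_isUnit_det _).1 A.isUnit
    rw [Matrix.det_fin_two] at h3
    exact Int.isUnit_mul_self h3
  set d := α * δ - β * γ with hd
  have hdR : ((α : ℝ) * δ - β * γ) * (α * δ - β * γ) = 1 := by
    rw [hd] at hdet
    exact_mod_cast hdet
  -- The inverse matrix is the determinant, which is ±1, times the adjugate; so the vertices of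
  -- `twoUpsilon` come from lattice points of `S`.
  have hvert : ∀ i, ∃ P : ℤ × ℤ, latticePoint P ∈ S ∧
      α * P.1 + β * P.2 + c.1 = (twoUpsilonVertex i).1 ∧
      γ * P.1 + δ * P.2 + c.2 = (twoUpsilonVertex i).2 := by
    intro i
    have h3 := latticePoint_twoUpsilonVertex_mem i
    rw [← hA] at h3
    obtain ⟨p, hp, hpi⟩ := h3
    have e1 : (α : ℝ) * p.1 + β * p.2 + c.1 = (twoUpsilonVertex i).1 := congrArg Prod.fst hpi
    have e2 : (γ : ℝ) * p.1 + δ * p.2 + c.2 = (twoUpsilonVertex i).2 := congrArg Prod.snd hpi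
    set Q := twoUpsilonVertex i
    have hp' : latticePoint (d * (δ * (Q.1 - c.1) - β * (Q.2 - c.2)),
        d * (α * (Q.2 - c.2) - γ * (Q.1 - c.1))) = p := by
      rw [hd]
      ext
      · simp only [latticePoint]
        push_cast
        rw [← e1, ← e2]
        linear_combination p.1 * hdR
      · simp only [latticePoint]
        push_cast
        rw [← e1, ← e2]
        linear_combination p.2 * hdR
    refine ⟨_, hp' ▸ hp, ?_, ?_⟩
    · simp only
      rw [hd] at hdet ⊢
      linear_combination (Q.1 - c.1) * hdet
    · simp only
      rw [hd] at hdet ⊢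
      linear_combination (Q.2 - c.2) * hdet
  choose P hPS hP1 hP2 using hvert
  have hPnn : ∀ i, (0 : ℝ) ≤ (P i).1 ∧ (0 : ℝ) ≤ (P i).2 := fun i => hS _ (hPS i)
  have hweights : ∀ p ∈ S, ∃ l : Fin 3 → ℝ, (∀ i, 0 ≤ l i) ∧ ∑ i, l i = 1 ∧
      p.1 = ∑ i, l i * ((P i).1 : ℝ) ∧ p.2 = ∑ i, l i * ((P i).2 : ℝ) := by
    intro p hp
    obtain ⟨l, hl, hsum, e1, e2⟩ := exists_weights_of_mem_twoUpsilon (hA ▸ mem_image_of_mem _ hp)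
    refine ⟨l, hl, hsum, ?_⟩
    have e1 : (α : ℝ) * p.1 + β * p.2 + c.1 = ∑ i, l i * ((twoUpsilonVertex i).1 : ℝ) := e1
    have e2 : (γ : ℝ) * p.1 + δ * p.2 + c.2 = ∑ i, l i * ((twoUpsilonVertex i).2 : ℝ) := e2
    simp only [← hP1, ← hP2] at e1 e2
    push_cast at e1 e2
    rw [Fin.sum_univ_three] at e1 e2 hsum ⊢
    rw [Fin.sum_univ_three]
    set X := l 0 * ((P 0).1 : ℝ) + l 1 * ((P 1).1 : ℝ) + l 2 * ((P 2).1 : ℝ) with hX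
    set Y := l 0 * ((P 0).2 : ℝ) + l 1 * ((P 1).2 : ℝ) + l 2 * ((P 2).2 : ℝ) with hY
    have f1 : (α : ℝ) * (p.1 - X) + β * (p.2 - Y) = 0 := by
      rw [hX, hY]; linear_combination e1 + c.1 * hsum
    have f2 : (γ : ℝ) * (p.1 - X) + δ * (p.2 - Y) = 0 := by
      rw [hX, hY]; linear_combination e2 + c.2 * hsum
    constructor
    · linear_combination ((α : ℝ) * δ - β * γ) * (δ * f1 - β * f2) - (p.1 - X) * hdR
    · linear_combination ((α : ℝ) * δ - β * γ) * (α * f2 - γ * f1) - (p.2 - Y) * hdR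
  have hzero : ∀ {l : Fin 3 → ℝ} {z : Fin 3 → ℝ}, (∀ i, 0 ≤ l i) → (∀ i, 0 ≤ z i) →
      0 = ∑ i, l i * z i → ∀ i, l i * z i = 0 := by
    intro l z hl hz hsum i
    exact (Finset.sum_eq_zero_iff_of_nonneg fun i _ => mul_nonneg (hl i) (hz i)).1 hsum.symm i
      (Finset.mem_univ i)
  -- Since all `P i` lie in the quadrant, a combination equal to the origin gives positive weight
  -- only to the origin itself. Likewise, points on an axis use only points on that axis. Hence the
  -- `P i` are the origin and one further point on each axis.
  obtain ⟨i, hi1, hi2⟩ : ∃ i, (P i).1 = 0 ∧ (P i).2 = 0 := by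
    obtain ⟨l, hl, hsum, e1, e2⟩ := hweights _ h0
    obtain ⟨i, -, hi⟩ := Finset.exists_ne_zero_of_sum_ne_zero (hsum.trans_ne one_ne_zero)
    have f1 := (mul_eq_zero.1 (hzero hl (fun i => (hPnn i).1) e1 i)).resolve_left hi
    have f2 := (mul_eq_zero.1 (hzero hl (fun i => (hPnn i).2) e2 i)).resolve_left hi
    exact ⟨i, by exact_mod_cast f1, by exact_mod_cast f2⟩
  obtain ⟨j, hj1, hj2⟩ : ∃ j, (P j).1 = 0 ∧ (P j).2 ≠ 0 := by
    obtain ⟨l, hl, hsum, e1, e2⟩ := hweights _ h1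
    obtain ⟨j, -, hj⟩ := Finset.exists_ne_zero_of_sum_ne_zero (e2.symm.trans_ne ha.ne')
    have hj' := mul_ne_zero_iff.1 hj
    have f1 := (mul_eq_zero.1 (hzero hl (fun i => (hPnn i).1) e1 j)).resolve_left hj'.1
    exact ⟨j, by exact_mod_cast f1, by exact_mod_cast hj'.2⟩
  obtain ⟨k, hk1, hk2⟩ : ∃ k, (P k).1 ≠ 0 ∧ (P k).2 = 0 := by
    obtain ⟨l, hl, hsum, e1, e2⟩ := hweights _ h2
    obtain ⟨j, -, hj⟩ := Finset.exists_ne_zero_of_sum_ne_zero (e1.symm.trans_ne hb.ne')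
    have hj' := mul_ne_zero_iff.1 hj
    have f1 := (mul_eq_zero.1 (hzero hl (fun i => (hPnn i).2) e2 j)).resolve_left hj'.1
    exact ⟨j, by exact_mod_cast hj'.2, by exact_mod_cast f1⟩
  have hij : i ≠ j := by rintro rfl; exact hj2 hi2
  have hik : i ≠ k := by rintro rfl; exact hk1 hi1
  have hjk : j ≠ k := by rintro rfl; exact hj2 hk2
  -- Every edge vector of `twoUpsilon` has a coordinate ±2.
  have hprim : ∀ i j : Fin 3, i ≠ j → ∀ w : ℤ,
      w ∣ (twoUpsilonVertex j).1 - (twoUpsilonVertex i).1 →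
        w ∣ (twoUpsilonVertex j).2 - (twoUpsilonVertex i).2 → w ∣ 2 := by
    intro i j hij w h3 h4
    have h5 : (twoUpsilonVertex j).1 - (twoUpsilonVertex i).1 = 2 ∨
        (twoUpsilonVertex j).1 - (twoUpsilonVertex i).1 = -2 ∨
        (twoUpsilonVertex j).2 - (twoUpsilonVertex i).2 = 2 ∨
        (twoUpsilonVertex j).2 - (twoUpsilonVertex i).2 = -2 := by
      clear h3 h4
      revert i j
      unfold twoUpsilonVertex
      decide
    rcases h5 with h5 | h5 | h5 | h5
    · rwa [h5] at h3
    · rw [h5] at h3; exact (dvd_neg.1 h3)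
    · rwa [h5] at h4
    · rw [h5] at h4; exact (dvd_neg.1 h4)
  have e1 : (twoUpsilonVertex j).1 - (twoUpsilonVertex i).1 = (P j).2 * β := by
    rw [← hP1, ← hP1, hi1, hi2, hj1]; ring
  have e2 : (twoUpsilonVertex j).2 - (twoUpsilonVertex i).2 = (P j).2 * δ := by
    rw [← hP2, ← hP2, hi1, hi2, hj1]; ring
  have e3 : (twoUpsilonVertex k).1 - (twoUpsilonVertex i).1 = (P k).1 * α := by
    rw [← hP1, ← hP1, hi1, hi2, hk2]; ring
  have e4 : (twoUpsilonVertex k).2 - (twoUpsilonVertex i).2 = (P k).1 * γ := by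
    rw [← hP2, ← hP2, hi1, hi2, hk2]; ring
  have hw := hprim i j hij (P j).2 ⟨β, e1⟩ ⟨δ, e2⟩
  have hu := hprim i k hik (P k).1 ⟨α, e3⟩ ⟨γ, e4⟩
  have hcross : ((twoUpsilonVertex k).1 - (twoUpsilonVertex i).1) *
        ((twoUpsilonVertex j).2 - (twoUpsilonVertex i).2) -
      ((twoUpsilonVertex j).1 - (twoUpsilonVertex i).1) *
        ((twoUpsilonVertex k).2 - (twoUpsilonVertex i).2) = 12 ∨
      ((twoUpsilonVertex k).1 - (twoUpsilonVertex i).1) *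
        ((twoUpsilonVertex j).2 - (twoUpsilonVertex i).2) -
      ((twoUpsilonVertex j).1 - (twoUpsilonVertex i).1) *
        ((twoUpsilonVertex k).2 - (twoUpsilonVertex i).2) = -12 := by
    clear hw hu e1 e2 e3 e4 hi1 hi2 hj1 hj2 hk1 hk2
    revert i j k
    unfold twoUpsilonVertex
    decide
  rw [e1, e2, e3, e4] at hcross
  -- The product of the two axis lengths is, up to sign, the determinant 12 of two edge vectors, and
  -- it divides 4.
  have h4 : (P j).2 * (P k).1 ∣ 2 * 2 := mul_dvd_mul hw hu
  have h12 : (12 : ℤ) ∣ (P j).2 * (P k).1 := by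
    rcases hcross with h | h
    · exact ⟨d, by rw [← h]; linear_combination (-(P j).2 * (P k).1) * hdet⟩
    · exact ⟨-d, by
        have : (12 : ℤ) = -(-12) := by norm_num
        rw [this, ← h]; linear_combination (-(P j).2 * (P k).1) * hdet⟩
  have := h12.trans h4
  norm_num at this

/-! ### Lattice width of the interior polygon -/

/-- A linear inequality on a set is strict at interior points. -/
theorem lt_of_mem_interior {T : Set Plane} {α β γ : ℝ} (hT : ∀ p ∈ T, α * p.1 + β * p.2 ≤ γ)
    (hαβ : α ≠ 0 ∨ β ≠ 0) {q : Plane} (hq : q ∈ interior T) : α * q.1 + β * q.2 < γ := by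
  obtain ⟨t, ht, htT⟩ := exists_pos_add_smul_mem hq (α, β)
  have h1 := hT _ htT
  simp only [Prod.fst_add, Prod.snd_add, Prod.smul_fst, Prod.smul_snd, smul_eq_mul] at h1
  have h2 : 0 < α * α + β * β := by
    rcases hαβ with h | h
    · have := mul_self_pos.2 h; nlinarith [mul_self_nonneg β]
    · have := mul_self_pos.2 h; nlinarith [mul_self_nonneg α]
  nlinarith [mul_pos ht h2]

namespace ExtendsTriangle

variable {S : Set Plane} {N : ℕ} (h : ExtendsTriangle S N)
include h

theorem pos_of_mem_interior {q : Plane} (hq : q ∈ interior S) : 0 < q.1 ∧ 0 < q.2 := by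
  have h1 := lt_of_mem_interior (α := -1) (β := 0) (γ := 0)
    (fun p hp => by linarith [(h.nonneg p hp).1]) (by norm_num) hq
  have h2 := lt_of_mem_interior (α := 0) (β := -1) (γ := 0)
    (fun p hp => by linarith [(h.nonneg p hp).2]) (by norm_num) hq
  constructor <;> linarith

/-- The point may lie on x + y = N, so the open triangle does not suffice. The segment from an
interior point `q` of `S` beyond that line is prolonged through `p`; with a small `ε` it stays in
the triangle, so `p` lies strictly between `q` and a point of `S`. -/
theorem mem_interior {p : Plane} (hx : 0 < p.1) (hy : 0 < p.2) (hp : p.1 + p.2 ≤ N) :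
    p ∈ interior S := by
  obtain ⟨q, hq, hqN⟩ := h.exists_interior
  obtain ⟨hq1, hq2⟩ := h.nonneg q (interior_subset hq)
  set m := min p.1 p.2 with hm
  have hm0 : 0 < m := lt_min hx hy
  set ε := m / (q.1 + q.2 + 1) with hε
  have hε0 : 0 < ε := div_pos hm0 (by linarith)
  have hεm : ε * (q.1 + q.2 + 1) = m := by rw [hε]; field_simp
  have e1 : ε * q.1 ≤ p.1 := by nlinarith [min_le_left p.1 p.2]
  have e2 : ε * q.2 ≤ p.2 := by nlinarith [min_le_right p.1 p.2]
  have hp' : p + ε • (p - q) ∈ S := by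
    refine h.triangle _ ?_ ?_ ?_
    all_goals simp only [Prod.fst_add, Prod.snd_add, Prod.smul_fst, Prod.smul_snd, smul_eq_mul,
      Prod.fst_sub, Prod.snd_sub]
    · nlinarith
    · nlinarith
    · nlinarith
  refine h.convex.openSegment_interior_self_subset_interior hq hp'
    ⟨ε / (1 + ε), 1 / (1 + ε), by positivity, by positivity, by field_simp; ring, ?_⟩
  ext
  · simp only [Prod.fst_add, Prod.smul_fst, smul_eq_mul, Prod.fst_sub]
    field_simp; ring
  · simp only [Prod.snd_add, Prod.smul_snd, smul_eq_mul, Prod.snd_sub]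
    field_simp; ring

theorem latticeWidth_interiorPolygon
    (hup : ∀ z : ℤ × ℤ, latticePoint z ∈ interior S → z.2 + 1 ≤ (max N 1 : ℕ)) :
    latticeWidth (interiorPolygon S) + 2 = ((max N 1 : ℕ) : ℤ) := by
  have hlow : ∀ z : ℤ × ℤ, latticePoint z ∈ interior S → 1 ≤ z.1 ∧ 1 ≤ z.2 := by
    intro z hz
    obtain ⟨h1, h2⟩ := h.pos_of_mem_interior hz
    simp only [latticePoint] at h1 h2
    have h1 : 0 < z.1 := by exact_mod_cast h1
    have h2 : 0 < z.2 := by exact_mod_cast h2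
    omega
  -- For `N < 2` there is no interior lattice point, and the convention -1 for the empty polygon
  -- gives -1 + 2 = 1.
  rcases lt_or_ge N 2 with hN | hN
  · have hmax : max N 1 = 1 := by omega
    have hempty : interiorPolygon S = ∅ := by
      rw [interiorPolygon, convexHull_eq_empty, Set.eq_empty_iff_forall_notMem]
      rintro _ ⟨hz, z, rfl⟩
      have h1 := hup z hz
      have h2 := hlow z hz
      rw [hmax] at h1
      push_cast at h1
      omega
    rw [latticeWidth, if_pos hempty, hmax]
    norm_num
  · have hmax : max N 1 = N := by omega
    rw [hmax] at hup ⊢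
    have hN' : (2 : ℝ) ≤ N := by exact_mod_cast hN
    have hmem : ∀ z : ℤ × ℤ, 1 ≤ z.1 → 1 ≤ z.2 → z.1 + z.2 ≤ N →
        latticePoint z ∈ interiorPolygon S := by
      intro z h1 h2 h3
      refine subset_convexHull ℝ _ ⟨h.mem_interior ?_ ?_ ?_, ⟨z, rfl⟩⟩ <;> simp only [latticePoint]
      · exact_mod_cast h1
      · exact_mod_cast h2
      · exact_mod_cast h3
    have hstrip : interiorPolygon S ⊆ {p | 1 ≤ p.2} ∩ {p | p.2 ≤ N - 1} := by
      refine convexHull_min ?_ ?_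
      · rintro _ ⟨hz, z, rfl⟩
        have h1 := (hlow z hz).2
        have h2 := hup z hz
        have h1 : (1 : ℝ) ≤ z.2 := by exact_mod_cast h1
        have h2 : (z.2 : ℝ) + 1 ≤ N := by exact_mod_cast h2
        refine ⟨h1, ?_⟩
        change (z.2 : ℝ) ≤ N - 1
        linarith
      · exact (convex_halfSpace_ge (LinearMap.snd ℝ ℝ ℝ).isLinear 1).inter
          (convex_halfSpace_le (LinearMap.snd ℝ ℝ ℝ).isLinear _)
    have hne : interiorPolygon S ≠ ∅ :=
      Set.Nonempty.ne_empty ⟨_, hmem (1, 1) le_rfl le_rfl (by simp only; omega)⟩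
    rw [latticeWidth, if_neg hne]
    have hsInf : sInf {s : ℕ | ∃ (A : Matrix.GeneralLinearGroup (Fin 2) ℤ) (c : ℤ × ℤ),
        ∀ p ∈ interiorPolygon S, 0 ≤ (zAffine A c p).2 ∧ (zAffine A c p).2 ≤ (s : ℝ)} = N - 2 := by
      have hin : N - 2 ∈ {s : ℕ | ∃ (A : Matrix.GeneralLinearGroup (Fin 2) ℤ) (c : ℤ × ℤ),
          ∀ p ∈ interiorPolygon S, 0 ≤ (zAffine A c p).2 ∧ (zAffine A c p).2 ≤ (s : ℝ)} := by
        refine ⟨1, (0, -1), fun p hp => ?_⟩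
        obtain ⟨h1, h2⟩ := hstrip hp
        have h1 : 1 ≤ p.2 := h1
        have h2 : p.2 ≤ N - 1 := h2
        rw [Nat.cast_sub hN]
        simp only [zAffine, Units.val_one, Matrix.one_apply_eq, Matrix.one_apply_ne one_ne_zero]
        push_cast
        constructor <;> linarith
      refine le_antisymm (Nat.sInf_le hin) (le_csInf ⟨_, hin⟩ ?_)
      rintro s ⟨A, c, hs⟩
      set γ := A.val 1 0 with hγ
      set δ := A.val 1 1 with hδ
      have hrow : γ ≠ 0 ∨ δ ≠ 0 := by
        by_contra! hcon
        have h3 : IsUnit (A.val.det) := (Matrix.isUnit_iff_isUnit_det _).1 A.isUnit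
        rw [Matrix.det_fin_two, ← hγ, ← hδ, hcon.1, hcon.2] at h3
        simp at h3
      have hval : ∀ z : ℤ × ℤ, 1 ≤ z.1 → 1 ≤ z.2 → z.1 + z.2 ≤ N →
          0 ≤ γ * z.1 + δ * z.2 + c.2 ∧ γ * z.1 + δ * z.2 + c.2 ≤ s := by
        intro z h1 h2 h3
        have h4 := hs _ (hmem z h1 h2 h3)
        simp only [zAffine, latticePoint] at h4
        exact_mod_cast h4
      have v1 := hval (1, 1) le_rfl le_rfl (by simp only; omega)
      have v2 := hval ((N : ℤ) - 1, 1) (by simp only; omega) le_rfl (by simp only; omega)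
      have v3 := hval (1, (N : ℤ) - 1) le_rfl (by simp only; omega) (by simp only; omega)
      simp only at v1 v2 v3
      have hN2 : (0 : ℤ) ≤ N - 2 := by omega
      -- Along (1, 1) to (N - 1, 1) the second coordinate of the image changes by γ (N - 2), and
      -- along (1, 1) to (1, N - 1) by δ (N - 2). One of γ, δ is a nonzero integer.
      have goal : (N : ℤ) - 2 ≤ s := by
        rcases hrow with h4 | h4
        · rcases lt_or_gt_of_ne h4 with h5 | h5 <;> nlinarith
        · rcases lt_or_gt_of_ne h4 with h5 | h5 <;> nlinarith
      omega
    rw [hsInf]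
    omega

end ExtendsTriangle

/-! ### The convex hull of the origin and a piecewise linear graph -/

theorem exists_segment_index {x : ℕ → ℤ} (hx0 : x 0 = 0) (n : ℕ) (hn : 0 < n) {t : ℝ}
    (ht0 : 0 ≤ t) (ht : t ≤ x n) : ∃ i < n, (x i : ℝ) ≤ t ∧ t ≤ x (i + 1) := by
  induction n with
  | zero => exact absurd hn (lt_irrefl 0)
  | succ n ih =>
    rcases le_total t (x n) with h | h
    · rcases Nat.eq_zero_or_pos n with rfl | hn
      · exact ⟨0, Nat.one_pos, by rw [hx0]; exact_mod_cast ht0, ht⟩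
      · obtain ⟨i, hi, h1⟩ := ih hn h
        exact ⟨i, by omega, h1⟩
    · exact ⟨n, Nat.lt_succ_self n, h, ht⟩

/-- The hull of the origin and the graph is spanned by the origin and the break points. -/
theorem IsLatticePiecewiseLinear.exists_finset {f : ℝ → ℝ} {b : ℤ} (hb : 0 < b)
    (hpl : IsLatticePiecewiseLinear f b) : ∃ F : Finset (ℤ × ℤ), F.Nonempty ∧
      hullOfGraph f b = convexHull ℝ (insert ((0 : ℝ), (0 : ℝ)) (latticePoint '' F)) ∧
      ∀ z ∈ F, 0 ≤ z.1 ∧ z.1 ≤ b ∧ f z.1 = z.2 := by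
  classical
  obtain ⟨n, x, y, hx0, hxn, hlt, hxy, hlin⟩ := hpl
  have hn : 0 < n := by
    rcases Nat.eq_zero_or_pos n with rfl | h
    · rw [hx0] at hxn; omega
    · exact h
  have hmono : ∀ j ≤ n, ∀ i ≤ j, x i ≤ x j := by
    intro j
    induction j with
    | zero =>
      intro _ i hi
      rw [Nat.le_zero.1 hi]
    | succ j ih =>
      intro hj i hi
      rcases Nat.lt_or_ge j i with h | h
      · rw [show i = j + 1 by omega]
      · exact (ih (by omega) i h).trans (hlt j (by omega)).le
  refine ⟨(Finset.range (n + 1)).image fun i => (x i, y i), ⟨(x 0, y 0), Finset.mem_image.2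
    ⟨0, by simp, rfl⟩⟩, ?_, ?_⟩
  swap
  · intro z hz
    obtain ⟨i, hi, rfl⟩ := Finset.mem_image.1 hz
    have hi : i ≤ n := by
      have := Finset.mem_range.1 hi
      omega
    refine ⟨?_, ?_, hxy i hi⟩
    · have := hmono i hi 0 (Nat.zero_le i)
      rwa [hx0] at this
    · have := hmono n le_rfl i hi
      rwa [hxn] at this
  have hmem : ∀ i ≤ n, latticePoint (x i, y i) ∈
      latticePoint '' (((Finset.range (n + 1)).image fun i => (x i, y i) : Finset (ℤ × ℤ)) :
        Set (ℤ × ℤ)) := by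
    intro i hi
    exact ⟨_, Finset.mem_coe.2 (Finset.mem_image.2 ⟨i, Finset.mem_range.2 (by omega), rfl⟩), rfl⟩
  apply Set.Subset.antisymm
  · refine convexHull_min ?_ (convex_convexHull ℝ _)
    rintro p (rfl | ⟨t, ⟨ht0, htb⟩, rfl⟩)
    · exact subset_convexHull ℝ _ (Set.mem_insert _ _)
    · rw [← hxn] at htb
      obtain ⟨i, hi, h1, h2⟩ := exists_segment_index hx0 n hn ht0 htb
      obtain ⟨m, c, hmc⟩ := hlin i hi
      have hd : (0 : ℝ) < x (i + 1) - x i := by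
        have : (x i : ℝ) < x (i + 1) := by exact_mod_cast hlt i hi
        linarith
      have e1 := hmc (x i) ⟨le_rfl, by linarith⟩
      have e2 := hmc (x (i + 1)) ⟨by linarith, le_rfl⟩
      have e3 := hmc t ⟨h1, h2⟩
      rw [hxy i (by omega)] at e1
      rw [hxy (i + 1) (by omega)] at e2
      have := convex_convexHull ℝ (insert ((0 : ℝ), (0 : ℝ)) (latticePoint ''
        (((Finset.range (n + 1)).image fun i => (x i, y i) : Finset (ℤ × ℤ)) : Set (ℤ × ℤ))))
        (subset_convexHull ℝ _ (Set.mem_insert_of_mem _ (hmem i (by omega))))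
        (subset_convexHull ℝ _ (Set.mem_insert_of_mem _ (hmem (i + 1) (by omega))))
        (show 0 ≤ (x (i + 1) - t) / (x (i + 1) - x i : ℝ) from div_nonneg (by linarith) hd.le)
        (show 0 ≤ (t - x i) / (x (i + 1) - x i : ℝ) from div_nonneg (by linarith) hd.le)
        (by field_simp; ring)
      convert this using 1
      have hd' := hd.ne'
      ext
      · simp only [latticePoint, Prod.fst_add, Prod.smul_fst, smul_eq_mul]
        field_simp; ring
      · simp only [latticePoint, Prod.snd_add, Prod.smul_snd, smul_eq_mul]
        rw [e1, e2, e3]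
        field_simp; ring
  · refine convexHull_mono (Set.insert_subset_insert ?_)
    rintro _ ⟨z, hz, rfl⟩
    obtain ⟨i, hi, rfl⟩ := Finset.mem_image.1 (Finset.mem_coe.1 hz)
    have hi : i ≤ n := by
      have := Finset.mem_range.1 hi
      omega
    refine ⟨x i, ⟨?_, ?_⟩, by simp only [latticePoint]; rw [hxy i hi]⟩
    · have := hmono i hi 0 (Nat.zero_le i)
      rw [hx0] at this
      exact_mod_cast this
    · have := hmono n le_rfl i hi
      rw [hxn] at this
      exact_mod_cast this

theorem mem_of_triangle_corners {S : Set Plane} (hS : Convex ℝ S) (h0 : ((0, 0) : Plane) ∈ S)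
    {a b : ℝ} (hab : a ≤ b) (h1 : ((0, a) : Plane) ∈ S) (h2 : ((b, 0) : Plane) ∈ S)
    {p : Plane} (hx : 0 ≤ p.1) (hy : 0 ≤ p.2) (hp : p.1 + p.2 ≤ a) : p ∈ S := by
  rcases eq_or_lt_of_le (add_nonneg hx hy) with hs | hs
  · have : p = (0, 0) := Prod.ext (by simp only; linarith) (by simp only; linarith)
    rwa [this]
  · set s := p.1 + p.2 with hsdef
    have e1 : ((s, 0) : Plane) ∈ S := by
      have := hS h0 h2 (show 0 ≤ 1 - s / b by
        rw [sub_nonneg, div_le_one (by linarith)]; linarith)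
        (show 0 ≤ s / b from div_nonneg hs.le (by linarith)) (by ring)
      convert this using 1
      have hb : b ≠ 0 := by linarith
      ext <;> simp
      field_simp
    have e2 : ((0, s) : Plane) ∈ S := by
      have := hS h0 h1 (show 0 ≤ 1 - s / a by
        rw [sub_nonneg, div_le_one (by linarith)]; linarith)
        (show 0 ≤ s / a from div_nonneg hs.le (by linarith)) (by ring)
      convert this using 1
      have ha : a ≠ 0 := by linarith
      ext <;> simp
      field_simp
    have := hS e1 e2 (div_nonneg hx hs.le) (div_nonneg hy hs.le)
      (by rw [← add_div, ← hsdef, div_self hs.ne'])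
    convert this using 1
    ext <;> simp <;> field_simp

/-- The part of the hull of the origin and a lattice polygon beyond a line. -/
theorem isLatticePolygon_beyond {F : Finset (ℤ × ℤ)} (hF : F.Nonempty) {N : ℕ}
    (hFN : ∀ z ∈ F, 0 ≤ z.1 ∧ 0 ≤ z.2 ∧ (N : ℤ) ≤ z.1 + z.2) {S : Set Plane}
    (hS : S = convexHull ℝ (insert ((0 : ℝ), (0 : ℝ)) (latticePoint '' F)))
    (h1 : (((N : ℝ), 0) : Plane) ∈ S) (h2 : ((0, (N : ℝ)) : Plane) ∈ S) :
    IsLatticePolygon {p | p ∈ S ∧ (N : ℝ) ≤ p.1 + p.2} := by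
  classical
  have hconv : Convex ℝ S := hS ▸ convex_convexHull ℝ _
  refine ⟨F ∪ {((N : ℤ), 0), (0, (N : ℤ))}, ?_⟩
  set V := latticePoint '' ((F ∪ {((N : ℤ), 0), (0, (N : ℤ))} : Finset (ℤ × ℤ)) :
    Set (ℤ × ℤ)) with hV
  have hsub := subset_convexHull ℝ V
  have hc := convex_convexHull ℝ V
  have m1 : (((N : ℝ), 0) : Plane) ∈ V := ⟨((N : ℤ), 0), by simp, by simp [latticePoint]⟩
  have m2 : ((0, (N : ℝ)) : Plane) ∈ V := ⟨(0, (N : ℤ)), by simp, by simp [latticePoint]⟩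
  apply Set.Subset.antisymm
  · rintro p ⟨hp, hpN⟩
    rw [hS, convexHull_insert (hF.to_set.image _)] at hp
    -- Every point of the hull is θ q with q in the hull of `F`, hence with q on or beyond the line
    -- x + y = N.
    obtain ⟨o, ho, q, hq, u, θ, hu, hθ, huθ, rfl⟩ := mem_convexJoin.1 hp
    rw [Set.mem_singleton_iff] at ho
    subst ho
    have hqV : q ∈ convexHull ℝ V :=
      convexHull_mono (Set.image_mono (by intro x hx; simp [Finset.mem_coe.1 hx])) hq
    have hqpos : q ∈ {p : Plane | 0 ≤ p.1} ∩ ({p : Plane | 0 ≤ p.2} ∩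
        {p : Plane | (N : ℝ) ≤ p.1 + p.2}) := by
      refine convexHull_min ?_ ?_ hq
      · rintro _ ⟨z, hz, rfl⟩
        obtain ⟨g1, g2, g3⟩ := hFN z hz
        refine ⟨?_, ?_, ?_⟩
        · change (0 : ℝ) ≤ z.1; exact_mod_cast g1
        · change (0 : ℝ) ≤ z.2; exact_mod_cast g2
        · change (N : ℝ) ≤ (z.1 : ℝ) + z.2; exact_mod_cast g3
      · exact (convex_halfSpace_ge (LinearMap.fst ℝ ℝ ℝ).isLinear 0).inter
          ((convex_halfSpace_ge (LinearMap.snd ℝ ℝ ℝ).isLinear 0).inter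
            (convex_halfSpace_ge (LinearMap.fst ℝ ℝ ℝ + LinearMap.snd ℝ ℝ ℝ).isLinear _))
    obtain ⟨g1, g2, g3⟩ := hqpos
    have g1 : 0 ≤ q.1 := g1
    have g2 : 0 ≤ q.2 := g2
    have g3 : (N : ℝ) ≤ q.1 + q.2 := g3
    have hθ1 : θ ≤ 1 := by linarith
    simp only [Prod.fst_add, Prod.snd_add, Prod.smul_fst, Prod.smul_snd, smul_eq_mul, mul_zero,
      zero_add] at hpN
    rcases eq_or_lt_of_le g3 with g3 | g3
    · rcases Nat.eq_zero_or_pos N with hN | hN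
      · subst hN
        push_cast at g3
        have hq0 : q = (0, 0) := Prod.ext (by simp only; linarith) (by simp only; linarith)
        rw [hq0]
        convert hsub m1 using 1
        ext <;> simp
      · have hN : (0 : ℝ) < N := by exact_mod_cast hN
        have hθ' : θ = 1 := le_antisymm hθ1 (by nlinarith)
        have hu' : u = 0 := by linarith
        rw [hθ', hu', zero_smul, zero_add, one_smul]
        exact hqV
    · have hs : 0 < q.1 + q.2 := lt_of_le_of_lt (Nat.cast_nonneg N) g3
      set s := q.1 + q.2 with hsdef
      have hN0 : (0 : ℝ) ≤ N := Nat.cast_nonneg N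
      have hr := hc (hsub m1) (hsub m2) (div_nonneg g1 hs.le) (div_nonneg g2 hs.le)
        (by rw [← add_div, ← hsdef, div_self hs.ne'])
      have hsN : 0 < s - N := by linarith
      -- The ray through q crosses the line at (N / s) q, which lies between the two added vertices;
      -- θ q lies between that crossing and q, and these are its weights.
      have := hc hr hqV (show 0 ≤ s * (1 - θ) / (s - N) from
          div_nonneg (mul_nonneg hs.le (by linarith)) hsN.le)
        (show 0 ≤ (θ * s - N) / (s - N) from div_nonneg (by rw [hsdef]; linarith) hsN.le)
        (by field_simp; ring)
      convert this using 1
      have hsN' := hsN.ne'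
      ext
      · simp only [Prod.fst_add, Prod.smul_fst, smul_eq_mul, mul_zero, zero_add, add_zero]
        field_simp; ring
      · simp only [Prod.snd_add, Prod.smul_snd, smul_eq_mul, mul_zero, zero_add]
        field_simp; ring
  · refine convexHull_min ?_ ?_
    · rintro _ ⟨z, hz, rfl⟩
      rcases Finset.mem_union.1 (Finset.mem_coe.1 hz) with hz | hz
      · refine ⟨?_, ?_⟩
        · rw [hS]
          exact subset_convexHull ℝ _ (Set.mem_insert_of_mem _ ⟨z, hz, rfl⟩)
        · change (N : ℝ) ≤ (z.1 : ℝ) + z.2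
          exact_mod_cast (hFN z hz).2.2
      · simp only [Finset.mem_insert, Finset.mem_singleton] at hz
        rcases hz with rfl | rfl
        · refine ⟨by simpa [latticePoint] using h1, by simp [latticePoint]⟩
        · refine ⟨by simpa [latticePoint] using h2, by simp [latticePoint]⟩
    · exact hconv.inter
        (convex_halfSpace_ge (LinearMap.fst ℝ ℝ ℝ + LinearMap.snd ℝ ℝ ℝ).isLinear _)

theorem mem_interior_of_triangle {S : Set Plane} {a : ℝ}
    (hS : ∀ p : Plane, 0 ≤ p.1 → 0 ≤ p.2 → p.1 + p.2 ≤ a → p ∈ S) {p : Plane} (hx : 0 < p.1)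
    (hy : 0 < p.2) (hp : p.1 + p.2 < a) : p ∈ interior S := by
  refine mem_interior.2 ⟨{p | 0 < p.1} ∩ ({p | 0 < p.2} ∩ {p | p.1 + p.2 < a}), ?_, ?_,
    hx, hy, hp⟩
  · rintro q ⟨h1, h2, h3⟩
    exact hS q (le_of_lt h1) (le_of_lt h2) (le_of_lt h3)
  · exact (isOpen_lt continuous_const (by fun_prop)).inter
      ((isOpen_lt continuous_const (by fun_prop)).inter (isOpen_lt (by fun_prop) continuous_const))

/-! ### Concavity of `f` and the choice of `N` -/

section Graph

variable {a b : ℤ} {f : ℝ → ℝ}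

/-- The graph lies above the chord from (0, a) to (b, 0), whose slope -a/b is at least -1. -/
theorem le_add_of_concave (ha : 1 ≤ a) (hab : a ≤ b)
    (hconc : ConcaveOn ℝ (Set.Icc (0 : ℝ) (b : ℝ)) f) (hf0 : f 0 = (a : ℝ))
    (hfb : f (b : ℝ) = 0) {t : ℝ} (ht : t ∈ Set.Icc (0 : ℝ) (b : ℝ)) : (a : ℝ) ≤ t + f t := by
  have ha' : (1 : ℝ) ≤ a := by exact_mod_cast ha
  have hab' : (a : ℝ) ≤ b := by exact_mod_cast hab
  have hb : (0 : ℝ) < b := by linarith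
  have hu : 0 ≤ t / b := div_nonneg ht.1 hb.le
  have h1 := hconc.2 ⟨le_rfl, hb.le⟩ ⟨hb.le, le_rfl⟩
    (show 0 ≤ 1 - t / b by rw [sub_nonneg, div_le_one hb]; exact ht.2) hu (by ring)
  simp only [smul_eq_mul, mul_zero, zero_add] at h1
  rw [hf0, hfb, div_mul_cancel₀ t hb.ne'] at h1
  have h2 : t / b * a ≤ t := by
    calc t / b * a ≤ t / b * b := mul_le_mul_of_nonneg_left hab' hu
      _ = t := div_mul_cancel₀ t hb.ne'
  linarith

/-- By concavity, a value above `a` at some t ≥ 1 would force f(1) > a = f(0). -/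
theorem le_of_concave (hconc : ConcaveOn ℝ (Set.Icc (0 : ℝ) (b : ℝ)) f)
    (hf0 : f 0 = (a : ℝ)) (hf1 : f 1 ≤ (a : ℝ)) {t : ℝ} (ht1 : 1 ≤ t) (htb : t ≤ b) :
    f t ≤ a := by
  have ht0 : 0 < t := by linarith
  have hb0 : (0 : ℝ) ≤ b := by linarith
  have h1 := hconc.2 ⟨le_rfl, hb0⟩ ⟨ht0.le, htb⟩
    (show 0 ≤ 1 - 1 / t by rw [sub_nonneg, div_le_one ht0]; exact ht1)
    (show 0 ≤ 1 / t by positivity) (by ring)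
  simp only [smul_eq_mul, mul_zero, zero_add] at h1
  rw [hf0, div_mul_cancel₀ 1 ht0.ne'] at h1
  have h2 : 1 / t * (f t - a) ≤ 0 := by linarith
  have h3 : f t - a ≤ 0 := by
    by_contra hcon
    rw [not_le] at hcon
    have := mul_pos (show 0 < 1 / t by positivity) hcon
    linarith
  linarith

theorem exists_extendsTriangle (ha : 1 ≤ a) (hab : a ≤ b)
    (hconc : ConcaveOn ℝ (Set.Icc (0 : ℝ) (b : ℝ)) f)
    (hpl : IsLatticePiecewiseLinear f b)
    (hnonneg : ∀ t ∈ Set.Icc (0 : ℝ) (b : ℝ), 0 ≤ f t)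
    (hf0 : f 0 = (a : ℝ)) (hf1 : f 1 ≤ (a : ℝ)) (hfb : f (b : ℝ) = 0) :
    ∃ N : ℕ, ExtendsTriangle (hullOfGraph f b) N ∧
      ∀ z : ℤ × ℤ, latticePoint z ∈ interior (hullOfGraph f b) → z.2 + 1 ≤ (max N 1 : ℕ) := by
  obtain ⟨F, hFne, hS, hF⟩ := hpl.exists_finset (by omega)
  set S := hullOfGraph f b with hSdef
  have ha' : (1 : ℝ) ≤ a := by exact_mod_cast ha
  have hab' : (a : ℝ) ≤ b := by exact_mod_cast hab
  have hb0 : (0 : ℝ) ≤ b := by linarith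
  have hconv : Convex ℝ S := convex_convexHull ℝ _
  have hsub := subset_convexHull ℝ
    (insert ((0 : ℝ), (0 : ℝ)) ((fun t : ℝ => (t, f t)) '' Set.Icc (0 : ℝ) (b : ℝ)))
  have hgraph : ∀ t ∈ Set.Icc (0 : ℝ) (b : ℝ), ((t, f t) : Plane) ∈ S := fun t ht =>
    hsub (Set.mem_insert_of_mem _ ⟨t, ht, rfl⟩)
  have m0 : ((0, 0) : Plane) ∈ S := hsub (Set.mem_insert _ _)
  have m1 : ((0, (a : ℝ)) : Plane) ∈ S := hf0 ▸ hgraph 0 ⟨le_rfl, hb0⟩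
  have m2 : (((b : ℝ), 0) : Plane) ∈ S := hfb ▸ hgraph b ⟨hb0, le_rfl⟩
  have htri : ∀ p : Plane, 0 ≤ p.1 → 0 ≤ p.2 → p.1 + p.2 ≤ a → p ∈ S :=
    fun p hx hy hp => mem_of_triangle_corners hconv m0 hab' m1 m2 hx hy hp
  have hnn : ∀ p ∈ S, 0 ≤ p.1 ∧ 0 ≤ p.2 := by
    have : S ⊆ {p : Plane | 0 ≤ p.1} ∩ {p : Plane | 0 ≤ p.2} := by
      refine convexHull_min ?_ ((convex_halfSpace_ge (LinearMap.fst ℝ ℝ ℝ).isLinear 0).inter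
        (convex_halfSpace_ge (LinearMap.snd ℝ ℝ ℝ).isLinear 0))
      rintro p (rfl | ⟨t, ht, rfl⟩)
      · exact ⟨le_refl (0 : ℝ), le_refl (0 : ℝ)⟩
      · exact ⟨ht.1, hnonneg t ht⟩
    exact fun p hp => this hp
  have hle : ∀ t ∈ Set.Icc (0 : ℝ) (b : ℝ), (a : ℝ) ≤ t + f t := fun t ht =>
    le_add_of_concave ha hab hconc hf0 hfb ht
  have hFpos : ∀ z ∈ F, 0 ≤ z.1 ∧ 0 ≤ z.2 ∧ a ≤ z.1 + z.2 := by
    intro z hz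
    obtain ⟨h1, h2, h3⟩ := hF z hz
    have ht : (z.1 : ℝ) ∈ Set.Icc (0 : ℝ) (b : ℝ) := ⟨by exact_mod_cast h1, by exact_mod_cast h2⟩
    have h4 := hnonneg _ ht
    have h5 := hle _ ht
    rw [h3] at h4 h5
    exact ⟨h1, by exact_mod_cast h4, by exact_mod_cast h5⟩
  have build : ∀ N : ℕ, (N : ℤ) ≤ a → (∃ q ∈ interior S, (N : ℝ) < q.1 + q.2) →
      ExtendsTriangle S N := by
    intro N hN hq
    have hN' : (N : ℝ) ≤ a := by exact_mod_cast hN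
    refine ⟨hconv, hnn, fun p hx hy hp => htri p hx hy (hp.trans hN'), hq, ?_⟩
    refine isLatticePolygon_beyond hFne (fun z hz => ?_) hS
      (htri _ (Nat.cast_nonneg N) le_rfl (by simpa using hN'))
      (htri _ le_rfl (Nat.cast_nonneg N) (by simpa using hN'))
    obtain ⟨h1, h2, h3⟩ := hFpos z hz
    exact ⟨h1, h2, by omega⟩
  -- Either Δ reaches beyond the line x + y = a, and `N = a` works, or Δ is the triangle x + y ≤ a,
  -- and `N = a - 1` leaves a last strip with nonempty interior.
  by_cases hex : ∃ t ∈ Set.Icc (0 : ℝ) (b : ℝ), (a : ℝ) < t + f t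
  · obtain ⟨t, ht, hta⟩ := hex
    obtain ⟨N, hN⟩ := Int.eq_ofNat_of_zero_le (show 0 ≤ a by omega)
    have hNR : (N : ℝ) = a := by rw [hN]; simp
    refine ⟨N, build N hN.ge ?_, ?_⟩
    · have hz : (((a : ℝ) / 3, (a : ℝ) / 3) : Plane) ∈ interior S :=
        mem_interior_of_triangle htri (by simp only; linarith) (by simp only; linarith)
          (by simp only; linarith)
      set s := t + f t with hs
      have hs0 : 0 < s := by linarith
      -- A graph point at level s > a is moved slightly towards an interior point of the triangle.
      -- With this ε, its own share of the level is still (s + a) / 2, hence above a.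
      set ε := (s - a) / (2 * s) with hε
      have hε0 : 0 < ε := div_pos (by linarith) (by linarith)
      have hε1 : ε < 1 := by rw [hε, div_lt_one (by linarith)]; linarith
      have hεs : ε * s = (s - a) / 2 := by rw [hε]; field_simp
      refine ⟨ε • (((a : ℝ) / 3, (a : ℝ) / 3) : Plane) + (1 - ε) • ((t, f t) : Plane),
        hconv.openSegment_interior_self_subset_interior hz (hgraph t ht)
          ⟨ε, 1 - ε, hε0, by linarith, by ring, rfl⟩, ?_⟩
      rw [hNR]
      simp only [Prod.fst_add, Prod.snd_add, Prod.smul_fst, Prod.smul_snd, smul_eq_mul]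
      have e1 : (1 - ε) * t + (1 - ε) * f t = s - ε * s := by rw [hs]; ring
      have e2 : 0 < ε * (a / 3) := mul_pos hε0 (by linarith)
      linarith
    · intro z hz
      -- It suffices to bound the break points. Their abscissas are integers, so each is 0 or at
      -- least 1, where `f` is at most `a`.
      have hSa : ∀ p ∈ S, 0 * p.1 + 1 * p.2 ≤ (a : ℝ) := by
        have : S ⊆ {p : Plane | p.2 ≤ a} := by
          rw [hS]
          refine convexHull_min ?_ (convex_halfSpace_le (LinearMap.snd ℝ ℝ ℝ).isLinear _)
          rintro p (rfl | ⟨w, hw, rfl⟩)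
          · change (0 : ℝ) ≤ a; linarith
          · obtain ⟨h1, h2, h3⟩ := hF w hw
            change (w.2 : ℝ) ≤ a
            rw [← h3]
            rcases eq_or_lt_of_le h1 with h4 | h4
            · rw [← h4, Int.cast_zero, hf0]
            · exact le_of_concave hconc hf0 hf1 (by exact_mod_cast h4)
                (by exact_mod_cast h2)
        intro p hp
        have h1 : p.2 ≤ a := this hp
        linarith
      have h1 := lt_of_mem_interior hSa (Or.inr one_ne_zero) hz
      simp only [latticePoint, zero_mul, one_mul, zero_add] at h1
      have h1 : z.2 < a := by exact_mod_cast h1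
      have : (N : ℤ) ≤ (max N 1 : ℕ) := by exact_mod_cast le_max_left N 1
      omega
  · push Not at hex
    obtain ⟨N, hN⟩ := Int.eq_ofNat_of_zero_le (show 0 ≤ a - 1 by omega)
    have hNR : (N : ℝ) = a - 1 := by
      have : (N : ℤ) = a - 1 := hN.symm
      exact_mod_cast this
    refine ⟨N, build N (by omega) ⟨(((a : ℝ) - 1 / 2) / 2, ((a : ℝ) - 1 / 2) / 2),
      mem_interior_of_triangle htri ?_ ?_ ?_, ?_⟩, ?_⟩
    · simp only; linarith
    · simp only; linarith
    · simp only; linarith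
    · simp only; linarith
    · intro z hz
      -- An interior lattice point has x + y ≤ a - 1 and x ≥ 1, hence y ≤ a - 2 = N - 1.
      have hSa : ∀ p ∈ S, 1 * p.1 + 1 * p.2 ≤ (a : ℝ) := by
        have : S ⊆ {p : Plane | p.1 + p.2 ≤ a} := by
          refine convexHull_min ?_
            (convex_halfSpace_le (LinearMap.fst ℝ ℝ ℝ + LinearMap.snd ℝ ℝ ℝ).isLinear _)
          rintro p (rfl | ⟨t, ht, rfl⟩)
          · change (0 : ℝ) + 0 ≤ a; linarith
          · exact hex t ht
        intro p hp
        have h1 : p.1 + p.2 ≤ a := this hp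
        linarith
      have h1 := lt_of_mem_interior hSa (Or.inr one_ne_zero) hz
      have h2 := lt_of_mem_interior (α := -1) (β := 0) (γ := 0)
        (fun p hp => by linarith [(hnn p hp).1]) (by norm_num) hz
      simp only [latticePoint, one_mul] at h1 h2
      have h1 : z.1 + z.2 < a := by exact_mod_cast h1
      have h2 : 0 < z.1 := by
        have : (0 : ℝ) < z.1 := by linarith
        exact_mod_cast this
      have : (N : ℤ) ≤ (max N 1 : ℕ) := by exact_mod_cast le_max_left N 1
      omega

end Graph

/-- Let `S` be the convex hull of the origin and the graph of a concave piecewise linear lattice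
function `f` on `[0, b]` with `f 0 = a ≥ f 1`, `f b = 0` and `1 ≤ a ≤ b`. Then `S` is not equivalent
to the doubled triangle `twoUpsilon`, and `S` has a regular subdivision, realized by a convex function
with integral values at the lattice points and with all gcd's of adjacent cells equal to one,
such that the metric graph of the subdivision, and likewise the metric graph of the
realizing function, has gonality `latticeWidth (interiorPolygon S) + 2`. -/
theorem theorem11 (a b : ℤ) (ha : 1 ≤ a) (hab : a ≤ b) (f : ℝ → ℝ)
    (hconc : ConcaveOn ℝ (Set.Icc (0 : ℝ) (b : ℝ)) f)
    (hpl : IsLatticePiecewiseLinear f b)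
    (hnonneg : ∀ t ∈ Set.Icc (0 : ℝ) (b : ℝ), 0 ≤ f t)
    (hf0 : f 0 = (a : ℝ)) (hf1 : f 1 ≤ (a : ℝ)) (hfb : f (b : ℝ) = 0) :
    ¬ LatticeEquiv (hullOfGraph f b) twoUpsilon ∧
    ∃ R : RegularSubdivision (hullOfGraph f b),
      R.IsIntegral ∧
      R.metricGraph.IsGonality (latticeWidth (interiorPolygon (hullOfGraph f b)) + 2) ∧
      ∃ (n : Fin R.r → ℤ × ℤ) (hn : ∀ i, R.IsNormal i (n i)),
        (∀ i j, i ≠ j → 0 < R.intersectionLength i j → minorsGcd (n i) (n j) = 1) ∧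
        (R.metricGraphOfNormals n hn).IsGonality
          (latticeWidth (interiorPolygon (hullOfGraph f b)) + 2) := by
  have ha' : (0 : ℝ) < a := by exact_mod_cast (by omega : 0 < a)
  have hb' : (0 : ℝ) < b := by exact_mod_cast (by omega : 0 < b)
  obtain ⟨N, hN, hup⟩ := exists_extendsTriangle ha hab hconc hpl hnonneg hf0 hf1 hfb
  have hsub := subset_convexHull ℝ
    (insert ((0 : ℝ), (0 : ℝ)) ((fun t : ℝ => (t, f t)) '' Set.Icc (0 : ℝ) (b : ℝ)))
  refine ⟨not_latticeEquiv_twoUpsilon hN.nonneg ha' hb' (hsub (Set.mem_insert _ _))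
    (hsub (Set.mem_insert_of_mem _ ⟨0, ⟨le_rfl, hb'.le⟩, by simp only [hf0]⟩))
    (hsub (Set.mem_insert_of_mem _ ⟨b, ⟨hb'.le, le_rfl⟩, by simp only [hfb]⟩)), ?_⟩
  rw [hN.latticeWidth_interiorPolygon hup]
  exact ⟨hN.subdivision, hN.isIntegral, hN.isGonality_dualGraph _ _,
    fun i => (-(((i : Fin (N + 1)) : ℕ) : ℤ), -(((i : Fin (N + 1)) : ℕ) : ℤ)), hN.isNormal,
    hN.minorsGcd_eq_one, hN.isGonality_dualGraph _ _⟩
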